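/- Let $C_0>0$. There is a constant $C>0$, depending only on $C_0$, such that the following holds. Let $n\in\mathbb N$ and let $X_1,\dots,X_n$ be random variables with values in $\{0,1,2,\dots\}$ that are 1-dependent, i.e. for $1\le s<t\le n$ with $t-s>1$ the $\sigma$-algebras generated by $X_1,\dots,X_s$ and by $X_t,\dots,X_n$ are independent. Put $X_k\equiv 0$ for $k\le 0$, $S_n=X_1+\dots+X_n$, $F_n\{x\}=P(S_n=x)$, $\lambda=\mathbb E S_n$, $\Gamma_2=\frac12(\operatorname{Var}S_n-\mathbb E S_n)$, and $\nu_j(k)=\mathbb E X_k(X_k-1)\cdots(X_k-j+1)$. For random variables $Y_1,Y_2,Y_3$ let $$\hat E^+(Y_1,Y_2)=\mathbb E Y_1Y_2+\mathbb E Y_1\,\mathbb E Y_2,\qquad \hat E^+(Y_1,Y_2,Y_3)=\mathbb E Y_1Y_2Y_3+\mathbb E Y_1\,\mathbb E Y_2Y_3+\hat E^+(Y_1,Y_2)\,\mathbb E Y_3,$$ $$\hat E^+_2(Y_1,Y_2)=\hat E^+(Y_1(Y_1-1),Y_2)+\hat E^+(Y_1,Y_2(Y_2-1)),$$ and let $$R_0=\sum_{k=1}^n\{\nu_2(k)+\nu_1^2(k)+\mathbb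 E X_{k-1}X_k\},$$ $$R_1=\sum_{k=1}^n\{\nu_1^3(k)+\nu_1(k)\nu_2(k)+\nu_3(k)+[\nu_1(k-2)+\nu_1(k-1)+\nu_1(k)]\,\mathbb E X_{k-1}X_k+\hat E_2^+(X_{k-1},X_k)+\hat E^+(X_{k-2},X_{k-1},X_k)\}.$$ Assume $$\nu_1(k)\le \tfrac1{100},\quad \nu_2(k)\le\nu_1(k),\quad |X_k|\le C_0\ \text{ almost surely}\quad(k=1,\dots,n),$$ $$\lambda\ge 1,\quad \sum_{k=1}^n\nu_2(k)\le\frac{\lambda}{20},\quad \sum_{k=2}^n|\operatorname{Cov}(X_{k-1},X_k)|\le\frac{\lambda}{20}.$$ Write $z=e^{it}-1$. Consider the following (signed) measures. - $\Pi$: the Poisson distribution with parameter $\lambda$. $\Pi_1$: its second order difference times $\Gamma_2$, i.e. $\Pi_1\{x\}=\Gamma_2(\Pi\{x\}-2\Pi\{x-1\}+\Pi\{x-2\})$, with Fourier–Stieltjes transform $\Gamma_2z^2e^{\lambda z}$. - $G$: the signed measure on $\{0,1,2,\dots\}$ with Fourier–Stieltjes transform $\exp(\lambda z+\Gamma_2z^2)$.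 - $TP$: the law of $\lfloor-2\Gamma_2\rfloor+P$, where $P$ is Poisson with parameter $\lambda+2\Gamma_2+\tilde\delta$ and $\tilde\delta\in[0,1)$ is the fractional part of $-2\Gamma_2$. - If $\Gamma_2>0$, $NB\{j\}=\frac{\Gamma(r+j)}{j!\,\Gamma(r)}q^r(1-q)^j$ for $j=0,1,2,\dots$, where $r(1-q)/q=\lambda$ and $r((1-q)/q)^2=2\Gamma_2$. - If $\Gamma_2<0$, $BI$: the binomial distribution with $N=\lfloor\lambda^2/(2|\Gamma_2|)\rfloor$ trials and success probability $\bar p=\lambda/N$. Then, for every $x\in\{0,1,2,\dots\}$, $$\Big(1+\frac{(x-\lambda)^2}{\lambda}\Big)|F_n\{x\}-\Pi\{x\}|\le C\frac{R_0}{\lambda\sqrt\lambda},$$ $$\Big(1+\frac{(x-\lambda)^2}{\lambda}\Big)|F_n\{x\}-\Pi\{x\}-\Pi_1\{x\}|\le C\Big(\frac{R_0^2}{\lambda^2\sqrt\lambda}+\frac{R_1}{\lambda^2}\Big),$$ $$\Big(1+\frac{(x-\lambda)^2}{\lambda}\Big)|F_n\{x\}-G\{x\}|\le C\frac{R_1}{\lambda^2},$$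 $$\Big(1+\frac{(x-\lambda)^2}{\lambda}\Big)|F_n\{x\}-TP\{x\}|\le C\Big(\frac{R_1+|\Gamma_2|}{\lambda^2}+\frac{\tilde\delta}{\lambda\sqrt\lambda}\Big).$$ If in addition $\Gamma_2>0$, then $$\Big(1+\frac{(x-\lambda)^2}{\lambda}\Big)|F_n\{x\}-NB\{x\}|\le C\Big(\frac{R_1}{\lambda^2}+\frac{\Gamma_2^2}{\lambda^3}\Big);$$ if instead $\Gamma_2<0$, then $$\Big(1+\frac{(x-\lambda)^2}{\lambda}\Big)|F_n\{x\}-BI\{x\}|\le C\Big(\frac{R_1}{\lambda^2}+\frac{\Gamma_2^2}{\lambda^3}\Big).$$ -/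

import Mathlib

open MeasureTheory ProbabilityTheory

namespace OneDep

noncomputable section

/-! ### The summands -/

/-- The summand `X_k` as a real random variable, for every integer index `k`,
with the convention `X_k = 0` for `k ≤ 0`. -/
def rv {Ω : Type*} (X : ℕ → Ω → ℕ) (k : ℤ) : Ω → ℝ :=
  fun ω => if 0 < k then (X k.toNat ω : ℝ) else 0

/-- `X_1, …, X_n` are `m`-dependent: whenever `1 ≤ s`, `t - s > m` and `t ≤ n`, the σ-algebras
generated by `X_1, …, X_s` and by `X_t, …, X_n` are independent. -/
def MDependent {Ω : Type*} [MeasurableSpace Ω] (m n : ℕ) (X : ℕ → Ω → ℕ) (μ : Measure Ω) : Prop :=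
  ∀ s t : ℕ, 1 ≤ s → s + m < t → t ≤ n →
    Indep (⨆ i ∈ Finset.Icc 1 s, MeasurableSpace.comap (X i) ⊤)
      (⨆ i ∈ Finset.Icc t n, MeasurableSpace.comap (X i) ⊤) μ

/-- The sum `S_n = X_1 + ⋯ + X_n`. -/
def S {Ω : Type*} (X : ℕ → Ω → ℕ) (n : ℕ) : Ω → ℕ := fun ω => ∑ k ∈ Finset.Icc 1 n, X k ω

/-- The point probability `F_n{x} = P(S_n = x)`. -/
def pointF {Ω : Type*} [MeasurableSpace Ω] (X : ℕ → Ω → ℕ) (n : ℕ) (μ : Measure Ω) (x : ℕ) : ℝ :=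
  μ.real {ω | S X n ω = x}

/-- `λ = E S_n`. -/
def lam {Ω : Type*} [MeasurableSpace Ω] (X : ℕ → Ω → ℕ) (n : ℕ) (μ : Measure Ω) : ℝ :=
  ∫ ω, (S X n ω : ℝ) ∂μ

/-- `Γ₂ = (Var S_n - E S_n) / 2`. -/
def Gam {Ω : Type*} [MeasurableSpace Ω] (X : ℕ → Ω → ℕ) (n : ℕ) (μ : Measure Ω) : ℝ :=
  (Var[fun ω => (S X n ω : ℝ); μ] - lam X n μ) / 2

/-- The factorial moment `ν_j(k) = E X_k (X_k - 1) ⋯ (X_k - j + 1)`. -/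
def nu {Ω : Type*} [MeasurableSpace Ω] (X : ℕ → Ω → ℕ) (μ : Measure Ω) (j : ℕ) (k : ℤ) : ℝ :=
  ∫ ω, ∏ i ∈ Finset.range j, (rv X k ω - (i : ℝ)) ∂μ

/-! ### The quantities `Ê⁺` and the remainder terms -/

/-- `Ê⁺(Y₁, Y₂) = E Y₁Y₂ + E Y₁ E Y₂`. -/
def EPlusPair {Ω : Type*} [MeasurableSpace Ω] (μ : Measure Ω) (Y₁ Y₂ : Ω → ℝ) : ℝ :=
  ∫ ω, Y₁ ω * Y₂ ω ∂μ + (∫ ω, Y₁ ω ∂μ) * ∫ ω, Y₂ ω ∂μ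

/-- `Ê⁺(Y₁, Y₂, Y₃) = E Y₁Y₂Y₃ + Ê⁺(Y₁) E Y₂Y₃ + Ê⁺(Y₁, Y₂) E Y₃`, where `Ê⁺(Y₁) = E Y₁`. -/
def EPlusTriple {Ω : Type*} [MeasurableSpace Ω] (μ : Measure Ω) (Y₁ Y₂ Y₃ : Ω → ℝ) : ℝ :=
  ∫ ω, Y₁ ω * Y₂ ω * Y₃ ω ∂μ + (∫ ω, Y₁ ω ∂μ) * (∫ ω, Y₂ ω * Y₃ ω ∂μ)
    + EPlusPair μ Y₁ Y₂ * ∫ ω, Y₃ ω ∂μ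

/-- `Ê₂⁺(Y₁, Y₂) = Ê⁺(Y₁(Y₁ - 1), Y₂) + Ê⁺(Y₁, Y₂(Y₂ - 1))`. -/
def EPlusTwo {Ω : Type*} [MeasurableSpace Ω] (μ : Measure Ω) (Y₁ Y₂ : Ω → ℝ) : ℝ :=
  EPlusPair μ (fun ω => Y₁ ω * (Y₁ ω - 1)) Y₂ + EPlusPair μ Y₁ (fun ω => Y₂ ω * (Y₂ ω - 1))

/-- The remainder term `R₀`. -/
def R₀ {Ω : Type*} [MeasurableSpace Ω] (X : ℕ → Ω → ℕ) (n : ℕ) (μ : Measure Ω) : ℝ :=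
  ∑ k ∈ Finset.Icc (1 : ℤ) n,
    (nu X μ 2 k + nu X μ 1 k ^ 2 + ∫ ω, rv X (k - 1) ω * rv X k ω ∂μ)

/-- The remainder term `R₁`. -/
def R₁ {Ω : Type*} [MeasurableSpace Ω] (X : ℕ → Ω → ℕ) (n : ℕ) (μ : Measure Ω) : ℝ :=
  ∑ k ∈ Finset.Icc (1 : ℤ) n,
    (nu X μ 1 k ^ 3 + nu X μ 1 k * nu X μ 2 k + nu X μ 3 k
      + (nu X μ 1 (k - 2) + nu X μ 1 (k - 1) + nu X μ 1 k) * ∫ ω, rv X (k - 1) ω * rv X k ω ∂μ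
      + EPlusTwo μ (rv X (k - 1)) (rv X k)
      + EPlusTriple μ (rv X (k - 2)) (rv X (k - 1)) (rv X k))

/-! ### The approximating (signed) measures, given by their point masses

Here `l` stands for `λ = E S_n` and `g` for `Γ₂`. -/

/-- The Poisson distribution with parameter `l`, as a measure on `ℤ`: its mass at `k`. -/
def pois (l : ℝ) (k : ℤ) : ℝ :=
  if 0 ≤ k then (poissonMeasure l.toNNReal).real {k.toNat} else 0

/-- The second order difference of the Poisson distribution with parameter `l`, times `g`;
its Fourier-Stieltjes transform is `exp (l z) * g * z ^ 2` with `z = exp (i t) - 1`. -/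
def pois₁ (l g : ℝ) (k : ℤ) : ℝ :=
  g * (pois l k - 2 * pois l (k - 1) + pois l (k - 2))

/-- The mass at `x` of the compound Poisson signed measure with Fourier-Stieltjes transform
`exp (l z + g z ^ 2)`, `z = exp (i t) - 1` (see `hasSum_compPois`): the coefficient of `w ^ x` in
`exp (l (w - 1) + g (w - 1) ^ 2) = exp (g - l) * exp ((l - 2 g) w) * exp (g w ^ 2)`. -/
def compPois (l g : ℝ) (x : ℕ) : ℝ :=
  ∑ j ∈ Finset.range (x / 2 + 1),
    Real.exp (g - l) * ((l - 2 * g) ^ (x - 2 * j) / (x - 2 * j).factorial)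
      * (g ^ j / j.factorial)

/-- The translated Poisson distribution, i.e. the law of `⌊-2g⌋ + P` where `P` is Poisson with
parameter `l + 2g + δ` and `δ` is the fractional part of `-2g`: its mass at `k`. -/
def transPois (l g : ℝ) (k : ℤ) : ℝ :=
  pois (l + 2 * g + Int.fract (-2 * g)) (k - ⌊-2 * g⌋)

/-- The parameter `q` of the negative binomial approximation. -/
def nbQ (l g : ℝ) : ℝ := l / (l + 2 * g)

/-- The parameter `r` of the negative binomial approximation. -/
def nbR (l g : ℝ) : ℝ := l ^ 2 / (2 * g)

/-- The negative binomial distribution with parameters `r`, `q`: its mass at `j`. -/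
def negBin (r q : ℝ) (j : ℕ) : ℝ :=
  Real.Gamma (r + j) / (j.factorial * Real.Gamma r) * q ^ r * (1 - q) ^ j

/-- The number of trials `N = ⌊l² / (2|g|)⌋` of the binomial approximation. -/
def biN (l g : ℝ) : ℕ := ⌊l ^ 2 / (2 * |g|)⌋₊

/-- The binomial distribution with `N` trials and success probability `p`: its mass at `j`. -/
def binom (N : ℕ) (p : ℝ) (j : ℕ) : ℝ := N.choose j * p ^ j * (1 - p) ^ (N - j)

/-! ### The approximations satisfy their defining relations -/

/-- `q` and `r` are determined by `r(1-q)/q = l` and `r((1-q)/q)² = 2g`. -/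
theorem nb_param {l g : ℝ} (hl : 0 < l) (hg : 0 < g) (r q : ℝ) :
    (r * (1 - q) / q = l ∧ r * ((1 - q) / q) ^ 2 = 2 * g) ↔ (r = nbR l g ∧ q = nbQ l g) := by
  have h0 : l + 2 * g ≠ 0 := by positivity
  constructor
  · rintro ⟨h1, h2⟩
    have hq : q ≠ 0 := by
      rintro rfl
      simp at h1
      exact hl.ne h1
    have h3 : l * ((1 - q) / q) = 2 * g := by rw [← h2, ← h1]; ring
    have h4 : l * (1 - q) = 2 * g * q := by
      field_simp at h3
      linarith
    have h5 : q = nbQ l g := by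
      unfold nbQ
      rw [eq_div_iff h0]
      linarith
    refine ⟨?_, h5⟩
    have h6 : (1 - q) / q = 2 * g / l := by
      rw [eq_div_iff hl.ne']
      linarith
    rw [mul_div_assoc, h6] at h1
    unfold nbR
    field_simp at h1 ⊢
    linarith
  · rintro ⟨rfl, rfl⟩
    have h6 : (1 - nbQ l g) / nbQ l g = 2 * g / l := by
      unfold nbQ
      field_simp
      ring
    rw [mul_div_assoc, h6]
    unfold nbR
    constructor <;> field_simp

theorem compPois_exp_mul (l g : ℝ) (w : ℂ) (x : ℕ) :
    w ^ x * (compPois l g x : ℂ)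
      = ∑ j ∈ Finset.range (x / 2 + 1), Complex.exp (g - l)
          * (((l - 2 * g) * w) ^ (x - 2 * j) / ((x - 2 * j).factorial : ℂ)
            * ((g * w ^ 2) ^ j / (j.factorial : ℂ))) := by
  unfold compPois
  push_cast
  rw [Finset.mul_sum]
  refine Finset.sum_congr rfl fun j hj => ?_
  have hj' : x = x - 2 * j + 2 * j := by
    have := Finset.mem_range.mp hj
    omega
  have hwx : w ^ x = w ^ (x - 2 * j) * (w ^ 2) ^ j := by
    rw [← pow_mul, ← pow_add, ← hj']
  rw [hwx, mul_pow, mul_pow]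
  ring

/-- The fibre sums of a family on `ℕ × ℕ` along `(i, j) ↦ i + 2 j`. -/
theorem tsum_fib (f : ℕ × ℕ → ℂ) (x : ℕ) :
    ∑' p : ((fun p : ℕ × ℕ => p.1 + 2 * p.2) ⁻¹' {x}), f p
      = ∑ j ∈ Finset.range (x / 2 + 1), f (x - 2 * j, j) := by
  have hfib : (fun p : ℕ × ℕ => p.1 + 2 * p.2) ⁻¹' {x}
      = ↑((Finset.range (x / 2 + 1)).image (fun j => (x - 2 * j, j))) := by
    ext ⟨i, j⟩
    simp only [Set.mem_preimage, Set.mem_singleton_iff, Finset.coe_image, Set.mem_image,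
      Finset.coe_range, Set.mem_Iio, Prod.mk.injEq]
    constructor
    · intro h
      exact ⟨j, by omega, by omega, rfl⟩
    · rintro ⟨j', h, h', rfl⟩
      omega
  rw [hfib, Finset.tsum_subtype', Finset.sum_image (by intro u _ v _ h; exact (Prod.mk.inj h).2)]

theorem summable_mul_aux (f g : ℕ → ℂ) (hf : Summable (fun i => ‖f i‖))
    (hg : Summable (fun i => ‖g i‖)) : Summable (fun p : ℕ × ℕ => f p.1 * g p.2) :=
  summable_mul_of_summable_norm hf hg

theorem exp_norm_summable (y : ℂ) : Summable (fun i : ℕ => ‖y ^ i / (i.factorial : ℂ)‖) := by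
  simpa only [norm_div, norm_pow, Complex.norm_natCast] using Real.summable_pow_div_factorial ‖y‖

theorem exp_mul_summable (u v : ℂ) :
    Summable (fun p : ℕ × ℕ => u ^ p.1 / (p.1.factorial : ℂ) * (v ^ p.2 / (p.2.factorial : ℂ))) :=
  summable_mul_aux (fun i => u ^ i / (i.factorial : ℂ)) (fun i => v ^ i / (i.factorial : ℂ))
    (exp_norm_summable u) (exp_norm_summable v)

/-- The masses `compPois l g` have the Fourier-Stieltjes transform `exp (l z + g z ^ 2)`. -/
theorem hasSum_compPois (l g t : ℝ) :
    HasSum (fun x : ℕ => Complex.exp (Complex.I * t) ^ x * (compPois l g x : ℂ))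
      (Complex.exp (l * (Complex.exp (Complex.I * t) - 1)
        + g * (Complex.exp (Complex.I * t) - 1) ^ 2)) := by
  generalize Complex.exp (Complex.I * t) = w
  have hexp : ∀ y : ℂ, HasSum (fun i : ℕ => y ^ i / (i.factorial : ℂ)) (Complex.exp y) := by
    intro y
    rw [Complex.exp_eq_exp_ℂ]
    exact NormedSpace.expSeries_div_hasSum_exp y
  have hs := exp_mul_summable ((l - 2 * g) * w) (g * w ^ 2)
  have h1 := (hexp ((l - 2 * g) * w)).mul (hexp (g * w ^ 2)) hs
  have h2 := (h1.mul_left (Complex.exp (g - l))).tsum_fiberwise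
    (fun p : ℕ × ℕ => p.1 + 2 * p.2)
  have h3 : Complex.exp (l * (w - 1) + g * (w - 1) ^ 2)
      = Complex.exp (g - l) * (Complex.exp ((l - 2 * g) * w) * Complex.exp (g * w ^ 2)) := by
    rw [← Complex.exp_add, ← Complex.exp_add]
    congr 1
    ring
  rw [h3]
  have h4 : ∀ x : ℕ, w ^ x * (compPois l g x : ℂ) = _ := fun x =>
    (compPois_exp_mul l g w x).trans (tsum_fib (fun p : ℕ × ℕ => Complex.exp (g - l)
      * (((l - 2 * g) * w) ^ p.1 / (p.1.factorial : ℂ)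
        * ((g * w ^ 2) ^ p.2 / (p.2.factorial : ℂ)))) x).symm
  rw [funext h4]
  exact h2

end

end OneDep

open OneDep

/-!
By Heinrich's expansion, the generating functions `f k` of the partial sums `S_k` at `w = 1 + z`
satisfy `f (k + 1) - f k = ∑ j ≥ 1, f (k - j) * D j (k + 1)`, where `D j k` is the expectation of
the product of the factors `w ^ X_i - 1` over the last `j` indices `i ≤ k`. By 1-dependence these
expectations decay geometrically in `j`, so the ratios `f (k + 1) / f k` are close to `1` and have a
second order expansion in `z`. Multiplying the ratios, the transform of `S_n` is
`exp (λ z + Γ₂ z ^ 2)` up to an error of order `R₁ * ‖z‖ ^ 3` times a Gaussian factor; the transform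
of each approximating law is compared with `exp (λ z + Γ₂ z ^ 2)` directly.

All this is done for `z = e ^ s - 1` with `s` in a strip of width of order `1 / √λ` around the
imaginary axis. Fourier inversion along the lines `re s = ± ε / √λ` then gives the local estimates
with the extra factor `exp (-ε |x - λ| / √λ)`, which absorbs the weight `1 + (x - λ) ^ 2 / λ`.
-/

namespace OneDep

/-! ### Inversion of bilateral Laplace transforms -/

section Inversion

open Complex Real intervalIntegral

/-- `a` has the bilateral Laplace transform `P s = ∑ₖ a k * e ^ (k s)` on the strip `|re s| ≤ 1`.
On `re s = 0` this is the Fourier-Stieltjes transform; leaving the imaginary axis is what gives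
non-uniform bounds. -/
def HasTransform (a : ℤ → ℝ) (P : ℂ → ℂ) : Prop :=
  ∀ s : ℂ, |s.re| ≤ 1 → HasSum (fun k : ℤ => (a k : ℂ) * exp (k * s)) (P s)

theorem integral_exp_int_mul_I (m : ℤ) :
    ∫ t in (-π)..π, Complex.exp (m * (t * I)) = if m = 0 then 2 * (π : ℂ) else 0 := by
  split_ifs with hm
  · subst hm
    simp only [Int.cast_zero, zero_mul, Complex.exp_zero, intervalIntegral.integral_const,
      real_smul, mul_one]
    push_cast
    ring
  · have hc : (m * I : ℂ) ≠ 0 := by simp [hm]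
    simp_rw [mul_comm (_ : ℂ) I, ← mul_assoc]
    rw [integral_exp_mul_complex hc, div_eq_zero_iff, sub_eq_zero,
      Complex.exp_eq_exp_iff_exists_int]
    exact Or.inl ⟨m, by push_cast; ring⟩

theorem norm_exp_intCast_mul (k : ℤ) (s : ℂ) : ‖exp (k * s)‖ = Real.exp (k * s.re) := by
  simp [Complex.norm_exp]

theorem HasTransform.summable_abs_mul_exp {a : ℤ → ℝ} {P : ℂ → ℂ} (ha : HasTransform a P) {h : ℝ}
    (hh : |h| ≤ 1) : Summable fun k : ℤ => |a k| * Real.exp (k * h) := by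
  simpa [norm_exp_intCast_mul] using (ha h (by simpa using hh)).summable.norm

theorem HasTransform.integral_mul_exp_neg {a : ℤ → ℝ} {P : ℂ → ℂ} (ha : HasTransform a P) {h : ℝ}
    (hh : |h| ≤ 1) (x : ℤ) :
    ∫ t in (-π)..π, P (h + t * I) * exp (-(x * (h + t * I))) = 2 * π * a x := by
  have hre (t : ℝ) : ((h : ℂ) + t * I).re = h := by simp
  have hexp (k : ℤ) (t : ℝ) : exp (k * (h + t * I)) * exp (-(x * (h + t * I)))
      = exp (((k - x : ℤ) : ℂ) * h) * exp (((k - x : ℤ) : ℂ) * (t * I)) := by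
    rw [← Complex.exp_add, ← Complex.exp_add]
    push_cast
    ring_nf
  have hnorm (k : ℤ) (t : ℝ) : ‖(a k : ℂ) * exp (k * (h + t * I)) * exp (-(x * (h + t * I)))‖
      = |a k| * Real.exp (k * h) * Real.exp (-(x * h)) := by
    rw [norm_mul, norm_mul, norm_exp_intCast_mul, Complex.norm_exp, norm_real, Real.norm_eq_abs]
    simp
  have hsum : HasSum
      (fun k : ℤ => ∫ t in (-π)..π,
        (a k : ℂ) * exp (k * (h + t * I)) * exp (-(x * (h + t * I))))
      (∫ t in (-π)..π, P (h + t * I) * exp (-(x * (h + t * I)))) := by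
    refine hasSum_integral_of_dominated_convergence
      (fun k _ => |a k| * Real.exp (k * h) * Real.exp (-(x * h)))
      (fun k => (by fun_prop : Continuous _).aestronglyMeasurable)
      (fun k => .of_forall fun t _ => (hnorm k t).le)
      (.of_forall fun t _ => (ha.summable_abs_mul_exp hh).mul_right _) (by simp)
      (.of_forall fun t _ => (ha _ (by rwa [hre])).mul_right _)
  refine hsum.unique ((hasSum_ite_eq x (2 * (π : ℂ) * a x)).congr_fun fun k => ?_)
  simp_rw [mul_assoc, hexp]
  rw [intervalIntegral.integral_const_mul, intervalIntegral.integral_const_mul,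
    integral_exp_int_mul_I]
  rcases eq_or_ne k x with rfl | hk
  · simp; ring
  · simp [hk, sub_ne_zero.mpr hk]

theorem integrable_one_add_abs_pow_mul_exp_neg_mul_sq {c : ℝ} (hc : 0 < c) (d : ℕ) :
    Integrable fun v : ℝ => (1 + |v|) ^ d * Real.exp (-c * v ^ 2) := by
  have hmoment (e : ℕ) : Integrable fun v : ℝ => |v| ^ e * Real.exp (-c * v ^ 2) := by
    have h := integrable_rpow_mul_exp_neg_mul_sq hc (s := e)
      (neg_one_lt_zero.trans_le e.cast_nonneg)
    simpa [Real.rpow_natCast] using h.norm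
  simp_rw [add_pow, one_pow, one_mul, Finset.sum_mul, mul_right_comm _ _ (Real.exp _)]
  exact integrable_finsetSum _ fun e _ => (hmoment _).mul_const _

theorem setIntegral_one_add_mul_abs_pow_mul_exp_le {c q : ℝ} (hc : 0 < c) (hq : 0 < q) (d : ℕ)
    (s : Set ℝ) :
    ∫ t in s, (1 + q * |t|) ^ d * Real.exp (-c * (q * t) ^ 2)
      ≤ (∫ v : ℝ, (1 + |v|) ^ d * Real.exp (-c * v ^ 2)) / q := by
  have hint := integrable_one_add_abs_pow_mul_exp_neg_mul_sq hc d
  have hscale (t : ℝ) : (1 + q * |t|) ^ d * Real.exp (-c * (q * t) ^ 2)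
      = (1 + |q * t|) ^ d * Real.exp (-c * (q * t) ^ 2) := by
    rw [abs_mul, abs_of_pos hq]
  simp_rw [hscale]
  calc _ ≤ ∫ t : ℝ, (1 + |q * t|) ^ d * Real.exp (-c * (q * t) ^ 2) :=
        setIntegral_le_integral (hint.comp_mul_left' hq.ne') (.of_forall fun t => by positivity)
    _ = _ := by
        rw [Measure.integral_comp_mul_left fun v : ℝ => (1 + |v|) ^ d * Real.exp (-c * v ^ 2),
          abs_of_pos (inv_pos.mpr hq), smul_eq_mul, inv_mul_eq_div]

theorem sum_mul_norm_pow_le {q h t : ℝ} (hq : 0 < q) (hh : |h| ≤ 1 / q) {A : ℕ → ℝ}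
    (hA : ∀ m, 0 ≤ A m) (d : ℕ) :
    ∑ m ∈ Finset.range (d + 1), A m * ‖(h : ℂ) + t * I‖ ^ m
      ≤ (∑ m ∈ Finset.range (d + 1), A m / q ^ m) * (1 + q * |t|) ^ d := by
  have hnorm : ‖(h : ℂ) + t * I‖ ≤ (1 + q * |t|) / q := by
    calc ‖(h : ℂ) + t * I‖ ≤ |h| + |t| := by
          simpa using norm_add_le (h : ℂ) (t * I)
      _ ≤ 1 / q + |t| := by gcongr
      _ = (1 + q * |t|) / q := by field_simp
  rw [Finset.sum_mul]
  refine Finset.sum_le_sum fun m hm => ?_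
  calc A m * ‖(h : ℂ) + t * I‖ ^ m ≤ A m * ((1 + q * |t|) / q) ^ m := by
        gcongr
        exact hA m
    _ = A m / q ^ m * (1 + q * |t|) ^ m := by rw [div_pow]; ring
    _ ≤ A m / q ^ m * (1 + q * |t|) ^ d := by
        gcongr
        · exact div_nonneg (hA m) (by positivity)
        · linarith [mul_nonneg hq.le (abs_nonneg t)]
        · exact Finset.mem_range_succ_iff.mp hm

theorem norm_mul_exp_neg_le {w : ℂ} {l h b c t : ℝ} (hl : 0 < l) (hh : |h| ≤ 1 / √l) {A : ℕ → ℝ}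
    (hA : ∀ m, 0 ≤ A m) {d : ℕ}
    (hw : ‖w‖ ≤ (∑ m ∈ Finset.range (d + 1), A m * ‖(h : ℂ) + t * I‖ ^ m)
      * Real.exp (l * h + b - c * l * t ^ 2)) (x : ℤ) :
    ‖w * exp (-(x * (h + t * I)))‖
      ≤ (∑ m ∈ Finset.range (d + 1), A m / √l ^ m) * (Real.exp b * Real.exp ((l - x) * h))
        * ((1 + √l * |t|) ^ d * Real.exp (-c * (√l * t) ^ 2)) := by
  have hexp : Real.exp (l * h + b - c * l * t ^ 2) * Real.exp (-(x * h))
      = Real.exp b * Real.exp ((l - x) * h) * Real.exp (-c * (√l * t) ^ 2) := by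
    rw [← Real.exp_add, ← Real.exp_add, ← Real.exp_add, mul_pow, Real.sq_sqrt hl.le]
    ring_nf
  have hnorm : ‖exp (-(x * (h + t * I)))‖ = Real.exp (-(x * h)) := by simp [Complex.norm_exp]
  calc _ ≤ (∑ m ∈ Finset.range (d + 1), A m / √l ^ m) * (1 + √l * |t|) ^ d
        * Real.exp (l * h + b - c * l * t ^ 2) * Real.exp (-(x * h)) := by
        rw [norm_mul, hnorm]
        gcongr
        exact hw.trans (by gcongr; exact sum_mul_norm_pow_le (Real.sqrt_pos.mpr hl) hh hA d)
    _ = _ := by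
        rw [mul_assoc, hexp]
        ring

theorem HasTransform.abs_apply_le {a : ℤ → ℝ} {P : ℂ → ℂ} (ha : HasTransform a P)
    {l h b c : ℝ} (hl : 1 ≤ l) (hc : 0 < c) (hh : |h| ≤ 1 / √l) {A : ℕ → ℝ} (hA : ∀ m, 0 ≤ A m)
    {d : ℕ}
    (hP : ∀ t : ℝ, |t| ≤ π → ‖P (h + t * I)‖
      ≤ (∑ m ∈ Finset.range (d + 1), A m * ‖(h : ℂ) + t * I‖ ^ m)
        * Real.exp (l * h + b - c * l * t ^ 2)) (x : ℤ) :
    |a x| ≤ Real.exp b * (∫ v : ℝ, (1 + |v|) ^ d * Real.exp (-c * v ^ 2))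
      * (∑ m ∈ Finset.range (d + 1), A m / √l ^ (m + 1)) * Real.exp ((l - x) * h) := by
  set q := √l
  have hq1 : 1 ≤ q := Real.one_le_sqrt.mpr hl
  have hq : 0 < q := by linarith
  set B := ∑ m ∈ Finset.range (d + 1), A m / q ^ m with hB
  have hB0 : 0 ≤ B := Finset.sum_nonneg fun m _ => div_nonneg (hA m) (by positivity)
  set K := B * (Real.exp b * Real.exp ((l - x) * h)) with hK
  have hpi : -π ≤ π := by linarith [Real.pi_pos]
  have hint : Integrable fun t : ℝ => (1 + q * |t|) ^ d * Real.exp (-c * (q * t) ^ 2) := by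
    simpa [abs_mul, abs_of_pos hq] using
      (integrable_one_add_abs_pow_mul_exp_neg_mul_sq hc d).comp_mul_left' hq.ne'
  have hbound : 2 * π * |a x| ≤ K * ((∫ v : ℝ, (1 + |v|) ^ d * Real.exp (-c * v ^ 2)) / q) := by
    calc 2 * π * |a x| = ‖∫ t in (-π)..π, P (h + t * I) * exp (-(x * (h + t * I)))‖ := by
          rw [ha.integral_mul_exp_neg (hh.trans ((div_le_one hq).mpr hq1))]
          simp [abs_of_pos Real.pi_pos]
      _ ≤ ∫ t in (-π)..π, K * ((1 + q * |t|) ^ d * Real.exp (-c * (q * t) ^ 2)) :=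
          norm_integral_le_of_norm_le hpi
            (.of_forall fun t ht => norm_mul_exp_neg_le (by linarith) hh hA
              (hP t (abs_le.mpr ⟨ht.1.le, ht.2⟩)) x)
            (hint.const_mul K).intervalIntegrable
      _ ≤ _ := by
          rw [intervalIntegral.integral_const_mul, intervalIntegral.integral_of_le hpi]
          gcongr
          exact setIntegral_one_add_mul_abs_pow_mul_exp_le hc hq d _
  calc |a x| ≤ 2 * π * |a x| :=
        le_mul_of_one_le_left (abs_nonneg _) (by linarith [Real.pi_gt_three])
    _ ≤ _ := hbound
    _ = _ := by
        simp_rw [hK, hB, pow_succ, ← div_div, ← Finset.sum_div]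
        ring

theorem one_add_sq_mul_exp_neg_le {ε u : ℝ} (hε : 0 < ε) (hu : 0 ≤ u) :
    (1 + u ^ 2) * Real.exp (-(ε * u)) ≤ 1 + 2 / ε ^ 2 := by
  have hquad : 1 + (ε * u) ^ 2 / 2 ≤ Real.exp (ε * u) := by
    linarith [Real.quadratic_le_exp_of_nonneg (mul_nonneg hε.le hu), mul_nonneg hε.le hu]
  rw [Real.exp_neg, ← div_eq_mul_inv, div_le_iff₀ (Real.exp_pos _)]
  calc 1 + u ^ 2 ≤ 1 + u ^ 2 + (2 / ε ^ 2 + (ε * u) ^ 2 / 2) :=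
        le_add_of_nonneg_right (by positivity)
    _ = (1 + 2 / ε ^ 2) * (1 + (ε * u) ^ 2 / 2) := by field_simp; ring
    _ ≤ _ := by gcongr

theorem exists_abs_eq_mul_eq_neg (r : ℝ) {δ : ℝ} (hδ : 0 ≤ δ) :
    ∃ h : ℝ, |h| = δ ∧ r * h = -(|r| * δ) := by
  rcases le_total 0 r with hr | hr
  · exact ⟨-δ, by rw [abs_neg, abs_of_nonneg hδ], by rw [abs_of_nonneg hr]; ring⟩
  · exact ⟨δ, abs_of_nonneg hδ, by rw [abs_of_nonpos hr]; ring⟩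

/-- Inverting along `re s = ± ε / √l`, with the sign of `l - x`, gains `exp (-ε |x - l| / √l)`,
which absorbs the weight. -/
theorem exists_weighted_bound {ε c : ℝ} (hε : 0 < ε) (hε1 : ε ≤ 1) (hc : 0 < c) (b : ℝ) (d : ℕ) :
    ∃ C : ℝ, 0 < C ∧ ∀ (l : ℝ) (A : ℕ → ℝ) (a : ℤ → ℝ) (P : ℂ → ℂ), 1 ≤ l → (∀ m, 0 ≤ A m) →
      HasTransform a P →
      (∀ s : ℂ, |s.re| = ε / √l → |s.im| ≤ π → ‖P s‖
        ≤ (∑ m ∈ Finset.range (d + 1), A m * ‖s‖ ^ m)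
          * Real.exp (l * s.re + b - c * l * s.im ^ 2)) →
      ∀ x : ℤ, (1 + ((x : ℝ) - l) ^ 2 / l) * |a x|
        ≤ C * ∑ m ∈ Finset.range (d + 1), A m / √l ^ (m + 1) := by
  set M := ∫ v : ℝ, (1 + |v|) ^ d * Real.exp (-c * v ^ 2)
  have : 0 ≤ M := integral_nonneg fun v => by positivity
  refine ⟨(1 + 2 / ε ^ 2) * (Real.exp b * (M + 1)), by positivity,
    fun l A a P hl hA ha hP x => ?_⟩
  have : 0 < √l := Real.sqrt_pos.mpr (by linarith)
  obtain ⟨h, hh, hxh⟩ := exists_abs_eq_mul_eq_neg (l - x) (δ := ε / √l) (by positivity)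
  set u := |(x : ℝ) - l| / √l with hu
  have hweight : 1 + ((x : ℝ) - l) ^ 2 / l = 1 + u ^ 2 := by
    rw [hu, div_pow, sq_abs, Real.sq_sqrt (by linarith)]
  have htilt : (l - x) * h = -(ε * u) := by
    rw [hxh, abs_sub_comm, hu]
    ring
  have hax := ha.abs_apply_le (b := b) hl hc (hh.trans_le (by gcongr)) hA (fun t ht => by
    simpa using hP (h + t * I) (by simpa using hh) (by simpa using ht)) x
  rw [htilt] at hax
  have hS : 0 ≤ ∑ m ∈ Finset.range (d + 1), A m / √l ^ (m + 1) :=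
    Finset.sum_nonneg fun m _ => div_nonneg (hA m) (by positivity)
  rw [hweight]
  calc (1 + u ^ 2) * |a x|
      ≤ (1 + u ^ 2) * (Real.exp b * M * (∑ m ∈ Finset.range (d + 1), A m / √l ^ (m + 1))
          * Real.exp (-(ε * u))) := by gcongr
    _ = (1 + u ^ 2) * Real.exp (-(ε * u)) * (Real.exp b * M)
          * ∑ m ∈ Finset.range (d + 1), A m / √l ^ (m + 1) := by ring
    _ ≤ (1 + 2 / ε ^ 2) * (Real.exp b * (M + 1))
          * ∑ m ∈ Finset.range (d + 1), A m / √l ^ (m + 1) := by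
        gcongr
        · exact one_add_sq_mul_exp_neg_le hε (by positivity)
        · linarith

end Inversion

/-! ### Transforms of the approximating laws -/

section Transforms

open Complex

variable {a b : ℤ → ℝ} {P Q : ℂ → ℂ}

theorem HasTransform.congr (ha : HasTransform a P) (hb : ∀ k, b k = a k) (hQ : ∀ s, Q s = P s) :
    HasTransform b Q := by
  rwa [funext hb, funext hQ]

theorem HasTransform.const_mul (ha : HasTransform a P) (c : ℝ) :
    HasTransform (fun k => c * a k) (fun s => c * P s) := fun s hs =>
  ((ha s hs).mul_left (c : ℂ)).congr_fun fun k => by push_cast; ring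

theorem HasTransform.add (ha : HasTransform a P) (hb : HasTransform b Q) :
    HasTransform (fun k => a k + b k) (fun s => P s + Q s) := fun s hs =>
  ((ha s hs).add (hb s hs)).congr_fun fun k => by push_cast; ring

theorem HasTransform.sub (ha : HasTransform a P) (hb : HasTransform b Q) :
    HasTransform (fun k => a k - b k) (fun s => P s - Q s) := fun s hs =>
  ((ha s hs).sub (hb s hs)).congr_fun fun k => by push_cast; ring

theorem HasTransform.shift (ha : HasTransform a P) (m : ℤ) :
    HasTransform (fun k => a (k - m)) (fun s => exp (m * s) * P s) := by
  intro s hs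
  have h := (ha s hs).mul_left (exp (m * s))
  rw [← (Equiv.subRight m).hasSum_iff] at h
  refine h.congr_fun fun k => ?_
  simp only [Function.comp, Equiv.subRight_apply]
  rw [mul_left_comm, ← Complex.exp_add]
  congr 2
  push_cast
  ring

/-- Extension by zero of a sequence on `ℕ` to `ℤ`, so that laws on `ℕ` and on `ℤ` have transforms
in the same sense. -/
noncomputable def zeroExt (a : ℕ → ℝ) (k : ℤ) : ℝ := if 0 ≤ k then a k.toNat else 0

theorem zeroExt_natCast (a : ℕ → ℝ) (x : ℕ) : zeroExt a (x : ℤ) = a x := by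
  simp [zeroExt]

theorem hasTransform_zeroExt {a : ℕ → ℝ}
    (h : ∀ s : ℂ, |s.re| ≤ 1 → HasSum (fun n : ℕ => (a n : ℂ) * exp s ^ n) (P s)) :
    HasTransform (zeroExt a) P := by
  intro s hs
  rw [← (Nat.cast_injective : Function.Injective (Nat.cast : ℕ → ℤ)).hasSum_iff]
  · exact (h s hs).congr_fun fun n => by
      simp [zeroExt_natCast, ← Complex.exp_nat_mul]
  · intro k hk
    have hneg : ¬ 0 ≤ k := fun h0 => hk ⟨k.toNat, Int.toNat_of_nonneg h0⟩
    simp [zeroExt, hneg]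

theorem hasSum_pow_div_factorial (y : ℂ) : HasSum (fun n : ℕ => y ^ n / n.factorial) (exp y) := by
  rw [Complex.exp_eq_exp_ℂ]
  exact NormedSpace.expSeries_div_hasSum_exp y

theorem hasTransform_pois {l : ℝ} (hl : 0 ≤ l) :
    HasTransform (pois l) (fun s => exp (l * (exp s - 1))) := by
  change HasTransform (zeroExt fun n => (poissonMeasure l.toNNReal).real {n}) _
  refine hasTransform_zeroExt fun s _ => ?_
  have h := (hasSum_pow_div_factorial (l * exp s)).mul_left (exp (-l))
  rw [← Complex.exp_add, show -(l : ℂ) + l * exp s = l * (exp s - 1) by ring] at h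
  refine h.congr_fun fun n => ?_
  rw [poissonMeasure_real_singleton, Real.coe_toNNReal _ hl]
  push_cast
  ring

theorem hasTransform_pois₁ {l : ℝ} (hl : 0 ≤ l) (g : ℝ) :
    HasTransform (pois₁ l g) (fun s => g * (exp s - 1) ^ 2 * exp (l * (exp s - 1))) := by
  have h := hasTransform_pois hl
  refine (((h.add ((h.shift 1).const_mul (-2))).add (h.shift 2)).const_mul g).congr
    (fun k => by unfold pois₁; ring) fun s => ?_
  have hexp : exp ((2 : ℤ) * s) = exp s ^ 2 := by rw [← Complex.exp_nat_mul]; simp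
  rw [hexp]
  push_cast
  rw [one_mul]
  ring

theorem hasTransform_transPois {l g : ℝ} (hl : 0 ≤ l + 2 * g + Int.fract (-2 * g)) :
    HasTransform (transPois l g) (fun s => exp ((⌊-2 * g⌋ : ℤ) * s
      + ((l + 2 * g + Int.fract (-2 * g) : ℝ) : ℂ) * (exp s - 1))) :=
  ((hasTransform_pois hl).shift ⌊-2 * g⌋).congr (fun _ => rfl) fun _ => Complex.exp_add _ _

theorem hasSum_compPois_mul_pow (l g : ℝ) (w : ℂ) :
    HasSum (fun x : ℕ => (compPois l g x : ℂ) * w ^ x)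
      (exp (l * (w - 1) + g * (w - 1) ^ 2)) := by
  have hprod := (hasSum_pow_div_factorial ((l - 2 * g) * w)).mul
    (hasSum_pow_div_factorial (g * w ^ 2)) (exp_mul_summable _ _)
  have hfib := (hprod.mul_left (exp (g - l))).tsum_fiberwise fun p : ℕ × ℕ => p.1 + 2 * p.2
  rw [← Complex.exp_add, ← Complex.exp_add,
    show (g - l + ((l - 2 * g) * w + g * w ^ 2) : ℂ) = l * (w - 1) + g * (w - 1) ^ 2 by ring]
    at hfib
  refine hfib.congr_fun fun x => ?_
  rw [mul_comm, compPois_exp_mul]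
  exact (tsum_fib (fun p : ℕ × ℕ => exp (g - l) * (((l - 2 * g) * w) ^ p.1 / (p.1.factorial : ℂ)
    * ((g * w ^ 2) ^ p.2 / (p.2.factorial : ℂ)))) x).symm

theorem hasTransform_compPois (l g : ℝ) :
    HasTransform (zeroExt (compPois l g))
      (fun s => exp (l * (exp s - 1) + g * (exp s - 1) ^ 2)) :=
  hasTransform_zeroExt fun s _ => hasSum_compPois_mul_pow l g (exp s)

theorem hasTransform_binom (N : ℕ) (p : ℝ) :
    HasTransform (zeroExt (binom N p)) (fun s => (1 + p * (exp s - 1)) ^ N) := by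
  refine hasTransform_zeroExt fun s _ => ?_
  have hbinom : (1 + p * (exp s - 1)) ^ N
      = ∑ j ∈ Finset.range (N + 1), (binom N p j : ℂ) * exp s ^ j := by
    rw [show 1 + p * (exp s - 1) = p * exp s + (1 - p) by ring, add_pow]
    refine Finset.sum_congr rfl fun j _ => ?_
    unfold binom
    push_cast
    ring
  rw [hbinom]
  refine hasSum_sum_of_ne_finset_zero fun j hj => ?_
  simp [binom, Nat.choose_eq_zero_of_lt (by simpa using hj : N < j)]

theorem ofReal_Gamma_add_natCast_div {r : ℝ} (hr : 0 < r) (n : ℕ) :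
    ((Real.Gamma (r + n) / (n.factorial * Real.Gamma r) : ℝ) : ℂ)
      = Ring.choose ((r : ℂ) + n - 1) n := by
  have hr' (k : ℕ) : (r : ℂ) ≠ -k := by
    intro h
    have : r = -(k : ℝ) := by exact_mod_cast h
    linarith [(k.cast_nonneg : (0 : ℝ) ≤ k)]
  have hasc : (Gamma (r + n) / Gamma r : ℂ) = n.factorial * Ring.choose ((r : ℂ) + n - 1) n := by
    rw [Complex.Gamma_add_nat_div_Gamma_eq _ hr', ← Ring.multichoose_eq, ← nsmul_eq_mul,
      Ring.factorial_nsmul_multichoose_eq_ascPochhammer, Polynomial.ascPochhammer_smeval_eq_eval]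
  have hn : (n.factorial : ℂ) ≠ 0 := by exact_mod_cast n.factorial_ne_zero
  push_cast [← Complex.Gamma_ofReal]
  rw [mul_comm (n.factorial : ℂ), ← div_div, hasc, mul_div_cancel_left₀ _ hn]

theorem hasSum_negBin_mul_pow {r q : ℝ} (hr : 0 < r) (hq : 0 ≤ q) {w : ℂ}
    (hw : ‖(1 - q) * w‖ < 1) :
    HasSum (fun j : ℕ => (negBin r q j : ℂ) * w ^ j)
      ((q : ℂ) ^ (r : ℂ) * (1 / (1 - (1 - q) * w) ^ (r : ℂ))) := by
  have hball : ((1 - q) * w : ℂ) ∈ Metric.eball 0 1 := by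
    rw [Metric.mem_eball, edist_zero_right, ← ofReal_norm]
    exact ENNReal.ofReal_lt_one.mpr hw
  have h := (one_div_one_sub_cpow_hasFPowerSeriesOnBall_zero (r : ℂ)).hasSum hball
  rw [zero_add] at h
  refine (h.mul_left ((q : ℂ) ^ (r : ℂ))).congr_fun fun j => ?_
  rw [FormalMultilinearSeries.ofScalars_apply_eq, ← ofReal_Gamma_add_natCast_div hr, smul_eq_mul,
    negBin]
  push_cast [Complex.ofReal_cpow hq, mul_pow]
  ring

theorem cpow_mul_one_div_mul_cpow {q r : ℝ} (hq : 0 < q) {v : ℂ} (hv : v ≠ 0) :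
    (q : ℂ) ^ (r : ℂ) * (1 / (q * v) ^ (r : ℂ)) = exp (-(r * log v)) := by
  have hq' : (q : ℂ) ≠ 0 := by exact_mod_cast hq.ne'
  rw [cpow_def_of_ne_zero hq', cpow_def_of_ne_zero (mul_ne_zero hq' hv),
    Complex.log_ofReal_mul hq hv, ← Complex.ofReal_log hq.le, one_div, ← Complex.exp_neg,
    ← Complex.exp_add]
  ring_nf

theorem hasTransform_negBin {l g : ℝ} (hl : 0 < l) (hg : 0 < g) (hgl : 8 * g ≤ l) :
    HasTransform (zeroExt (negBin (nbR l g) (nbQ l g)))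
      (fun s => exp (-(nbR l g * log (1 - (2 * g / l : ℝ) * (exp s - 1))))) := by
  refine hasTransform_zeroExt fun s hs => ?_
  have hr : 0 < nbR l g := by unfold nbR; positivity
  have hq : 0 < nbQ l g := by unfold nbQ; positivity
  have hq1 : 1 - nbQ l g = 2 * g / (l + 2 * g) := by unfold nbQ; field_simp; ring
  have hw : ‖(1 - nbQ l g : ℂ) * exp s‖ < 1 := by
    have hcast : (1 - nbQ l g : ℂ) = ((2 * g / (l + 2 * g) : ℝ) : ℂ) := by
      rw [← hq1]; push_cast; rfl
    rw [hcast, norm_mul, Complex.norm_real, Real.norm_eq_abs, abs_of_pos (by positivity),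
      Complex.norm_exp, div_mul_eq_mul_div, div_lt_one (by positivity)]
    have hexp : Real.exp s.re ≤ Real.exp 1 := Real.exp_le_exp.mpr (abs_le.mp hs).2
    nlinarith [Real.exp_one_lt_d9]
  have hfactor : 1 - (1 - nbQ l g) * exp s
      = nbQ l g * (1 - (2 * g / l : ℝ) * (exp s - 1)) := by
    have hl' : (l : ℂ) ≠ 0 := by exact_mod_cast hl.ne'
    have hlg : (l : ℂ) + 2 * g ≠ 0 := by exact_mod_cast (by positivity : l + 2 * g ≠ 0)
    unfold nbQ
    push_cast
    field_simp
    ring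
  have hv : 1 - (2 * g / l : ℝ) * (exp s - 1) ≠ 0 := by
    intro h0
    rw [h0, mul_zero, sub_eq_zero] at hfactor
    simp [← hfactor] at hw
  have h := hasSum_negBin_mul_pow hr hq.le hw
  rwa [hfactor, cpow_mul_one_div_mul_cpow hq hv] at h

end Transforms

/-! ### Estimates on the strip -/

section ComplexExponential
open Complex

theorem exp_sub_one_re (s : ℂ) :
    (exp s - 1).re = Real.exp s.re - 1 - Real.exp s.re * (1 - Real.cos s.im) := by
  rw [sub_re, exp_re, one_re]; ring

theorem norm_exp_sub_one_sq (s : ℂ) :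
    ‖exp s - 1‖ ^ 2 = (Real.exp s.re - 1) ^ 2 + 2 * (Real.exp s.re * (1 - Real.cos s.im)) := by
  rw [← normSq_eq_norm_sq, normSq_apply, sub_re, sub_im, exp_re, exp_im, one_re, one_im]
  linear_combination Real.exp s.re ^ 2 * Real.sin_sq_add_cos_sq s.im

theorem norm_exp_sub_exp_le {a b : ℂ} {M : ℝ} (ha : a.re ≤ M) (hb : b.re ≤ M) :
    ‖exp a - exp b‖ ≤ ‖a - b‖ * Real.exp M := by
  rw [mul_comm]
  exact (convex_halfSpace_re_le M).norm_image_sub_le_of_norm_deriv_le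
    (fun _ _ => differentiableAt_exp)
    (fun z hz => by rw [Complex.deriv_exp, norm_exp]; exact Real.exp_le_exp.mpr hz) hb ha

theorem norm_exp_sub_one_sub_le (u : ℂ) : ‖exp u - 1 - u‖ ≤ ‖u‖ ^ 2 * Real.exp ‖u‖ := by
  simpa [Finset.sum_range_succ, sub_sub] using norm_exp_sub_sum_le_norm_mul_exp u 2

theorem norm_exp_sub_quadratic_le (u : ℂ) :
    ‖exp u - 1 - u - u ^ 2 / 2‖ ≤ ‖u‖ ^ 3 * Real.exp ‖u‖ := by
  simpa [Finset.sum_range_succ, sub_sub, add_assoc, Nat.factorial]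
    using norm_exp_sub_sum_le_norm_mul_exp u 3

theorem norm_one_add_le (y : ℂ) : ‖1 + y‖ ≤ Real.exp (y.re + ‖y‖ ^ 2 / 2) := by
  refine (sq_le_sq₀ (norm_nonneg _) (Real.exp_pos _).le).mp ?_
  calc ‖1 + y‖ ^ 2 = 2 * y.re + ‖y‖ ^ 2 + 1 := by
        rw [← normSq_eq_norm_sq, ← normSq_eq_norm_sq, normSq_apply, normSq_apply, add_re, add_im,
          one_re, one_im]
        ring
    _ ≤ Real.exp (2 * y.re + ‖y‖ ^ 2) := Real.add_one_le_exp _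
    _ = Real.exp (y.re + ‖y‖ ^ 2 / 2) ^ 2 := by
        rw [← Real.exp_nat_mul]; congr 1; push_cast; ring

theorem norm_log_one_add_sub_quadratic_le {u : ℂ} (hu : ‖u‖ ≤ 1 / 2) :
    ‖log (1 + u) - (u - u ^ 2 / 2)‖ ≤ ‖u‖ ^ 3 := by
  have hTaylor : logTaylor 3 u = u - u ^ 2 / 2 := by
    simp [logTaylor, Finset.sum_range_succ]; ring
  rw [← hTaylor]
  calc _ ≤ ‖u‖ ^ 3 * (1 - ‖u‖)⁻¹ / 3 := by
        have h := norm_log_sub_logTaylor_le 2 (z := u) (by linarith)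
        norm_num at h
        exact h
    _ ≤ ‖u‖ ^ 3 * 3 / 3 := by
        gcongr
        rw [inv_le_comm₀ (by linarith) (by norm_num)]
        linarith
    _ = _ := by ring

theorem norm_exp_sub_one_sub_self_sub_le {s : ℂ} (hs : ‖s‖ ≤ 4) :
    ‖exp s - 1 - s - (exp s - 1) ^ 2 / 2‖ ≤ 3 * Real.exp 8 * ‖s‖ ^ 3 := by
  have hexp : Real.exp ‖s‖ ≤ Real.exp 4 := Real.exp_le_exp.mpr hs
  have hexp8 : Real.exp 8 = Real.exp 4 * Real.exp 4 := by rw [← Real.exp_add]; norm_num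
  have hexp4 : (4 : ℝ) + 1 ≤ Real.exp 4 := Real.add_one_le_exp 4
  have hfirst : ‖exp s - 1 - s‖ ≤ ‖s‖ ^ 2 * Real.exp 4 :=
    (norm_exp_sub_one_sub_le s).trans (by gcongr)
  have hsum : ‖(exp s - 1 - s) + 2 * s‖ ≤ ‖s‖ * (4 * Real.exp 4 + 2) := by
    refine (norm_add_le _ _).trans ?_
    rw [norm_mul, Complex.norm_two]
    nlinarith [norm_nonneg s, mul_nonneg (norm_nonneg s) (Real.exp_pos 4).le]
  have hsplit : exp s - 1 - s - (exp s - 1) ^ 2 / 2 = (exp s - 1 - s - s ^ 2 / 2)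
      - (exp s - 1 - s) * ((exp s - 1 - s) + 2 * s) / 2 := by ring
  rw [hsplit]
  refine (norm_sub_le _ _).trans ?_
  rw [norm_div, norm_mul, Complex.norm_two]
  calc _ ≤ ‖s‖ ^ 3 * Real.exp 4
        + (‖s‖ ^ 2 * Real.exp 4) * (‖s‖ * (4 * Real.exp 4 + 2)) / 2 := by
        gcongr
        exact (norm_exp_sub_quadratic_le s).trans (by gcongr)
    _ = ‖s‖ ^ 3 * (Real.exp 4 + Real.exp 4 * (2 * Real.exp 4 + 1)) := by ring
    _ ≤ ‖s‖ ^ 3 * (3 * Real.exp 8) := by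
        gcongr
        rw [hexp8]; nlinarith
    _ = _ := by ring

theorem norm_pow_sub_pow_le {𝕜 : Type*} [NormedField 𝕜] {a b : 𝕜} {m : ℝ} (N : ℕ)
    (ha : ‖a‖ ≤ m) (hb : ‖b‖ ≤ m) : ‖a ^ N - b ^ N‖ ≤ N * ‖a - b‖ * m ^ (N - 1) := by
  have hm : 0 ≤ m := (norm_nonneg a).trans ha
  rw [← (Commute.all a b).mul_geom_sum₂ N, norm_mul, mul_comm (N : ℝ), mul_assoc]
  gcongr
  have hterm : ∀ i ∈ Finset.range N, ‖a ^ i * b ^ (N - 1 - i)‖ ≤ m ^ (N - 1) := by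
    intro i hi
    calc ‖a ^ i * b ^ (N - 1 - i)‖ ≤ m ^ i * m ^ (N - 1 - i) := by
          rw [norm_mul, norm_pow, norm_pow]; gcongr
      _ = m ^ (N - 1) := by
          rw [← pow_add, Nat.add_sub_cancel' (Nat.le_sub_one_of_lt (Finset.mem_range.mp hi))]
  simpa using norm_sum_le_of_le _ hterm

theorem norm_ofReal_mul_of_nonneg {r : ℝ} (hr : 0 ≤ r) (z : ℂ) : ‖(r : ℂ) * z‖ = r * ‖z‖ := by
  rw [norm_mul, norm_real, Real.norm_of_nonneg hr]

theorem norm_ofReal_mul_sq (g : ℝ) (z : ℂ) : ‖(g : ℂ) * z ^ 2‖ = |g| * ‖z‖ ^ 2 := by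
  rw [norm_mul, norm_pow, norm_real, Real.norm_eq_abs]

theorem re_ofReal_mul_sq_le (g : ℝ) (z : ℂ) : ((g : ℂ) * z ^ 2).re ≤ |g| * ‖z‖ ^ 2 :=
  (re_le_norm _).trans_eq (norm_ofReal_mul_sq g z)

end ComplexExponential

section Strip
open Complex

/-- The part of the strip `|re s| ≤ 1 / √l`, `|im s| ≤ π` near the imaginary axis on which the
transforms are compared. -/
structure InStrip (l : ℝ) (s : ℂ) : Prop where
  one_le : 1 ≤ l
  re_le : |s.re| ≤ 1 / 2
  re_sq : l * s.re ^ 2 ≤ 1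
  im_le : |s.im| ≤ Real.pi

/-- The exponent of the Gaussian bound of the transforms. -/
noncomputable def gaussExp (l : ℝ) (s : ℂ) : ℝ := l * s.re + 3 - 1 / 100 * l * s.im ^ 2

theorem exp_le_two_of_abs_le {h : ℝ} (hh : |h| ≤ 1 / 2) : Real.exp h ≤ 2 :=
  calc Real.exp h ≤ Real.exp (1 / 2) := Real.exp_le_exp.mpr (abs_le.mp hh).2
    _ ≤ 1 / (1 - 1 / 2) := Real.exp_bound_div_one_sub_of_interval (by norm_num) (by norm_num)
    _ = 2 := by norm_num

theorem exp_sub_one_sub_le_sq {h : ℝ} (hh : |h| ≤ 1 / 2) : Real.exp h - 1 - h ≤ h ^ 2 :=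
  (abs_le.mp (Real.abs_exp_sub_one_sub_id_le (by linarith))).2

theorem exp_sub_one_sq_le {h : ℝ} (hh : |h| ≤ 1 / 2) : (Real.exp h - 1) ^ 2 ≤ 9 / 4 * h ^ 2 := by
  have habs : |Real.exp h - 1| ≤ 3 / 2 * |h| :=
    calc |Real.exp h - 1| = |(Real.exp h - 1 - h) + h| := by rw [sub_add_cancel]
      _ ≤ |Real.exp h - 1 - h| + |h| := abs_add_le _ _
      _ ≤ |h| * |h| + |h| := by
          rw [← sq, sq_abs]
          gcongr
          exact Real.abs_exp_sub_one_sub_id_le (by linarith)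
      _ ≤ 1 / 2 * |h| + |h| := by gcongr
      _ = 3 / 2 * |h| := by ring
  calc (Real.exp h - 1) ^ 2 = |Real.exp h - 1| ^ 2 := (sq_abs _).symm
    _ ≤ (3 / 2 * |h|) ^ 2 := by gcongr
    _ = 9 / 4 * h ^ 2 := by rw [mul_pow, sq_abs]; norm_num

namespace InStrip
variable {l : ℝ} {s : ℂ} (hs : InStrip l s)
include hs

theorem pos : 0 < l := one_pos.trans_le hs.one_le

theorem le_exp_mul_one_sub_cos : s.im ^ 2 / 10 ≤ Real.exp s.re * (1 - Real.cos s.im) := by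
  have hcos := Real.cos_le_one_sub_mul_cos_sq hs.im_le
  have hpi : 1 / 5 ≤ 2 / Real.pi ^ 2 := by
    rw [div_le_div_iff₀ (by norm_num) (by positivity)]
    nlinarith [Real.pi_lt_d2, Real.pi_pos]
  have hcos' : 1 / 5 * s.im ^ 2 ≤ 1 - Real.cos s.im := by nlinarith [sq_nonneg s.im]
  have hexp : 1 / 2 ≤ Real.exp s.re := by
    linarith [Real.add_one_le_exp s.re, (abs_le.mp hs.re_le).1]
  nlinarith [sq_nonneg s.im]

theorem exp_mul_one_sub_cos_le : Real.exp s.re * (1 - Real.cos s.im) ≤ s.im ^ 2 := by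
  have hcos := Real.one_sub_sq_div_two_le_cos (x := s.im)
  nlinarith [sq_nonneg s.im, exp_le_two_of_abs_le hs.re_le, Real.exp_pos s.re]

theorem norm_exp_sub_one_le : ‖exp s - 1‖ ≤ 2 * ‖s‖ := by
  have hnorm : ‖s‖ ^ 2 = s.re ^ 2 + s.im ^ 2 := by
    rw [← normSq_eq_norm_sq, normSq_apply]; ring
  refine (sq_le_sq₀ (norm_nonneg _) (by positivity)).mp ?_
  rw [norm_exp_sub_one_sq, mul_pow, hnorm]
  nlinarith [sq_nonneg s.re, sq_nonneg s.im, hs.exp_mul_one_sub_cos_le, exp_sub_one_sq_le hs.re_le]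

theorem norm_exp_sub_one_le_three : ‖exp s - 1‖ ≤ 3 := by
  refine (norm_sub_le _ _).trans ?_
  rw [norm_exp, norm_one]
  linarith [exp_le_two_of_abs_le hs.re_le]

theorem norm_le_four : ‖s‖ ≤ 4 := by
  refine (Complex.norm_le_abs_re_add_abs_im s).trans ?_
  linarith [hs.re_le, hs.im_le, Real.pi_lt_d2]

theorem le_gaussExp {κ : ℝ} (hκ : κ ≤ 9 / 20) :
    l * (exp s - 1).re + κ * l * ‖exp s - 1‖ ^ 2 ≤ gaussExp l s := by
  rw [norm_exp_sub_one_sq, exp_sub_one_re]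
  unfold gaussExp
  have hc := hs.le_exp_mul_one_sub_cos
  set c := Real.exp s.re * (1 - Real.cos s.im)
  have : 0 ≤ c := le_trans (by positivity) hc
  have hlin := exp_sub_one_sub_le_sq hs.re_le
  have hsq : κ * (Real.exp s.re - 1) ^ 2 ≤ 9 / 20 * (9 / 4 * s.re ^ 2) := by
    gcongr
    exact exp_sub_one_sq_le hs.re_le
  have hκc : κ * (2 * c) ≤ 9 / 10 * c := by nlinarith
  have hbracket : (Real.exp s.re - 1 - c) + κ * ((Real.exp s.re - 1) ^ 2 + 2 * c)
      ≤ s.re + 2.1 * s.re ^ 2 - s.im ^ 2 / 100 := by nlinarith [sq_nonneg s.re]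
  have hmul := mul_le_mul_of_nonneg_left hbracket hs.pos.le
  nlinarith [hs.re_sq]

theorem re_compPois_le {g κ : ℝ} (hg : |g| ≤ κ * l) (hκ : κ ≤ 9 / 20) :
    (l * (exp s - 1) + g * (exp s - 1) ^ 2).re ≤ gaussExp l s := by
  rw [add_re, re_ofReal_mul]
  calc l * (exp s - 1).re + ((g : ℂ) * (exp s - 1) ^ 2).re
      ≤ l * (exp s - 1).re + κ * l * ‖exp s - 1‖ ^ 2 := by
        gcongr
        exact (re_ofReal_mul_sq_le g _).trans (by gcongr)
    _ ≤ gaussExp l s := hs.le_gaussExp hκ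

theorem re_pois_le : (l * (exp s - 1)).re ≤ gaussExp l s := by
  simpa using hs.re_compPois_le (g := 0) (κ := 0) (by simp) (by norm_num)

theorem re_transPois_le {μ : ℝ} (hμ : l / 10 ≤ μ) (hμ' : μ ≤ 3 * l) :
    (((l - μ : ℝ) : ℂ) * s + (μ : ℂ) * (exp s - 1)).re ≤ gaussExp l s := by
  rw [add_re, re_ofReal_mul, re_ofReal_mul, exp_sub_one_re]
  unfold gaussExp
  have hc := hs.le_exp_mul_one_sub_cos
  set c := Real.exp s.re * (1 - Real.cos s.im)
  have hre : μ * (Real.exp s.re - 1 - s.re) ≤ 3 * l * s.re ^ 2 := by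
    have := hs.pos
    have := Real.add_one_le_exp s.re
    exact mul_le_mul hμ' (exp_sub_one_sub_le_sq hs.re_le) (by linarith) (by positivity)
  have him : l / 10 * (s.im ^ 2 / 10) ≤ μ * c := by
    have := hs.pos
    exact mul_le_mul hμ hc (by positivity) (by linarith)
  nlinarith [hs.re_sq]

theorem norm_compPois_sub_pois_le {g : ℝ} (hg : |g| ≤ 2 / 25 * l) :
    ‖exp (l * (exp s - 1) + g * (exp s - 1) ^ 2) - exp (l * (exp s - 1))‖
      ≤ 4 * |g| * ‖s‖ ^ 2 * Real.exp (gaussExp l s) := by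
  refine (norm_exp_sub_exp_le (hs.re_compPois_le hg (by norm_num)) hs.re_pois_le).trans ?_
  gcongr
  rw [add_sub_cancel_left, norm_ofReal_mul_sq]
  calc |g| * ‖exp s - 1‖ ^ 2 ≤ |g| * (2 * ‖s‖) ^ 2 := by gcongr; exact hs.norm_exp_sub_one_le
    _ = _ := by ring

theorem norm_compPois_sub_pois₁_le {g : ℝ} (hg : |g| ≤ 2 / 25 * l) :
    ‖exp (l * (exp s - 1) + g * (exp s - 1) ^ 2)
      - (exp (l * (exp s - 1)) + g * (exp s - 1) ^ 2 * exp (l * (exp s - 1)))‖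
      ≤ 16 * g ^ 2 * ‖s‖ ^ 4 * Real.exp (gaussExp l s) := by
  set u := (g : ℂ) * (exp s - 1) ^ 2
  have hun : ‖u‖ = |g| * ‖exp s - 1‖ ^ 2 := norm_ofReal_mul_sq g _
  have hfactor : exp (l * (exp s - 1) + u) - (exp (l * (exp s - 1)) + u * exp (l * (exp s - 1)))
      = exp (l * (exp s - 1)) * (exp u - 1 - u) := by rw [Complex.exp_add]; ring
  have hexponent : l * (exp s - 1).re + ‖u‖ ≤ gaussExp l s := by
    refine le_trans ?_ (hs.le_gaussExp (κ := 2 / 25) (by norm_num))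
    rw [hun]
    gcongr
  have hnorm : ‖u‖ ≤ |g| * (2 * ‖s‖) ^ 2 := by
    rw [hun]
    gcongr
    exact hs.norm_exp_sub_one_le
  rw [hfactor, norm_mul, norm_exp, re_ofReal_mul]
  calc _ ≤ Real.exp (l * (exp s - 1).re) * (‖u‖ ^ 2 * Real.exp ‖u‖) := by
        gcongr; exact norm_exp_sub_one_sub_le u
    _ = ‖u‖ ^ 2 * Real.exp (l * (exp s - 1).re + ‖u‖) := by rw [Real.exp_add]; ring
    _ ≤ (|g| * (2 * ‖s‖) ^ 2) ^ 2 * Real.exp (gaussExp l s) := by gcongr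
    _ = _ := by rw [mul_pow, sq_abs]; ring

theorem norm_compPois_sub_transPois_le {g : ℝ} (hg : |g| ≤ 2 / 25 * l) :
    ‖exp (l * (exp s - 1) + g * (exp s - 1) ^ 2) - exp ((⌊-2 * g⌋ : ℤ) * s
      + ((l + 2 * g + Int.fract (-2 * g) : ℝ) : ℂ) * (exp s - 1))‖
      ≤ (4 * Int.fract (-2 * g) * ‖s‖ ^ 2
          + 6 * Real.exp 8 * (|g| + Int.fract (-2 * g)) * ‖s‖ ^ 3)
        * Real.exp (gaussExp l s) := by
  set δ := Int.fract (-2 * g) with hδ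
  have hδ0 : 0 ≤ δ := Int.fract_nonneg _
  have hδ1 : δ < 1 := Int.fract_lt_one _
  have hfloor : ((⌊-2 * g⌋ : ℤ) : ℂ) = ((l - (l + 2 * g + δ) : ℝ) : ℂ) := by
    rw [← ofReal_intCast, hδ, Int.fract]
    congr 1
    ring
  have hg' := abs_le.mp hg
  have hl := hs.one_le
  rw [hfloor]
  refine (norm_exp_sub_exp_le (hs.re_compPois_le hg (by norm_num))
    (hs.re_transPois_le (by linarith) (by linarith))).trans ?_
  gcongr
  have hdiff : l * (exp s - 1) + g * (exp s - 1) ^ 2 - (((l - (l + 2 * g + δ) : ℝ) : ℂ) * s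
      + ((l + 2 * g + δ : ℝ) : ℂ) * (exp s - 1))
      = -((δ / 2 : ℝ) * (exp s - 1) ^ 2)
        - ((2 * g + δ : ℝ) : ℂ) * (exp s - 1 - s - (exp s - 1) ^ 2 / 2) := by
    push_cast; ring
  have hcoeff : |2 * g + δ| ≤ 2 * (|g| + δ) := by
    refine (abs_add_le _ _).trans ?_
    rw [abs_mul, abs_of_nonneg hδ0, abs_two]; linarith
  rw [hdiff]
  refine (norm_sub_le _ _).trans ?_
  rw [norm_neg, norm_ofReal_mul_sq, norm_mul, norm_real, Real.norm_eq_abs,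
    abs_of_nonneg (by positivity : 0 ≤ δ / 2)]
  calc _ ≤ δ / 2 * (2 * ‖s‖) ^ 2 + 2 * (|g| + δ) * (3 * Real.exp 8 * ‖s‖ ^ 3) := by
        gcongr
        · exact hs.norm_exp_sub_one_le
        · exact norm_exp_sub_one_sub_self_sub_le hs.norm_le_four
    _ = 2 * δ * ‖s‖ ^ 2 + 6 * Real.exp 8 * (|g| + δ) * ‖s‖ ^ 3 := by ring
    _ ≤ _ := by gcongr; norm_num

end InStrip

theorem norm_compPois_exponent_add_nbR_mul_log_le {l g : ℝ} (hl : 0 < l) (hg0 : 0 < g)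
    (hg : g ≤ 2 / 25 * l) {z : ℂ} (hz : ‖z‖ ≤ 3) :
    ‖(l : ℂ) * z + g * z ^ 2 - -(nbR l g * log (1 - (2 * g / l : ℝ) * z))‖
      ≤ 4 * (g ^ 2 / l) * ‖z‖ ^ 3 := by
  set ρ := 2 * g / l with hρ
  have hρ0 : 0 < ρ := by positivity
  have hρ1 : ρ ≤ 4 / 25 := by rw [hρ, div_le_iff₀ hl]; linarith
  set r := nbR l g with hr
  have hr0 : 0 < r := by rw [hr, nbR]; positivity
  have hlin : r * ρ = l := by rw [hr, hρ, nbR]; field_simp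
  have hquad : r * ρ ^ 2 / 2 = g := by rw [hr, hρ, nbR]; field_simp
  have hcubic : r * ρ ^ 3 = 4 * (g ^ 2 / l) := by rw [hr, hρ, nbR]; field_simp; ring
  set u : ℂ := -((ρ : ℂ) * z) with hu
  have hun : ‖u‖ = ρ * ‖z‖ := by rw [hu, norm_neg, norm_ofReal_mul_of_nonneg hρ0.le]
  have hu1 : ‖u‖ ≤ 1 / 2 := by rw [hun]; nlinarith [norm_nonneg z]
  have hdiff : (l : ℂ) * z + g * z ^ 2 - -(r * log (1 - ρ * z))
      = r * (log (1 + u) - (u - u ^ 2 / 2)) := by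
    rw [← hlin, ← hquad, hu, sub_eq_add_neg 1]
    push_cast
    ring
  rw [hdiff, norm_ofReal_mul_of_nonneg hr0.le]
  calc _ ≤ r * ‖u‖ ^ 3 := by gcongr; exact norm_log_one_add_sub_quadratic_le hu1
    _ = r * ρ ^ 3 * ‖z‖ ^ 3 := by rw [hun]; ring
    _ = _ := by rw [hcubic]

theorem InStrip.norm_compPois_sub_negBin_le {l g : ℝ} {s : ℂ} (hs : InStrip l s) (hg0 : 0 < g)
    (hg : g ≤ 2 / 25 * l) :
    ‖exp (l * (exp s - 1) + g * (exp s - 1) ^ 2)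
      - exp (-(nbR l g * log (1 - (2 * g / l : ℝ) * (exp s - 1))))‖
      ≤ 32 * (g ^ 2 / l) * ‖s‖ ^ 3 * Real.exp (gaussExp l s) := by
  have hl := hs.pos
  have hdiff := norm_compPois_exponent_add_nbR_mul_log_le hl hg0 hg hs.norm_exp_sub_one_le_three
  have hga : |g| ≤ 2 / 25 * l := by rwa [abs_of_pos hg0]
  set z := exp s - 1
  set w := -(nbR l g * log (1 - (2 * g / l : ℝ) * z))
  have herror : 4 * (g ^ 2 / l) * ‖z‖ ^ 3 ≤ 2 / 25 * l * ‖z‖ ^ 2 := by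
    have hratio : g ^ 2 / l ≤ 4 / 625 * l := by
      rw [div_le_iff₀ hl]; nlinarith
    calc 4 * (g ^ 2 / l) * ‖z‖ ^ 3 = 4 * (g ^ 2 / l) * ‖z‖ * ‖z‖ ^ 2 := by ring
      _ ≤ 4 * (4 / 625 * l) * 3 * ‖z‖ ^ 2 := by gcongr; exact hs.norm_exp_sub_one_le_three
      _ ≤ _ := by nlinarith [mul_nonneg hl.le (sq_nonneg ‖z‖)]
  have hw : w.re ≤ gaussExp l s := by
    have hquad := hs.le_gaussExp (κ := 4 / 25) (by norm_num)
    have hre := (abs_le.mp (abs_re_le_norm ((l : ℂ) * z + g * z ^ 2 - w))).1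
    rw [sub_re, add_re, re_ofReal_mul] at hre
    nlinarith [re_ofReal_mul_sq_le g z, mul_le_mul_of_nonneg_right hga (sq_nonneg ‖z‖)]
  refine (norm_exp_sub_exp_le (hs.re_compPois_le hga (by norm_num)) hw).trans ?_
  gcongr
  calc _ ≤ 4 * (g ^ 2 / l) * (2 * ‖s‖) ^ 3 :=
        hdiff.trans (by gcongr; exact hs.norm_exp_sub_one_le)
    _ = _ := by ring

section Binomial
variable {p c : ℝ} {z : ℂ}

theorem norm_mul_sub_mul_sq_le (hp : 0 ≤ p) (hc : 0 ≤ c) (hcp : c ≤ 2 / 25 * p) (hz : ‖z‖ ≤ 3) :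
    ‖(p : ℂ) * z - c * z ^ 2‖ ≤ 5 / 4 * (p * ‖z‖) := by
  refine (norm_sub_le _ _).trans ?_
  rw [norm_ofReal_mul_of_nonneg hp, norm_ofReal_mul_sq, abs_of_nonneg hc]
  have hquad : c * ‖z‖ ^ 2 ≤ (2 / 25 * p) * (3 * ‖z‖) := by rw [pow_two]; gcongr
  nlinarith [mul_nonneg hp (norm_nonneg z)]

theorem norm_exp_sub_one_add_le (hp : 0 ≤ p) (hp1 : p ≤ 1 / 5) (hc : 0 ≤ c)
    (hcp : c ≤ 2 / 25 * p) (hz : ‖z‖ ≤ 3) :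
    ‖exp (p * z - c * z ^ 2) - (1 + (p : ℂ) * z)‖
      ≤ |p ^ 2 / 2 - c| * ‖z‖ ^ 2 + (8 * p ^ 3 + 2 * (p * c)) * ‖z‖ ^ 3 := by
  set v : ℂ := p * z - c * z ^ 2 with hv
  have hvn : ‖v‖ ≤ 5 / 4 * (p * ‖z‖) := norm_mul_sub_mul_sq_le hp hc hcp hz
  have hexp : Real.exp ‖v‖ ≤ 4 := by
    have hv1 : ‖v‖ ≤ 3 / 4 := by
      have : p * ‖z‖ ≤ 1 / 5 * 3 := by gcongr
      linarith
    calc Real.exp ‖v‖ ≤ Real.exp (3 / 4) := Real.exp_le_exp.mpr hv1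
      _ ≤ 1 / (1 - 3 / 4) := Real.exp_bound_div_one_sub_of_interval (by norm_num) (by norm_num)
      _ = 4 := by norm_num
  have hsplit : exp v - (1 + (p : ℂ) * z) = (exp v - 1 - v - v ^ 2 / 2)
      + ((p ^ 2 / 2 - c : ℝ) : ℂ) * z ^ 2 - ((p * c : ℝ) : ℂ) * z ^ 3
      + ((c ^ 2 / 2 : ℝ) : ℂ) * z ^ 4 := by
    rw [hv]; push_cast; ring
  have hcubic : ‖exp v - 1 - v - v ^ 2 / 2‖ ≤ 8 * p ^ 3 * ‖z‖ ^ 3 := by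
    refine (norm_exp_sub_quadratic_le v).trans ?_
    calc ‖v‖ ^ 3 * Real.exp ‖v‖ ≤ (5 / 4 * (p * ‖z‖)) ^ 3 * 4 := by gcongr
      _ = (125 / 16) * (p ^ 3 * ‖z‖ ^ 3) := by ring
      _ ≤ 8 * (p ^ 3 * ‖z‖ ^ 3) := by gcongr; norm_num
      _ = _ := by ring
  have hquartic : c ^ 2 / 2 * ‖z‖ ^ 4 ≤ p * c * ‖z‖ ^ 3 := by
    have : c * ‖z‖ / 2 ≤ p := by
      nlinarith [mul_le_mul hcp hz (norm_nonneg z) (by positivity)]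
    calc c ^ 2 / 2 * ‖z‖ ^ 4 = (c * ‖z‖ / 2) * (c * ‖z‖ ^ 3) := by ring
      _ ≤ p * (c * ‖z‖ ^ 3) := by gcongr
      _ = _ := by ring
  rw [hsplit]
  refine (norm_add_le_of_le (norm_sub_le_of_le (norm_add_le_of_le hcubic le_rfl) le_rfl)
    le_rfl).trans ?_
  rw [norm_ofReal_mul_sq, norm_ofReal_mul_of_nonneg (by positivity),
    norm_ofReal_mul_of_nonneg (by positivity), norm_pow, norm_pow]
  linarith

theorem norm_exp_pow_sub_one_add_pow_le (hp : 0 ≤ p) (hp1 : p ≤ 1 / 5) (hc : 0 ≤ c)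
    (hcp : c ≤ 2 / 25 * p) (hz : ‖z‖ ≤ 3) {N : ℕ} (hN : 0 < N) :
    ‖exp (p * z - c * z ^ 2) ^ N - (1 + (p : ℂ) * z) ^ N‖
      ≤ N * (|p ^ 2 / 2 - c| * ‖z‖ ^ 2 + (8 * p ^ 3 + 2 * (p * c)) * ‖z‖ ^ 3)
        * (5 / 2 * Real.exp (N * (p * z.re + p / 10 * ‖z‖ ^ 2))) := by
  set e := p * z.re + p / 10 * ‖z‖ ^ 2 with he
  have hbinom : ‖1 + (p : ℂ) * z‖ ≤ Real.exp e := by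
    refine (norm_one_add_le _).trans (Real.exp_le_exp.mpr ?_)
    rw [re_ofReal_mul, norm_ofReal_mul_of_nonneg hp, he, mul_pow]
    have : p ^ 2 * ‖z‖ ^ 2 ≤ p / 5 * ‖z‖ ^ 2 := by gcongr; nlinarith
    linarith
  have hexp : ‖exp (p * z - c * z ^ 2)‖ ≤ Real.exp e := by
    rw [norm_exp]
    refine Real.exp_le_exp.mpr ?_
    have hre := (abs_le.mp (abs_re_le_norm ((c : ℂ) * z ^ 2))).1
    rw [norm_ofReal_mul_sq, abs_of_nonneg hc] at hre
    rw [sub_re, re_ofReal_mul, he]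
    nlinarith [sq_nonneg ‖z‖]
  have hpow : Real.exp e ^ (N - 1) ≤ 5 / 2 * Real.exp (N * e) := by
    have he' : -(3 / 5) ≤ e := by
      have hre := (abs_le.mp (abs_re_le_norm z)).1
      have hpz : p * ‖z‖ ≤ 1 / 5 * 3 := by gcongr
      have : 0 ≤ p / 10 * ‖z‖ ^ 2 := by positivity
      nlinarith
    calc Real.exp e ^ (N - 1) = Real.exp ((N - 1) * e) := by
          rw [← Real.exp_nat_mul, Nat.cast_pred hN]
      _ ≤ Real.exp (3 / 5 + N * e) := Real.exp_le_exp.mpr (by linarith)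
      _ = Real.exp (3 / 5) * Real.exp (N * e) := Real.exp_add _ _
      _ ≤ 1 / (1 - 3 / 5) * Real.exp (N * e) := by
          gcongr
          exact Real.exp_bound_div_one_sub_of_interval (by norm_num) (by norm_num)
      _ = 5 / 2 * Real.exp (N * e) := by norm_num
  calc _ ≤ N * ‖exp (p * z - c * z ^ 2) - (1 + (p : ℂ) * z)‖ * Real.exp e ^ (N - 1) :=
        norm_pow_sub_pow_le N hexp hbinom
    _ ≤ _ := by
        gcongr
        exact norm_exp_sub_one_add_le hp hp1 hc hcp hz

variable {l g : ℝ}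

theorem two_mul_abs_mul_biN_le (hg : g ≠ 0) : 2 * |g| * biN l g ≤ l ^ 2 := by
  have := abs_pos.mpr hg
  rw [← le_div_iff₀' (by positivity)]
  exact Nat.floor_le (by positivity)

theorem lt_two_mul_abs_mul_biN_add_one (hg : g ≠ 0) : l ^ 2 < 2 * |g| * (biN l g + 1) := by
  have := abs_pos.mpr hg
  rw [← div_lt_iff₀' (by positivity)]
  exact Nat.lt_floor_add_one _

theorem mul_le_biN (hl : 1 ≤ l) (hg0 : g ≠ 0) (hg : |g| ≤ 2 / 25 * l) :
    21 / 4 * l ≤ (biN l g : ℝ) := by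
  have hlt := lt_two_mul_abs_mul_biN_add_one (l := l) hg0
  have hmul : l * l ≤ 4 / 25 * (biN l g + 1) * l := by
    nlinarith [mul_le_mul_of_nonneg_right hg (by positivity : (0 : ℝ) ≤ biN l g + 1)]
  linarith [le_of_mul_le_mul_right hmul (by linarith)]

theorem one_div_biN_le (hl : 1 ≤ l) (hg0 : g ≠ 0) (hg : |g| ≤ 2 / 25 * l) :
    1 / (biN l g : ℝ) ≤ 12 / 5 * (|g| / l ^ 2) := by
  have hN := mul_le_biN hl hg0 hg
  rw [mul_div_assoc', div_le_div_iff₀ (by linarith) (by positivity)]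
  nlinarith [lt_two_mul_abs_mul_biN_add_one (l := l) hg0, abs_nonneg g]

theorem biN_mul_abs_sub_le (hl : 1 ≤ l) (hg0 : g ≠ 0) (hg : |g| ≤ 2 / 25 * l) :
    biN l g * |(l / biN l g) ^ 2 / 2 - |g| / biN l g| ≤ 12 / 5 * (g ^ 2 / l ^ 2) := by
  have hN : (0 : ℝ) < biN l g := by linarith [mul_le_biN hl hg0 hg]
  have hle := two_mul_abs_mul_biN_le (l := l) hg0
  have hlt := lt_two_mul_abs_mul_biN_add_one (l := l) hg0
  have hinv := one_div_biN_le hl hg0 hg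
  set N : ℝ := (biN l g : ℝ)
  have hdiff : (l / N) ^ 2 / 2 - |g| / N = (l ^ 2 - 2 * |g| * N) / (2 * N ^ 2) := by
    field_simp
  rw [hdiff, abs_of_nonneg (div_nonneg (by linarith) (by positivity))]
  calc N * ((l ^ 2 - 2 * |g| * N) / (2 * N ^ 2)) ≤ N * (2 * |g| / (2 * N ^ 2)) := by
        gcongr; linarith
    _ = |g| * (1 / N) := by field_simp
    _ ≤ |g| * (12 / 5 * (|g| / l ^ 2)) := by gcongr
    _ = 12 / 5 * (g ^ 2 / l ^ 2) := by rw [← sq_abs g]; ring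

theorem biN_mul_cubic_le (hl : 1 ≤ l) (hg0 : g ≠ 0) (hg : |g| ≤ 2 / 25 * l) :
    biN l g * (8 * (l / biN l g) ^ 3 + 2 * (l / biN l g * (|g| / biN l g)))
      ≤ 51 * (g ^ 2 / l) := by
  have hN : (0 : ℝ) < biN l g := by linarith [mul_le_biN hl hg0 hg]
  have hinv := one_div_biN_le hl hg0 hg
  set N : ℝ := (biN l g : ℝ)
  calc N * (8 * (l / N) ^ 3 + 2 * (l / N * (|g| / N)))
      = 8 * l ^ 3 * (1 / N) ^ 2 + 2 * (l * |g|) * (1 / N) := by field_simp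
    _ ≤ 8 * l ^ 3 * (12 / 5 * (|g| / l ^ 2)) ^ 2 + 2 * (l * |g|) * (12 / 5 * (|g| / l ^ 2)) := by
        gcongr
    _ = (8 * (12 / 5) ^ 2 + 2 * (12 / 5)) * (g ^ 2 / l) := by
        rw [← sq_abs g]; field_simp
    _ ≤ _ := by gcongr; norm_num

theorem InStrip.norm_compPois_sub_binom_le {s : ℂ} (hs : InStrip l s) (hg0 : g < 0)
    (hg : |g| ≤ 2 / 25 * l) :
    ‖exp (l * (exp s - 1) + g * (exp s - 1) ^ 2)
      - (1 + ((l / biN l g : ℝ) : ℂ) * (exp s - 1)) ^ biN l g‖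
      ≤ (24 * (g ^ 2 / l ^ 2) * ‖s‖ ^ 2 + 1020 * (g ^ 2 / l) * ‖s‖ ^ 3)
        * Real.exp (gaussExp l s) := by
  have hl := hs.pos
  have hNl := mul_le_biN hs.one_le hg0.ne hg
  have hquad := biN_mul_abs_sub_le hs.one_le hg0.ne hg
  have hcubic := biN_mul_cubic_le hs.one_le hg0.ne hg
  set N := biN l g
  have hN : (0 : ℝ) < N := by linarith
  have hz := hs.norm_exp_sub_one_le
  have hz3 := hs.norm_exp_sub_one_le_three
  have hgauss := hs.le_gaussExp (κ := 1 / 10) (by norm_num)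
  set z := exp s - 1
  have hpow : exp ((l : ℂ) * z + g * z ^ 2)
      = exp (((l / N : ℝ) : ℂ) * z - ((|g| / N : ℝ) : ℂ) * z ^ 2) ^ N := by
    have hN' : (N : ℂ) ≠ 0 := by exact_mod_cast hN.ne'
    rw [← Complex.exp_nat_mul, abs_of_neg hg0]
    push_cast
    congr 1
    field_simp
    ring
  have hexponent : N * (l / N * z.re + l / N / 10 * ‖z‖ ^ 2) ≤ gaussExp l s := by
    refine le_trans (le_of_eq ?_) hgauss
    field_simp
  rw [hpow]
  refine (norm_exp_pow_sub_one_add_pow_le (by positivity) ?_ (by positivity) ?_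
    hz3 (Nat.cast_pos.mp hN)).trans ?_
  · rw [div_le_iff₀ hN]; linarith
  · rw [mul_div_assoc']; gcongr
  rw [mul_add, ← mul_assoc (N : ℝ), ← mul_assoc (N : ℝ)]
  calc _ ≤ (12 / 5 * (g ^ 2 / l ^ 2) * (2 * ‖s‖) ^ 2 + 51 * (g ^ 2 / l) * (2 * ‖s‖) ^ 3)
        * (5 / 2 * Real.exp (gaussExp l s)) := by gcongr
    _ = _ := by ring

end Binomial

end Strip

/-! ### Recursions for ratios -/

section RatioRecursion
open Finset

/-- The ratio `f k / f (k - 1)` of consecutive terms. The truncated index makes the ratio at `0`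
equal to `1` whenever `f 0 ≠ 0`. -/
noncomputable def ratio (f : ℕ → ℂ) (k : ℕ) : ℂ := f k / f (k - 1)

theorem ratio_succ (f : ℕ → ℂ) (k : ℕ) : ratio f (k + 1) = f (k + 1) / f k := rfl

theorem norm_inv_le_of_norm_sub_one_le {w : ℂ} {δ : ℝ} (h : ‖w - 1‖ ≤ δ) (hδ : δ < 1) :
    ‖w⁻¹‖ ≤ (1 - δ)⁻¹ := by
  have h1 : 1 - δ ≤ ‖w‖ := by
    have := norm_sub_norm_le (1 : ℂ) (1 - w)
    rw [sub_sub_cancel, norm_one, norm_sub_rev] at this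
    linarith
  rw [norm_inv]
  exact inv_anti₀ (by linarith) h1

theorem norm_sub_le_pow_mul_norm {f : ℕ → ℂ} {k : ℕ} {δ : ℝ} (hδ : δ < 1)
    (hk : ∀ i ≤ k, f i ≠ 0 ∧ ‖ratio f i - 1‖ ≤ δ) (j : ℕ) :
    ‖f (k - j)‖ ≤ ((1 - δ)⁻¹) ^ j * ‖f k‖ := by
  induction j with
  | zero => simp
  | succ j ih =>
    obtain ⟨hne, hratio⟩ := hk (k - j) (Nat.sub_le _ _)
    have hstep : f (k - (j + 1)) = (ratio f (k - j))⁻¹ * f (k - j) := by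
      rw [ratio, inv_div, div_mul_cancel₀ _ hne, Nat.sub_sub]
    have : 0 ≤ (1 - δ)⁻¹ := inv_nonneg.mpr (by linarith)
    rw [hstep, norm_mul, pow_succ', mul_assoc]
    gcongr
    exact norm_inv_le_of_norm_sub_one_le hratio hδ

theorem sum_range_le_of_le_mul_add_two {u : ℕ → ℝ} {κ : ℝ} (hu : ∀ j, 0 ≤ u j) (hκ : κ < 1)
    (h : ∀ j, u (j + 2) ≤ κ * u j) (J : ℕ) :
    ∑ j ∈ range J, u j ≤ (u 0 + u 1) / (1 - κ) := by
  have hext : ∑ j ∈ range J, u j ≤ ∑ j ∈ range (J + 2), u j :=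
    sum_le_sum_of_subset_of_nonneg (by simp) fun _ _ _ => hu _
  have hshift : ∑ j ∈ range J, u (j + 1 + 1) ≤ κ * ∑ j ∈ range J, u j := by
    rw [mul_sum]
    exact sum_le_sum fun j _ => h j
  rw [sum_range_succ', sum_range_succ', zero_add] at hext
  rw [le_div_iff₀ (by linarith)]
  linarith

/-- The recursion expressing `f (k + 1) - f k` through the previous values of `f`, with
coefficients `D j (k + 1)` whose norms are bounded by small quantities `E j (k + 1)` that decay
geometrically in `j`. For generating functions of partial sums, `D j k` is the expectation of the
product of `(1 + z) ^ X i - 1` over the last `j` indices `i ≤ k`. -/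
structure RatioRecursion (n : ℕ) (f : ℕ → ℂ) (D : ℕ → ℕ → ℂ) (E : ℕ → ℕ → ℝ) : Prop where
  f_zero : f 0 = 1
  f_succ : ∀ k < n, f (k + 1) = f k + ∑ j ∈ range (k + 1), f (k - (j + 1)) * D (j + 1) (k + 1)
  D_eq_zero : ∀ j k, k < j → D j k = 0
  norm_D_le : ∀ j k, ‖D j k‖ ≤ E j k
  E_add_three_le : ∀ j k, E (j + 3) k ≤ 1 / 24 * E (j + 1) k
  E_add_two_le : ∀ j k, E (j + 2) k ≤ 2.02 * E (j + 1) k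
  E_one_le : ∀ k, E 1 k ≤ 0.0204
  E_two_le : ∀ k, E 2 k ≤ 0.0413

namespace RatioRecursion

variable {n : ℕ} {f : ℕ → ℂ} {D : ℕ → ℕ → ℂ} {E : ℕ → ℕ → ℝ} (H : RatioRecursion n f D E) {k : ℕ}
include H

theorem E_nonneg (j k : ℕ) : 0 ≤ E j k := (norm_nonneg _).trans (H.norm_D_le j k)

theorem sum_pow_mul_E_le (m k J : ℕ) :
    ∑ j ∈ range J, (10 / 9 : ℝ) ^ (j + m + 1) * E (j + m + 1) k
      ≤ 19 / 18 * ((10 / 9) ^ (m + 1) * E (m + 1) k + (10 / 9) ^ (m + 2) * E (m + 2) k) := by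
  have hnonneg (j : ℕ) : 0 ≤ (10 / 9 : ℝ) ^ (j + m + 1) * E (j + m + 1) k :=
    mul_nonneg (by positivity) (H.E_nonneg _ _)
  refine (sum_range_le_of_le_mul_add_two (κ := 1 / 19) hnonneg (by norm_num)
    (fun j => ?_) J).trans_eq ?_
  · rw [show j + 2 + m + 1 = (j + m + 1) + 2 by ring, pow_add]
    calc (10 / 9 : ℝ) ^ (j + m + 1) * (10 / 9) ^ 2 * E (j + m + 3) k
        ≤ (10 / 9 : ℝ) ^ (j + m + 1) * (10 / 9) ^ 2 * (1 / 24 * E (j + m + 1) k) := by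
          gcongr
          exact H.E_add_three_le _ _
      _ = (10 / 9) ^ 2 / 24 * ((10 / 9 : ℝ) ^ (j + m + 1) * E (j + m + 1) k) := by ring
      _ ≤ _ := mul_le_mul_of_nonneg_right (by norm_num) (hnonneg j)
  · rw [zero_add, show 1 + m + 1 = m + 2 by ring]
    ring

theorem norm_ratio_sub_sum_le_of_forall (hkn : k < n)
    (hk : ∀ i ≤ k, f i ≠ 0 ∧ ‖ratio f i - 1‖ ≤ 1 / 10) {m : ℕ} (hm : m ≤ k + 1) :
    ‖ratio f (k + 1) - 1 - ∑ j ∈ range m, f (k - (j + 1)) / f k * D (j + 1) (k + 1)‖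
      ≤ 19 / 18 * ((10 / 9) ^ (m + 1) * E (m + 1) (k + 1)
        + (10 / 9) ^ (m + 2) * E (m + 2) (k + 1)) := by
  have hf := (hk k le_rfl).1
  obtain ⟨J, hJ⟩ : ∃ J, k + 1 = m + J := ⟨k + 1 - m, by omega⟩
  have htail : ratio f (k + 1) - 1
        - ∑ j ∈ range m, f (k - (j + 1)) / f k * D (j + 1) (k + 1)
      = ∑ j ∈ range J, f (k - (j + m + 1)) / f k * D (j + m + 1) (k + 1) := by
    have hall : ratio f (k + 1) - 1
        = ∑ j ∈ range (m + J), f (k - (j + 1)) / f k * D (j + 1) (k + 1) := by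
      rw [ratio_succ, H.f_succ k hkn, add_div, div_self hf, add_sub_cancel_left, sum_div, hJ]
      exact sum_congr rfl fun j _ => mul_div_right_comm _ _ _
    rw [hall, sum_range_add, add_sub_cancel_left]
    simp only [add_comm m]
  rw [htail]
  refine (norm_sum_le_of_le _ fun j _ => ?_).trans (H.sum_pow_mul_E_le m (k + 1) J)
  rw [norm_mul, norm_div]
  refine mul_le_mul ?_ (H.norm_D_le _ _) (norm_nonneg _) (by positivity)
  rw [div_le_iff₀ (norm_pos_iff.mpr hf)]
  exact (norm_sub_le_pow_mul_norm (by norm_num) hk _).trans_eq (by norm_num)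

theorem forall_ne_zero_and_norm_ratio_sub_one_le (hkn : k ≤ n) :
    ∀ i ≤ k, f i ≠ 0 ∧ ‖ratio f i - 1‖ ≤ 1 / 10 := by
  induction k with
  | zero =>
    intro i hi
    obtain rfl : i = 0 := by omega
    simp [ratio, H.f_zero]
  | succ k ih =>
    have hk := ih (by omega)
    have hstep : ‖ratio f (k + 1) - 1‖ ≤ 1 / 10 := by
      have hsum := H.norm_ratio_sub_sum_le_of_forall hkn hk (Nat.zero_le _)
      have hE₁ := H.E_one_le (k + 1)
      have hE₂ := H.E_two_le (k + 1)
      simp only [range_zero, sum_empty, sub_zero, zero_add] at hsum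
      norm_num at hsum hE₁ hE₂ ⊢
      linarith
    intro i hi
    rcases Nat.of_le_succ hi with h | rfl
    · exact hk i h
    · refine ⟨fun h0 => ?_, hstep⟩
      rw [ratio_succ, h0] at hstep
      norm_num at hstep

theorem norm_ratio_sub_sum_le (hkn : k < n) {m : ℕ} (hm : m ≤ k + 1) :
    ‖ratio f (k + 1) - 1 - ∑ j ∈ range m, f (k - (j + 1)) / f k * D (j + 1) (k + 1)‖
      ≤ 19 / 18 * ((10 / 9) ^ (m + 1) * E (m + 1) (k + 1)
        + (10 / 9) ^ (m + 2) * E (m + 2) (k + 1)) :=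
  H.norm_ratio_sub_sum_le_of_forall hkn (H.forall_ne_zero_and_norm_ratio_sub_one_le hkn.le) hm

theorem f_ne_zero (hk : k ≤ n) : f k ≠ 0 :=
  (H.forall_ne_zero_and_norm_ratio_sub_one_le hk k le_rfl).1

theorem norm_ratio_sub_one_le (hk : k ≤ n) : ‖ratio f k - 1‖ ≤ 1 / 10 :=
  (H.forall_ne_zero_and_norm_ratio_sub_one_le hk k le_rfl).2

theorem ratio_ne_zero (hk : k ≤ n) : ratio f k ≠ 0 :=
  div_ne_zero (H.f_ne_zero hk) (H.f_ne_zero (by omega))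

theorem norm_inv_ratio_le (hk : k ≤ n) : ‖(ratio f k)⁻¹‖ ≤ 10 / 9 :=
  (norm_inv_le_of_norm_sub_one_le (H.norm_ratio_sub_one_le hk) (by norm_num)).trans_eq
    (by norm_num)

theorem norm_inv_ratio_sub_one_le (hk : k ≤ n) :
    ‖(ratio f k)⁻¹ - 1‖ ≤ 10 / 9 * ‖ratio f k - 1‖ := by
  have : (ratio f k)⁻¹ - 1 = -((ratio f k)⁻¹ * (ratio f k - 1)) := by
    linear_combination inv_mul_cancel₀ (H.ratio_ne_zero hk)
  rw [this, norm_neg, norm_mul]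
  gcongr
  exact H.norm_inv_ratio_le hk

theorem f_eq_prod_ratio : f n = ∏ k ∈ range n, ratio f (k + 1) := by
  have h : ∀ m ≤ n, f m = ∏ k ∈ range m, ratio f (k + 1) := by
    intro m
    induction m with
    | zero => simp [H.f_zero]
    | succ m ih =>
      intro hm
      rw [prod_range_succ, ← ih (by omega), ratio_succ, mul_div_cancel₀ _ (H.f_ne_zero (by omega))]
  exact h n le_rfl

theorem norm_ratio_sub_one_le_E (hk : k ≤ n) : ‖ratio f k - 1‖ ≤ 1.18 * E 1 k + 1.31 * E 2 k := by
  have hE₁ := H.E_nonneg 1 k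
  have hE₂ := H.E_nonneg 2 k
  cases k with
  | zero =>
    simp only [ratio, Nat.zero_sub, H.f_zero, div_one, sub_self, norm_zero]
    positivity
  | succ k =>
    have h := H.norm_ratio_sub_sum_le hk (Nat.zero_le _)
    simp only [range_zero, sum_empty, sub_zero, zero_add] at h
    norm_num at h ⊢
    linarith

theorem norm_ratio_succ_sub_first_le (hk : k < n) :
    ‖ratio f (k + 1) - 1 - (ratio f k)⁻¹ * D 1 (k + 1)‖ ≤ 4.25 * E 2 (k + 1) := by
  have h := H.norm_ratio_sub_sum_le hk (m := 1) (by omega)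
  have hE₃ := H.E_add_two_le 1 (k + 1)
  have hE₂ := H.E_nonneg 2 (k + 1)
  simp only [range_one, sum_singleton, zero_add] at h
  rw [ratio.eq_1 f k, inv_div]
  norm_num at h hE₃ ⊢
  linarith

theorem norm_ratio_succ_sub_second_le (hk : k < n) :
    ‖ratio f (k + 1) - 1 - (ratio f k)⁻¹ * D 1 (k + 1)
      - (ratio f k)⁻¹ * (ratio f (k - 1))⁻¹ * D 2 (k + 1)‖ ≤ 5 * E 3 (k + 1) := by
  rcases Nat.eq_zero_or_pos k with rfl | hk0
  · have hf₁ : f 1 = 1 + D 1 1 := by simpa [H.f_zero] using H.f_succ 0 hk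
    have hE₃ := H.E_nonneg 3 1
    rw [zero_add, H.D_eq_zero 2 1 (by norm_num)]
    simpa [ratio, H.f_zero, hf₁] using hE₃
  · have h := H.norm_ratio_sub_sum_le hk (m := 2) (by omega)
    have hE₄ := H.E_add_two_le 2 (k + 1)
    have hE₃ := H.E_nonneg 3 (k + 1)
    have hf₁ : f (k - 1) ≠ 0 := H.f_ne_zero (by omega)
    have hinv : (ratio f k)⁻¹ * (ratio f (k - 1))⁻¹ = f (k - 2) / f k := by
      rw [ratio, ratio, inv_div, inv_div, Nat.sub_sub, mul_comm, div_mul_div_cancel₀ hf₁]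
    simp only [sum_range_succ, range_zero, sum_empty, zero_add] at h
    rw [hinv, ratio.eq_1 f k, inv_div, sub_sub]
    norm_num at h hE₄ ⊢
    linarith

end RatioRecursion

theorem mul_sq_add_sq_mul_le_cube_add_cube {a b : ℝ} (ha : 0 ≤ a) (hb : 0 ≤ b) :
    a * b ^ 2 + a ^ 2 * b ≤ a ^ 3 + b ^ 3 := by
  nlinarith [mul_nonneg (add_nonneg ha hb) (sq_nonneg (a - b))]

theorem norm_one_add_le_of_norm_sub_mul_le {y z : ℂ} {p R : ℝ} (hp : 0 ≤ p)
    (hpz : p * ‖z‖ ≤ 0.0201) (hy : ‖y‖ ≤ 1 / 10) (h : ‖y - z * p‖ ≤ R) :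
    ‖1 + y‖ ≤ Real.exp (p * z.re + 1.061 * R + 0.5 * (p ^ 2 * ‖z‖ ^ 2)) := by
  have hR : 0 ≤ R := (norm_nonneg _).trans h
  have hre : y.re ≤ p * z.re + R := by
    have := (abs_le.mp ((Complex.abs_re_le_norm (y - z * p)).trans h)).2
    rw [Complex.sub_re, Complex.re_mul_ofReal] at this
    linarith
  have hnorm : ‖y‖ ≤ p * ‖z‖ + R := by
    have := norm_add_le_of_le h (le_refl ‖z * (p : ℂ)‖)
    rw [sub_add_cancel, mul_comm z, norm_ofReal_mul_of_nonneg hp] at this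
    linarith
  have hsq : ‖y‖ ^ 2 ≤ p ^ 2 * ‖z‖ ^ 2 + 0.1201 * R := by
    calc ‖y‖ ^ 2 ≤ ‖y‖ * (p * ‖z‖ + R) := by rw [pow_two]; gcongr
      _ = ‖y‖ * (p * ‖z‖) + ‖y‖ * R := mul_add _ _ _
      _ ≤ (p * ‖z‖ + R) * (p * ‖z‖) + 1 / 10 * R := by gcongr
      _ = p ^ 2 * ‖z‖ ^ 2 + R * (p * ‖z‖) + 1 / 10 * R := by ring
      _ ≤ p ^ 2 * ‖z‖ ^ 2 + R * 0.0201 + 1 / 10 * R := by gcongr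
      _ = _ := by ring
  refine (norm_one_add_le y).trans (Real.exp_le_exp.mpr ?_)
  norm_num at hsq ⊢
  linarith

theorem norm_exp_mul_add_sub_quadratic_le {K p γ : ℝ} {z : ℂ} (hK : 1 ≤ K) (hz : ‖z‖ ≤ 3)
    (hp : 0 ≤ p) (hp1 : p ≤ 1) (hγ : |γ| ≤ K * p) :
    ‖Complex.exp (z * p + γ * z ^ 2) - 1 - z * p - (γ + p ^ 2 / 2) * z ^ 2‖
      ≤ (3 * K + (4 * K) ^ 3 * Real.exp (12 * K)) * (‖z‖ ^ 3 * (p ^ 3 + p * |γ|)) := by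
  set u : ℂ := z * p + γ * z ^ 2 with hu
  have hsplit : Complex.exp u - 1 - z * p - (γ + p ^ 2 / 2) * z ^ 2
      = (Complex.exp u - 1 - u - u ^ 2 / 2)
        + ((z * p) * (γ * z ^ 2) + (γ * z ^ 2) ^ 2 / 2) := by
    rw [hu]; ring
  have hzp : ‖z * (p : ℂ)‖ = ‖z‖ * p := by
    rw [mul_comm, norm_ofReal_mul_of_nonneg hp, mul_comm]
  have hcross : ‖(z * p) * (γ * z ^ 2) + (γ * z ^ 2) ^ 2 / 2‖ ≤ 3 * K * (‖z‖ ^ 3 * (p * |γ|)) := by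
    refine (norm_add_le _ _).trans ?_
    rw [norm_mul, norm_div, norm_pow, norm_ofReal_mul_sq, hzp, Complex.norm_ofNat]
    calc ‖z‖ * p * (|γ| * ‖z‖ ^ 2) + (|γ| * ‖z‖ ^ 2) ^ 2 / 2
        = 1 * (‖z‖ ^ 3 * (p * |γ|)) + |γ| * ‖z‖ * (|γ| * ‖z‖ ^ 3) / 2 := by ring
      _ ≤ K * (‖z‖ ^ 3 * (p * |γ|)) + K * p * 3 * (|γ| * ‖z‖ ^ 3) / 2 := by gcongr
      _ = 5 / 2 * (K * (‖z‖ ^ 3 * (p * |γ|))) := by ring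
      _ ≤ 3 * (K * (‖z‖ ^ 3 * (p * |γ|))) := by gcongr; norm_num
      _ = _ := by ring
  have hu_le : ‖u‖ ≤ 4 * K * (‖z‖ * p) := by
    rw [hu]
    refine (norm_add_le _ _).trans ?_
    rw [norm_ofReal_mul_sq, hzp]
    calc ‖z‖ * p + |γ| * ‖z‖ ^ 2 = 1 * (‖z‖ * p) + |γ| * (‖z‖ * ‖z‖) := by ring
      _ ≤ K * (‖z‖ * p) + K * p * (3 * ‖z‖) := by gcongr
      _ = _ := by ring
  have hrem : ‖Complex.exp u - 1 - u - u ^ 2 / 2‖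
      ≤ (4 * K) ^ 3 * Real.exp (12 * K) * (‖z‖ ^ 3 * p ^ 3) := by
    have hu12 : ‖u‖ ≤ 12 * K :=
      hu_le.trans ((by gcongr : _ ≤ 4 * K * (3 * 1)).trans_eq (by ring))
    calc _ ≤ ‖u‖ ^ 3 * Real.exp ‖u‖ := norm_exp_sub_quadratic_le u
      _ ≤ (4 * K * (‖z‖ * p)) ^ 3 * Real.exp (12 * K) := by gcongr
      _ = _ := by ring
  rw [hsplit]
  refine (norm_add_le_of_le hrem hcross).trans ?_
  have : 0 ≤ 3 * K * (‖z‖ ^ 3 * p ^ 3) := by positivity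
  have : 0 ≤ (4 * K) ^ 3 * Real.exp (12 * K) * (‖z‖ ^ 3 * (p * |γ|)) := by positivity
  linarith

theorem norm_prod_sub_prod_le {a b : ℕ → ℂ} {e : ℕ → ℝ} (n : ℕ)
    (ha : ∀ k < n, ‖a k‖ ≤ Real.exp (e k)) (hb : ∀ k < n, ‖b k‖ ≤ Real.exp (e k)) :
    ‖∏ k ∈ range n, a k - ∏ k ∈ range n, b k‖
      ≤ (∑ k ∈ range n, ‖a k - b k‖ * Real.exp (-e k)) * Real.exp (∑ k ∈ range n, e k) := by
  induction n with
  | zero => simp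
  | succ n ih =>
    have hdiff := ih (fun k hk => ha k (by omega)) fun k hk => hb k (by omega)
    have hprod : ‖∏ k ∈ range n, a k‖ ≤ Real.exp (∑ k ∈ range n, e k) := by
      rw [norm_prod, Real.exp_sum]
      exact prod_le_prod (fun _ _ => norm_nonneg _) fun k hk =>
        ha k ((mem_range.mp hk).trans n.lt_succ_self)
    have hsplit : (∏ k ∈ range n, a k) * a n - (∏ k ∈ range n, b k) * b n
        = (∏ k ∈ range n, a k) * (a n - b n)
          + (∏ k ∈ range n, a k - ∏ k ∈ range n, b k) * b n := by ring
    have hcancel : Real.exp (-e n) * Real.exp (e n) = 1 := by rw [← Real.exp_add]; simp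
    rw [prod_range_succ, prod_range_succ, sum_range_succ, sum_range_succ, hsplit, Real.exp_add]
    refine (norm_add_le _ _).trans ?_
    rw [norm_mul, norm_mul]
    calc _ ≤ Real.exp (∑ k ∈ range n, e k) * ‖a n - b n‖
          + (∑ k ∈ range n, ‖a k - b k‖ * Real.exp (-e k))
            * Real.exp (∑ k ∈ range n, e k) * Real.exp (e n) := by
          gcongr
          exact hb n n.lt_succ_self
      _ = _ := by
          linear_combination (-Real.exp (∑ k ∈ range n, e k) * ‖a n - b n‖) * hcancel

end RatioRecursion

/-! ### Expansion of the logarithms of the ratios -/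

section RecursionData
open Finset

/-- A `RatioRecursion` at `z` together with the moment bounds on its coefficients: `p`, `m₂`, `m₃`
play the role of factorial moments of orders one to three, `q`, `q₂` of the mixed moments of two
neighbours of total orders two and three, and `t` of the mixed moment of three consecutive
variables. -/
structure RecursionData (z : ℂ) (K : ℝ) (n : ℕ) (f : ℕ → ℂ) (D : ℕ → ℕ → ℂ) (E : ℕ → ℕ → ℝ)
    (p m₂ m₃ q q₂ t : ℕ → ℝ) : Prop extends RatioRecursion n f D E where
  norm_le : ‖z‖ ≤ 2.01
  one_le : 1 ≤ K
  p_nonneg : ∀ k, 0 ≤ p k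
  m₂_nonneg : ∀ k, 0 ≤ m₂ k
  m₃_nonneg : ∀ k, 0 ≤ m₃ k
  q_nonneg : ∀ k, 0 ≤ q k
  q₂_nonneg : ∀ k, 0 ≤ q₂ k
  t_nonneg : ∀ k, 0 ≤ t k
  p_zero : p 0 = 0
  p_le : ∀ k, p k ≤ 1 / 100
  m₂_le : ∀ k, m₂ k ≤ p k
  q_le : ∀ k, q k ≤ K * p k
  E_one_le_mul : ∀ k, E 1 k ≤ 1.01 * (‖z‖ * p k)
  E_two_le_mul : ∀ k, E 2 k ≤ 1.03 * (‖z‖ ^ 2 * q k)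
  E_three_le_mul : ∀ k, E 3 k ≤ K * (‖z‖ ^ 3 * t k)
  norm_D_one_sub_linear_le : ∀ k, ‖D 1 k - z * p k‖ ≤ 0.51 * (‖z‖ ^ 2 * m₂ k)
  norm_D_one_sub_quadratic_le :
    ∀ k, ‖D 1 k - z * p k - z ^ 2 * m₂ k / 2‖ ≤ K * (‖z‖ ^ 3 * m₃ k)
  norm_D_two_sub_le : ∀ k, ‖D 2 k - z ^ 2 * q k‖ ≤ K * (‖z‖ ^ 3 * q₂ k)

/-- The coefficient of `z ^ 2` in the second order expansion of the logarithm of the ratio of index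
`k + 1`. -/
noncomputable def gammaCoeff (p m₂ q : ℕ → ℝ) (k : ℕ) : ℝ :=
  m₂ (k + 1) / 2 - p (k + 1) ^ 2 / 2 + q (k + 1) - p (k + 1) * p k

/-- The quantity which, multiplied by `‖z‖ ^ 2`, bounds the logarithm of the norm of the ratio of
index `k + 1` beyond its linear part. -/
noncomputable def majorant (p m₂ q : ℕ → ℝ) (k : ℕ) : ℝ :=
  0.6 * m₂ (k + 1) + 4.75 * q (k + 1) + 1.5 * (p (k + 1) * p k) + 0.05 * q k
    + 0.5 * p (k + 1) ^ 2

/-- The third order contribution of the ratio of index `k + 1`: a bound, up to a constant, for the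
coefficient of `‖z‖ ^ 3` in the remainder of the second order expansion. -/
noncomputable def thirdOrder (p m₂ m₃ q q₂ t : ℕ → ℝ) (k : ℕ) : ℝ :=
  p (k + 1) ^ 3 + p k ^ 3 + p (k + 1) * m₂ (k + 1) + m₃ (k + 1)
    + (p (k - 1) + p k + p (k + 1)) * q (k + 1) + q₂ (k + 1) + m₂ k * p (k + 1)
    + p k * m₂ (k + 1) + t (k + 1) + p (k + 1) * q k + p (k - 1) * p k * p (k + 1)

/-- The constant of the third order remainder of one ratio. -/
noncomputable def ratioConst (K : ℝ) : ℝ :=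
  3 * (18 * K ^ 2 + (3 * (2 * K) + (4 * (2 * K)) ^ 3 * Real.exp (12 * (2 * K))))

theorem ratioConst_pos {K : ℝ} (hK : 0 < K) : 0 < ratioConst K := by
  unfold ratioConst
  positivity

theorem mul_sub_quadratic_eq_of_mul_one_add_eq_one {R : Type*} [Field R] {A α : R}
    (hA : A * (1 + α) = 1) (d z p p' m : R) :
    A * d - z * p - (m / 2 - p * p') * z ^ 2
      = (d - z * p - z ^ 2 * m / 2) - p * z * (α - z * p') - (d - z * p) * α + d * α ^ 2 * A := by
  linear_combination (1 - α) * d * hA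

namespace RecursionData

variable {z : ℂ} {K : ℝ} {n : ℕ} {f : ℕ → ℂ} {D : ℕ → ℕ → ℂ} {E : ℕ → ℕ → ℝ}
  {p m₂ m₃ q q₂ t : ℕ → ℝ} (H : RecursionData z K n f D E p m₂ m₃ q q₂ t) {k : ℕ}
include H

theorem K_nonneg : 0 ≤ K := zero_le_one.trans H.one_le

theorem le_K_mul {a : ℝ} (ha : 0 ≤ a) : a ≤ K * a := le_mul_of_one_le_left ha H.one_le

theorem norm_D_one_le (k : ℕ) : ‖D 1 k‖ ≤ 1.01 * (‖z‖ * p k) :=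
  (H.norm_D_le 1 k).trans (H.E_one_le_mul k)

theorem norm_D_two_le (k : ℕ) : ‖D 2 k‖ ≤ 1.03 * (‖z‖ ^ 2 * q k) :=
  (H.norm_D_le 2 k).trans (H.E_two_le_mul k)

theorem p_mul_norm_le (k : ℕ) : p k * ‖z‖ ≤ 0.0201 :=
  (mul_le_mul (H.p_le k) H.norm_le (norm_nonneg z) (by norm_num)).trans_eq (by norm_num)

theorem abs_gammaCoeff_le_majorant (k : ℕ) : |gammaCoeff p m₂ q k| ≤ majorant p m₂ q k := by
  have := H.m₂_nonneg (k + 1)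
  have := H.q_nonneg (k + 1)
  have := H.q_nonneg k
  have := mul_nonneg (H.p_nonneg (k + 1)) (H.p_nonneg k)
  have := sq_nonneg (p (k + 1))
  unfold gammaCoeff majorant
  rw [abs_le]
  norm_num
  constructor <;> linarith

theorem majorant_nonneg (k : ℕ) : 0 ≤ majorant p m₂ q k :=
  (abs_nonneg _).trans (H.abs_gammaCoeff_le_majorant k)

theorem abs_gammaCoeff_le (k : ℕ) : |gammaCoeff p m₂ q k| ≤ 2 * K * p (k + 1) := by
  have := H.m₂_le (k + 1)
  have := H.m₂_nonneg (k + 1)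
  have := H.q_le (k + 1)
  have := H.q_nonneg (k + 1)
  have hp := H.p_nonneg (k + 1)
  have := mul_nonneg hp (H.p_nonneg k)
  have : p (k + 1) * p k ≤ p (k + 1) * (1 / 100) := by gcongr; exact H.p_le _
  have : p (k + 1) ^ 2 ≤ p (k + 1) * (1 / 100) := by rw [pow_two]; gcongr; exact H.p_le _
  have := sq_nonneg (p (k + 1))
  have := H.le_K_mul hp
  unfold gammaCoeff
  rw [abs_le]
  constructor <;> linarith

theorem norm_ratio_sub_one_le_mul (hk : k ≤ n) : ‖ratio f k - 1‖ ≤ 4 * K * (‖z‖ * p k) := by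
  have hp := H.p_nonneg k
  have hK := H.K_nonneg
  have hz := H.norm_le
  have hE₁ := H.E_one_le_mul k
  have hE₂ : E 2 k ≤ 1.03 * (2.01 * (K * (‖z‖ * p k))) := by
    calc E 2 k ≤ 1.03 * (‖z‖ ^ 2 * (K * p k)) :=
          (H.E_two_le_mul k).trans (by gcongr; exact H.q_le k)
      _ = 1.03 * (‖z‖ * (K * (‖z‖ * p k))) := by ring
      _ ≤ _ := by gcongr
  have hzp : 0 ≤ ‖z‖ * p k := by positivity
  have := H.le_K_mul hzp
  refine (H.norm_ratio_sub_one_le_E hk).trans ?_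
  norm_num at hE₁ hE₂ ⊢
  linarith

theorem norm_ratio_succ_sub_linear_le (hk : k < n) :
    ‖ratio f (k + 1) - 1 - z * p (k + 1)‖ ≤ ‖z‖ ^ 2 * (0.51 * m₂ (k + 1) + 4.4 * q (k + 1))
      + 10 / 9 * ‖ratio f k - 1‖ * ‖D 1 (k + 1)‖ := by
  have hsplit : ratio f (k + 1) - 1 - z * p (k + 1)
      = (ratio f (k + 1) - 1 - (ratio f k)⁻¹ * D 1 (k + 1)) + (D 1 (k + 1) - z * p (k + 1))
        + ((ratio f k)⁻¹ - 1) * D 1 (k + 1) := by ring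
  have hinv : ‖((ratio f k)⁻¹ - 1) * D 1 (k + 1)‖
      ≤ 10 / 9 * ‖ratio f k - 1‖ * ‖D 1 (k + 1)‖ := by
    rw [norm_mul]
    gcongr
    exact H.norm_inv_ratio_sub_one_le hk.le
  have hE₂ := H.E_two_le_mul (k + 1)
  have : 0 ≤ ‖z‖ ^ 2 * q (k + 1) := mul_nonneg (by positivity) (H.q_nonneg _)
  rw [hsplit]
  refine (norm_add_le_of_le (norm_add_le_of_le (H.norm_ratio_succ_sub_first_le hk)
    (H.norm_D_one_sub_linear_le (k + 1))) hinv).trans ?_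
  norm_num at hE₂ ⊢
  linarith

theorem norm_ratio_sub_linear_le (hk : k ≤ n) :
    ‖ratio f k - 1 - z * p k‖ ≤ 5 * K * (‖z‖ ^ 2 * (m₂ k + q k + p k * p (k - 1))) := by
  have hK := H.K_nonneg
  have hm := H.m₂_nonneg k
  have hq := H.q_nonneg k
  have hp := H.p_nonneg k
  have hp' := H.p_nonneg (k - 1)
  cases k with
  | zero =>
    simp only [ratio, Nat.zero_sub, H.f_zero, H.p_zero, div_one, sub_self,
      Complex.ofReal_zero, mul_zero, norm_zero, add_zero]
    positivity
  | succ k =>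
    rw [Nat.add_sub_cancel] at hp' ⊢
    refine (H.norm_ratio_succ_sub_linear_le hk).trans ?_
    calc _ ≤ ‖z‖ ^ 2 * (0.51 * m₂ (k + 1) + 4.4 * q (k + 1))
          + 10 / 9 * (4 * K * (‖z‖ * p k)) * (1.01 * (‖z‖ * p (k + 1))) := by
          gcongr
          · exact H.norm_ratio_sub_one_le_mul (by omega)
          · exact H.norm_D_one_le _
      _ = 0.51 * (‖z‖ ^ 2 * m₂ (k + 1)) + 4.4 * (‖z‖ ^ 2 * q (k + 1))
          + 10 / 9 * 4 * 1.01 * (K * (‖z‖ ^ 2 * (p (k + 1) * p k))) := by ring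
      _ ≤ 0.51 * (K * (‖z‖ ^ 2 * m₂ (k + 1))) + 4.4 * (K * (‖z‖ ^ 2 * q (k + 1)))
          + 10 / 9 * 4 * 1.01 * (K * (‖z‖ ^ 2 * (p (k + 1) * p k))) := by
          gcongr 0.51 * ?_ + 4.4 * ?_ + _ <;> exact H.le_K_mul (by positivity)
      _ ≤ 5 * (K * (‖z‖ ^ 2 * m₂ (k + 1))) + 5 * (K * (‖z‖ ^ 2 * q (k + 1)))
          + 5 * (K * (‖z‖ ^ 2 * (p (k + 1) * p k))) := by gcongr <;> norm_num
      _ = _ := by ring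

theorem norm_ratio_succ_sub_linear_le_majorant (hk : k < n) :
    ‖ratio f (k + 1) - 1 - z * p (k + 1)‖ ≤ ‖z‖ ^ 2 * (0.51 * m₂ (k + 1) + 4.4 * q (k + 1)
      + 1.4 * (p (k + 1) * p k) + 0.04 * q k) := by
  have hp := H.p_nonneg k
  have hp' := H.p_nonneg (k + 1)
  have hq := H.q_nonneg k
  have hratio : ‖ratio f k - 1‖ ≤ 1.1918 * (‖z‖ * p k) + 1.3493 * (‖z‖ ^ 2 * q k) := by
    have h := H.norm_ratio_sub_one_le_E hk.le
    have hE₁ := H.E_one_le_mul k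
    have hE₂ := H.E_two_le_mul k
    norm_num at h hE₁ hE₂ ⊢
    linarith
  have hprod : 10 / 9 * ‖ratio f k - 1‖ * ‖D 1 (k + 1)‖
      ≤ 1.4 * (‖z‖ ^ 2 * (p (k + 1) * p k)) + 0.04 * (‖z‖ ^ 2 * q k) := by
    calc _ ≤ 10 / 9 * (1.1918 * (‖z‖ * p k) + 1.3493 * (‖z‖ ^ 2 * q k)) * ‖D 1 (k + 1)‖ := by
          gcongr
      _ = 10 / 9 * 1.1918 * (‖z‖ * p k) * ‖D 1 (k + 1)‖
          + 10 / 9 * 1.3493 * (‖z‖ ^ 2 * q k) * ‖D 1 (k + 1)‖ := by ring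
      _ ≤ 10 / 9 * 1.1918 * (‖z‖ * p k) * (1.01 * (‖z‖ * p (k + 1)))
          + 10 / 9 * 1.3493 * (‖z‖ ^ 2 * q k) * 0.0204 := by
          gcongr
          · exact H.norm_D_one_le _
          · exact (H.norm_D_le _ _).trans (H.E_one_le _)
      _ = 10 / 9 * 1.1918 * 1.01 * (‖z‖ ^ 2 * (p (k + 1) * p k))
          + 10 / 9 * 1.3493 * 0.0204 * (‖z‖ ^ 2 * q k) := by ring
      _ ≤ _ := by gcongr <;> norm_num
  refine (H.norm_ratio_succ_sub_linear_le hk).trans ((add_le_add_right hprod _).trans_eq ?_)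
  ring

theorem norm_inv_ratio_mul_D_one_sub_le (hk : k ≤ n) :
    ‖(ratio f k)⁻¹ * D 1 (k + 1) - z * p (k + 1) - (m₂ (k + 1) / 2 - p (k + 1) * p k) * z ^ 2‖
      ≤ 18 * K ^ 2 * (‖z‖ ^ 3 * (m₃ (k + 1) + p (k + 1) * (m₂ k + q k + p k * p (k - 1))
        + p k * m₂ (k + 1) + p (k + 1) * p k ^ 2)) := by
  set A := (ratio f k)⁻¹
  set α := ratio f k - 1 with hα_def
  have hK := H.K_nonneg
  have hKK : K ≤ K ^ 2 := le_self_pow₀ H.one_le (by norm_num)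
  have hp := H.p_nonneg k
  have hp' := H.p_nonneg (k + 1)
  have hp'' := H.p_nonneg (k - 1)
  have hm := H.m₂_nonneg k
  have hm' := H.m₂_nonneg (k + 1)
  have hm₃ := H.m₃_nonneg (k + 1)
  have hq := H.q_nonneg k
  have hα : ‖α‖ ≤ 4 * K * (‖z‖ * p k) := H.norm_ratio_sub_one_le_mul hk
  have hA : A * (1 + α) = 1 := by
    rw [hα_def, add_sub_cancel]
    exact inv_mul_cancel₀ (H.ratio_ne_zero hk)
  have hlinear : ‖p (k + 1) * z * (α - z * p k)‖
      ≤ p (k + 1) * ‖z‖ * (5 * K * (‖z‖ ^ 2 * (m₂ k + q k + p k * p (k - 1)))) := by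
    rw [norm_mul, norm_ofReal_mul_of_nonneg hp']
    gcongr
    exact H.norm_ratio_sub_linear_le hk
  have hmixed : ‖(D 1 (k + 1) - z * p (k + 1)) * α‖
      ≤ 0.51 * (‖z‖ ^ 2 * m₂ (k + 1)) * (4 * K * (‖z‖ * p k)) := by
    rw [norm_mul]
    gcongr
    exact H.norm_D_one_sub_linear_le _
  have hsq : ‖D 1 (k + 1) * α ^ 2 * A‖
      ≤ 1.01 * (‖z‖ * p (k + 1)) * (4 * K * (‖z‖ * p k)) ^ 2 * (10 / 9) := by
    rw [norm_mul, norm_mul, norm_pow]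
    gcongr
    exacts [H.norm_D_one_le _, H.norm_inv_ratio_le hk]
  rw [mul_sub_quadratic_eq_of_mul_one_add_eq_one hA]
  refine (norm_add_le_of_le (norm_sub_le_of_le (norm_sub_le_of_le
    (H.norm_D_one_sub_quadratic_le (k + 1)) hlinear) hmixed) hsq).trans ?_
  calc _ = 1 * K * (‖z‖ ^ 3 * m₃ (k + 1))
        + 5 * K * (‖z‖ ^ 3 * (p (k + 1) * (m₂ k + q k + p k * p (k - 1))))
        + 0.51 * 4 * K * (‖z‖ ^ 3 * (p k * m₂ (k + 1)))
        + 1.01 * 16 * (10 / 9) * K ^ 2 * (‖z‖ ^ 3 * (p (k + 1) * p k ^ 2)) := by ring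
    _ ≤ 18 * K ^ 2 * (‖z‖ ^ 3 * m₃ (k + 1))
        + 18 * K ^ 2 * (‖z‖ ^ 3 * (p (k + 1) * (m₂ k + q k + p k * p (k - 1))))
        + 18 * K ^ 2 * (‖z‖ ^ 3 * (p k * m₂ (k + 1)))
        + 18 * K ^ 2 * (‖z‖ ^ 3 * (p (k + 1) * p k ^ 2)) := by
      gcongr <;> norm_num
    _ = _ := by ring

theorem norm_inv_ratio_mul_D_two_sub_le (hk : k ≤ n) :
    ‖(ratio f k)⁻¹ * (ratio f (k - 1))⁻¹ * D 2 (k + 1) - q (k + 1) * z ^ 2‖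
      ≤ 18 * K ^ 2 * (‖z‖ ^ 3 * ((p k + p (k - 1)) * q (k + 1) + q₂ (k + 1))) := by
  set A := (ratio f k)⁻¹
  set B := (ratio f (k - 1))⁻¹
  have hk' : k - 1 ≤ n := by omega
  have hK := H.K_nonneg
  have hKK : K ≤ K ^ 2 := le_self_pow₀ H.one_le (by norm_num)
  have hp := H.p_nonneg k
  have hp'' := H.p_nonneg (k - 1)
  have hq := H.q_nonneg (k + 1)
  have hq₂ := H.q₂_nonneg (k + 1)
  have hA : ‖A - 1‖ ≤ 10 / 9 * (4 * K * (‖z‖ * p k)) :=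
    (H.norm_inv_ratio_sub_one_le hk).trans (by gcongr; exact H.norm_ratio_sub_one_le_mul hk)
  have hB : ‖B - 1‖ ≤ 10 / 9 * (4 * K * (‖z‖ * p (k - 1))) :=
    (H.norm_inv_ratio_sub_one_le hk').trans (by gcongr; exact H.norm_ratio_sub_one_le_mul hk')
  have hAB : ‖A * B - 1‖ ≤ 5 * K * (‖z‖ * (p k + p (k - 1))) := by
    have hsplit : A * B - 1 = (A - 1) * B + (B - 1) := by ring
    rw [hsplit]
    refine (norm_add_le _ _).trans ?_
    rw [norm_mul]
    calc _ ≤ 10 / 9 * (4 * K * (‖z‖ * p k)) * (10 / 9)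
          + 10 / 9 * (4 * K * (‖z‖ * p (k - 1))) := by gcongr; exact H.norm_inv_ratio_le hk'
      _ = 400 / 81 * (K * (‖z‖ * p k)) + 40 / 9 * (K * (‖z‖ * p (k - 1))) := by ring
      _ ≤ 5 * (K * (‖z‖ * p k)) + 5 * (K * (‖z‖ * p (k - 1))) := by gcongr <;> norm_num
      _ = _ := by ring
  have hsplit : A * B * D 2 (k + 1) - q (k + 1) * z ^ 2
      = (A * B - 1) * D 2 (k + 1) + (D 2 (k + 1) - z ^ 2 * q (k + 1)) := by ring
  rw [hsplit]
  refine (norm_add_le_of_le (norm_mul_le_of_le hAB (H.norm_D_two_le (k + 1)))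
    (H.norm_D_two_sub_le (k + 1))).trans ?_
  calc _ = 5 * 1.03 * K * (‖z‖ ^ 3 * ((p k + p (k - 1)) * q (k + 1)))
        + 1 * K * (‖z‖ ^ 3 * q₂ (k + 1)) := by ring
    _ ≤ 18 * K ^ 2 * (‖z‖ ^ 3 * ((p k + p (k - 1)) * q (k + 1)))
        + 18 * K ^ 2 * (‖z‖ ^ 3 * q₂ (k + 1)) := by gcongr <;> norm_num
    _ = _ := by ring

theorem norm_ratio_succ_sub_quadratic_le (hk : k < n) :
    ‖ratio f (k + 1) - 1 - z * p (k + 1)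
        - (gammaCoeff p m₂ q k + p (k + 1) ^ 2 / 2) * z ^ 2‖
      ≤ 18 * K ^ 2 * (‖z‖ ^ 3 * (m₃ (k + 1) + p (k + 1) * (m₂ k + q k + p k * p (k - 1))
        + p k * m₂ (k + 1) + p (k + 1) * p k ^ 2
        + ((p k + p (k - 1)) * q (k + 1) + q₂ (k + 1)) + t (k + 1))) := by
  have hsplit : ratio f (k + 1) - 1 - z * p (k + 1)
        - (gammaCoeff p m₂ q k + p (k + 1) ^ 2 / 2) * z ^ 2
      = ((ratio f k)⁻¹ * D 1 (k + 1) - z * p (k + 1)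
          - (m₂ (k + 1) / 2 - p (k + 1) * p k) * z ^ 2)
        + ((ratio f k)⁻¹ * (ratio f (k - 1))⁻¹ * D 2 (k + 1) - q (k + 1) * z ^ 2)
        + (ratio f (k + 1) - 1 - (ratio f k)⁻¹ * D 1 (k + 1)
          - (ratio f k)⁻¹ * (ratio f (k - 1))⁻¹ * D 2 (k + 1)) := by
    unfold gammaCoeff
    push_cast
    ring
  have htail : 5 * E 3 (k + 1) ≤ 18 * K ^ 2 * (‖z‖ ^ 3 * t (k + 1)) := by
    have := H.K_nonneg
    have := H.t_nonneg (k + 1)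
    have : K ≤ K ^ 2 := le_self_pow₀ H.one_le (by norm_num)
    calc 5 * E 3 (k + 1) ≤ 5 * (K * (‖z‖ ^ 3 * t (k + 1))) := by
          gcongr
          exact H.E_three_le_mul _
      _ = 5 * K * (‖z‖ ^ 3 * t (k + 1)) := by ring
      _ ≤ _ := by gcongr; norm_num
  rw [hsplit]
  refine (norm_add_le_of_le (norm_add_le_of_le (H.norm_inv_ratio_mul_D_one_sub_le hk.le)
    (H.norm_inv_ratio_mul_D_two_sub_le hk.le))
    ((H.norm_ratio_succ_sub_second_le hk).trans htail)).trans_eq ?_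
  ring

theorem contributions_le_thirdOrder (k : ℕ) :
    m₃ (k + 1) + p (k + 1) * (m₂ k + q k + p k * p (k - 1)) + p k * m₂ (k + 1)
        + p (k + 1) * p k ^ 2 + ((p k + p (k - 1)) * q (k + 1) + q₂ (k + 1)) + t (k + 1)
        + (p (k + 1) ^ 3 + p (k + 1) * |gammaCoeff p m₂ q k|)
      ≤ 3 * thirdOrder p m₂ m₃ q q₂ t k := by
  have hp := H.p_nonneg k
  have hp' := H.p_nonneg (k + 1)
  have hp'' := H.p_nonneg (k - 1)
  have hm := H.m₂_nonneg k
  have hm' := H.m₂_nonneg (k + 1)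
  have hm₃ := H.m₃_nonneg (k + 1)
  have hq := H.q_nonneg k
  have hq' := H.q_nonneg (k + 1)
  have hq₂ := H.q₂_nonneg (k + 1)
  have ht := H.t_nonneg (k + 1)
  have hγ : |gammaCoeff p m₂ q k|
      ≤ m₂ (k + 1) / 2 + p (k + 1) ^ 2 / 2 + q (k + 1) + p (k + 1) * p k := by
    have := mul_nonneg hp' hp
    have := sq_nonneg (p (k + 1))
    unfold gammaCoeff
    rw [abs_le]
    constructor <;> linarith
  have hpγ := mul_le_mul_of_nonneg_left hγ hp'
  have hcube := mul_sq_add_sq_mul_le_cube_add_cube hp' hp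
  have : 0 ≤ p (k + 1) ^ 3 / 2 + 2 * p k ^ 3 + 5 / 2 * (p (k + 1) * m₂ (k + 1)) + 2 * m₃ (k + 1)
    + 2 * ((p (k - 1) + p k + p (k + 1)) * q (k + 1)) + 2 * q₂ (k + 1) + 2 * (m₂ k * p (k + 1))
    + 2 * (p k * m₂ (k + 1)) + 2 * t (k + 1) + 2 * (p (k + 1) * q k)
    + 2 * (p (k - 1) * p k * p (k + 1)) := by positivity
  unfold thirdOrder
  linarith

theorem norm_ratio_succ_sub_exp_le (hk : k < n) :
    ‖ratio f (k + 1) - Complex.exp (z * p (k + 1) + gammaCoeff p m₂ q k * z ^ 2)‖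
      ≤ ratioConst K * (‖z‖ ^ 3 * thirdOrder p m₂ m₃ q q₂ t k) := by
  have hK := H.one_le
  have hz : ‖z‖ ≤ 3 := H.norm_le.trans (by norm_num)
  have hp := H.p_nonneg (k + 1)
  have hp1 : p (k + 1) ≤ 1 := (H.p_le _).trans (by norm_num)
  have hratio := H.norm_ratio_succ_sub_quadratic_le hk
  have hexp := norm_exp_mul_add_sub_quadratic_le (by linarith) hz hp hp1 (H.abs_gammaCoeff_le k)
  have hsum := H.contributions_le_thirdOrder k
  set S₁ := m₃ (k + 1) + p (k + 1) * (m₂ k + q k + p k * p (k - 1)) + p k * m₂ (k + 1)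
    + p (k + 1) * p k ^ 2 + ((p k + p (k - 1)) * q (k + 1) + q₂ (k + 1)) + t (k + 1)
  set S₂ := p (k + 1) ^ 3 + p (k + 1) * |gammaCoeff p m₂ q k|
  set C₁ := 18 * K ^ 2
  set C₂ := 3 * (2 * K) + (4 * (2 * K)) ^ 3 * Real.exp (12 * (2 * K))
  have hS₁ : 0 ≤ ‖z‖ ^ 3 * S₁ :=
    nonneg_of_mul_nonneg_right ((norm_nonneg _).trans hratio) (by positivity)
  have : 0 ≤ ‖z‖ ^ 3 * S₂ := by positivity
  have htriangle := norm_sub_le_of_le hratio hexp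
  simp only [sub_sub_sub_cancel_right] at htriangle
  calc _ ≤ C₁ * (‖z‖ ^ 3 * S₁) + C₂ * (‖z‖ ^ 3 * S₂) := htriangle
    _ ≤ (C₁ + C₂) * (‖z‖ ^ 3 * S₁) + (C₁ + C₂) * (‖z‖ ^ 3 * S₂) := by
        gcongr
        · exact le_add_of_nonneg_right (by positivity)
        · exact le_add_of_nonneg_left (by positivity)
    _ = (C₁ + C₂) * (‖z‖ ^ 3 * (S₁ + S₂)) := by ring
    _ ≤ (C₁ + C₂) * (‖z‖ ^ 3 * (3 * thirdOrder p m₂ m₃ q q₂ t k)) := by gcongr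
    _ = _ := by rw [ratioConst]; ring

theorem norm_ratio_succ_le (hk : k < n) :
    ‖ratio f (k + 1)‖ ≤ Real.exp (p (k + 1) * z.re + majorant p m₂ q k * ‖z‖ ^ 2) := by
  have hnorm := norm_one_add_le_of_norm_sub_mul_le (H.p_nonneg (k + 1)) (H.p_mul_norm_le (k + 1))
    (H.norm_ratio_sub_one_le hk) (H.norm_ratio_succ_sub_linear_le_majorant hk)
  rw [add_sub_cancel] at hnorm
  refine hnorm.trans (Real.exp_le_exp.mpr ?_)
  have hmajorant : 1.061 * (0.51 * m₂ (k + 1) + 4.4 * q (k + 1) + 1.4 * (p (k + 1) * p k)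
      + 0.04 * q k) + 0.5 * p (k + 1) ^ 2 ≤ majorant p m₂ q k := by
    have := H.m₂_nonneg (k + 1)
    have := H.q_nonneg (k + 1)
    have := H.q_nonneg k
    have := mul_nonneg (H.p_nonneg (k + 1)) (H.p_nonneg k)
    unfold majorant
    norm_num
    linarith
  linarith [mul_le_mul_of_nonneg_right hmajorant (sq_nonneg ‖z‖)]

theorem norm_exp_factor_le (k : ℕ) :
    ‖Complex.exp (z * p (k + 1) + gammaCoeff p m₂ q k * z ^ 2)‖
      ≤ Real.exp (p (k + 1) * z.re + majorant p m₂ q k * ‖z‖ ^ 2) := by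
  have hre := re_ofReal_mul_sq_le (gammaCoeff p m₂ q k) z
  have hγ := mul_le_mul_of_nonneg_right (H.abs_gammaCoeff_le_majorant k) (sq_nonneg ‖z‖)
  rw [Complex.norm_exp, Complex.add_re, Complex.re_mul_ofReal, Real.exp_le_exp]
  linarith

theorem exp_neg_factor_le_two (k : ℕ) :
    Real.exp (-(p (k + 1) * z.re + majorant p m₂ q k * ‖z‖ ^ 2)) ≤ 2 := by
  have hre := mul_le_mul_of_nonneg_left (abs_le.mp (Complex.abs_re_le_norm z)).1
    (H.p_nonneg (k + 1))
  have hmajorant := mul_nonneg (H.majorant_nonneg k) (sq_nonneg ‖z‖)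
  have hpz := H.p_mul_norm_le (k + 1)
  norm_num at hpz
  calc _ ≤ Real.exp (1 / 2) := Real.exp_le_exp.mpr (by linarith)
    _ ≤ 2 := exp_le_two_of_abs_le (abs_of_pos one_half_pos).le

theorem norm_sub_exp_le :
    ‖f n - Complex.exp (z * (∑ k ∈ range n, p (k + 1) : ℝ)
        + (∑ k ∈ range n, gammaCoeff p m₂ q k : ℝ) * z ^ 2)‖
      ≤ 2 * ratioConst K * (‖z‖ ^ 3 * ∑ k ∈ range n, thirdOrder p m₂ m₃ q q₂ t k)
        * Real.exp ((∑ k ∈ range n, p (k + 1)) * z.re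
          + (∑ k ∈ range n, majorant p m₂ q k) * ‖z‖ ^ 2) := by
  have h := norm_prod_sub_prod_le n (fun k hk => H.norm_ratio_succ_le hk)
    fun k _ => H.norm_exp_factor_le k
  rw [← H.f_eq_prod_ratio, ← Complex.exp_sum, sum_add_distrib, sum_add_distrib,
    ← mul_sum, ← sum_mul, ← sum_mul, ← sum_mul] at h
  push_cast
  refine h.trans ?_
  gcongr
  rw [mul_sum, mul_sum]
  refine sum_le_sum fun k hk => ?_
  have hk := H.norm_ratio_succ_sub_exp_le (mem_range.mp hk)
  calc _ ≤ _ * 2 :=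
        mul_le_mul hk (H.exp_neg_factor_le_two k) (Real.exp_pos _).le ((norm_nonneg _).trans hk)
    _ = _ := by ring

end RecursionData

end RecursionData

/-! ### Heinrich's expansion -/

section BoundedMeasurable
variable {Ω : Type*} {𝕜 : Type*} [RCLike 𝕜]

/-- Bounded functions measurable with respect to a given σ-algebra. -/
structure BddMeas (m : MeasurableSpace Ω) (g : Ω → 𝕜) : Prop where
  meas : Measurable[m] g
  bdd : ∃ C : ℝ, ∀ ω, ‖g ω‖ ≤ C

namespace BddMeas
variable {m m' : MeasurableSpace Ω} {g h : Ω → 𝕜}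

theorem mono (hg : BddMeas m g) (hm : m ≤ m') : BddMeas m' g :=
  ⟨hg.meas.mono hm le_rfl, hg.bdd⟩

theorem mul (hg : BddMeas m g) (hh : BddMeas m h) : BddMeas m (fun ω => g ω * h ω) := by
  obtain ⟨C, hC⟩ := hg.bdd
  obtain ⟨C', hC'⟩ := hh.bdd
  refine ⟨hg.meas.mul hh.meas, C * C', fun ω => ?_⟩
  rw [norm_mul]
  exact mul_le_mul (hC ω) (hC' ω) (norm_nonneg _) ((norm_nonneg _).trans (hC ω))

theorem add (hg : BddMeas m g) (hh : BddMeas m h) : BddMeas m (fun ω => g ω + h ω) := by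
  obtain ⟨C, hC⟩ := hg.bdd
  obtain ⟨C', hC'⟩ := hh.bdd
  exact ⟨hg.meas.add hh.meas, C + C', fun ω => norm_add_le_of_le (hC ω) (hC' ω)⟩

theorem const (c : 𝕜) : BddMeas m (fun _ : Ω => c) := ⟨measurable_const, ‖c‖, fun _ => le_rfl⟩

theorem prod {ι : Type*} (s : Finset ι) {g : ι → Ω → 𝕜} (hg : ∀ i ∈ s, BddMeas m (g i)) :
    BddMeas m (fun ω => ∏ i ∈ s, g i ω) := by
  classical
  induction s using Finset.induction_on with
  | empty => simpa using const (1 : 𝕜)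
  | insert a s ha ih =>
    simp_rw [Finset.prod_insert ha]
    exact (hg a (by simp)).mul (ih fun i hi => hg i (by simp [hi]))

theorem integrable {mΩ : MeasurableSpace Ω} {μ : Measure Ω} [IsFiniteMeasure μ] {g : Ω → 𝕜}
    (hg : BddMeas mΩ g) : Integrable g μ := by
  obtain ⟨C, hC⟩ := hg.bdd
  exact Integrable.of_bound hg.meas.aestronglyMeasurable C (Filter.Eventually.of_forall hC)

theorem integral_mul {m m' mΩ : MeasurableSpace Ω} {μ : Measure Ω} {g h : Ω → 𝕜} (hm : m ≤ mΩ)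
    (hm' : m' ≤ mΩ) (hind : Indep m m' μ) (hg : BddMeas m g) (hh : BddMeas m' h) :
    ∫ ω, g ω * h ω ∂μ = (∫ ω, g ω ∂μ) * ∫ ω, h ω ∂μ := by
  refine IndepFun.integral_fun_mul_eq_mul_integral ?_
    (hg.mono hm).meas.aestronglyMeasurable (hh.mono hm').meas.aestronglyMeasurable
  rw [IndepFun_iff_Indep]
  exact indep_of_indep_of_le hind hg.meas.comap_le hh.meas.comap_le

theorem comp_of_le {Y : Ω → ℕ} {B : ℕ} (hY : ∀ ω, Y ω ≤ B) (φ : ℕ → 𝕜)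
    (hm : MeasurableSpace.comap Y ⊤ ≤ m) : BddMeas m (fun ω => φ (Y ω)) := by
  refine ⟨?_, ∑ i ∈ Finset.range (B + 1), ‖φ i‖, fun ω => ?_⟩
  · have hY' : Measurable[m] Y := fun s _ => hm _ ⟨s, trivial, rfl⟩
    exact (measurable_from_top (f := φ)).comp hY'
  · exact Finset.single_le_sum (f := fun i => ‖φ i‖) (fun i _ => norm_nonneg _)
      (by simpa [Nat.lt_succ_iff] using hY ω)

end BddMeas
end BoundedMeasurable

theorem natCast_mul_sub_one_nonneg (y : ℕ) : 0 ≤ (y : ℝ) * (y - 1) := by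
  cases y with
  | zero => simp
  | succ y => push_cast; rw [add_sub_cancel_right]; positivity

section Dependent
variable {Ω : Type*} {mΩ : MeasurableSpace Ω}

/-- The σ-algebra generated by the variables with index at most `s`. -/
@[reducible] def past (Y : ℕ → Ω → ℕ) (s : ℕ) : MeasurableSpace Ω :=
  ⨆ i ∈ Set.Iic s, MeasurableSpace.comap (Y i) ⊤

/-- The σ-algebra generated by the variables with index at least `t`. -/
@[reducible] def future (Y : ℕ → Ω → ℕ) (t : ℕ) : MeasurableSpace Ω :=
  ⨆ i ∈ Set.Ici t, MeasurableSpace.comap (Y i) ⊤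

theorem comap_le_past (Y : ℕ → Ω → ℕ) {i s : ℕ} (h : i ≤ s) :
    MeasurableSpace.comap (Y i) ⊤ ≤ past Y s :=
  le_iSup₂_of_le (f := fun i (_ : i ∈ Set.Iic s) => MeasurableSpace.comap (Y i) ⊤) i h le_rfl

theorem comap_le_future (Y : ℕ → Ω → ℕ) {i t : ℕ} (h : t ≤ i) :
    MeasurableSpace.comap (Y i) ⊤ ≤ future Y t :=
  le_iSup₂_of_le (f := fun i (_ : i ∈ Set.Ici t) => MeasurableSpace.comap (Y i) ⊤) i h le_rfl

/-- A uniformly bounded 1-dependent sequence starting with `Y 0 = 0`. -/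
structure BddOneDep (μ : Measure Ω) (B : ℕ) (Y : ℕ → Ω → ℕ) : Prop where
  meas : ∀ k, Measurable (Y k)
  le : ∀ k ω, Y k ω ≤ B
  zero : ∀ ω, Y 0 ω = 0
  indep : ∀ s t, s + 1 < t → Indep (past Y s) (future Y t) μ

namespace BddOneDep
variable {μ : Measure Ω} {B : ℕ} {Y : ℕ → Ω → ℕ} (hY : BddOneDep μ B Y)
include hY

theorem past_le (s : ℕ) : past Y s ≤ mΩ := iSup₂_le fun i _ => (hY.meas i).comap_le

theorem future_le (s : ℕ) : future Y s ≤ mΩ := iSup₂_le fun i _ => (hY.meas i).comap_le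

variable {𝕜 : Type*} [RCLike 𝕜]

theorem comp (φ : ℕ → 𝕜) (k : ℕ) : BddMeas mΩ (fun ω => φ (Y k ω)) :=
  BddMeas.comp_of_le (hY.le k) φ (hY.meas k).comap_le

theorem comp_past (φ : ℕ → 𝕜) {k s : ℕ} (h : k ≤ s) : BddMeas (past Y s) (fun ω => φ (Y k ω)) :=
  BddMeas.comp_of_le (hY.le k) φ (comap_le_past Y h)

theorem comp_future (φ : ℕ → 𝕜) {k s : ℕ} (h : s ≤ k) :
    BddMeas (future Y s) (fun ω => φ (Y k ω)) :=
  BddMeas.comp_of_le (hY.le k) φ (comap_le_future Y h)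

theorem integral_mul {s t : ℕ} (hst : s + 1 < t) {g h : Ω → 𝕜} (hg : BddMeas (past Y s) g)
    (hh : BddMeas (future Y t) h) :
    ∫ ω, g ω * h ω ∂μ = (∫ ω, g ω ∂μ) * ∫ ω, h ω ∂μ :=
  BddMeas.integral_mul (hY.past_le s) (hY.future_le t) (hY.indep s t hst) hg hh

end BddOneDep

/-- The variable `(1 + z) ^ y - 1` of Heinrich's expansion at `w = 1 + z`, as a function of the
value `y`. -/
noncomputable def powSubOne (w : ℂ) (y : ℕ) : ℂ := w ^ y - 1

/-- The generating function of the partial sum `Y 1 + ⋯ + Y k`. -/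
noncomputable def genFun (μ : Measure Ω) (Y : ℕ → Ω → ℕ) (w : ℂ) (k : ℕ) : ℂ :=
  ∫ ω, ∏ i ∈ Finset.range k, w ^ Y (i + 1) ω ∂μ

/-- The expectation of the product of `w ^ Y i - 1` over the last `j` indices `i ≤ k`: the
coefficient `D j k` of the recursion for `genFun`. -/
noncomputable def blockExp (μ : Measure Ω) (Y : ℕ → Ω → ℕ) (w : ℂ) (j k : ℕ) : ℂ :=
  ∫ ω, ∏ i ∈ Finset.range j, powSubOne w (Y (k - i) ω) ∂μ

/-- The absolute version of `blockExp`: the bound `E j k` of the recursion for `genFun`. -/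
noncomputable def blockNorm (μ : Measure Ω) (Y : ℕ → Ω → ℕ) (w : ℂ) (j k : ℕ) : ℝ :=
  ∫ ω, ∏ i ∈ Finset.range j, ‖powSubOne w (Y (k - i) ω)‖ ∂μ

theorem genFun_zero (μ : Measure Ω) [IsProbabilityMeasure μ] (Y : ℕ → Ω → ℕ) (w : ℂ) :
    genFun μ Y w 0 = 1 := by simp [genFun]

theorem blockExp_zero (μ : Measure Ω) [IsProbabilityMeasure μ] (Y : ℕ → Ω → ℕ) (w : ℂ) (k : ℕ) :
    blockExp μ Y w 0 k = 1 := by simp [blockExp]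

theorem norm_blockExp_le (μ : Measure Ω) (Y : ℕ → Ω → ℕ) (w : ℂ) (j k : ℕ) :
    ‖blockExp μ Y w j k‖ ≤ blockNorm μ Y w j k := by
  unfold blockExp blockNorm
  simpa only [norm_prod] using norm_integral_le_integral_norm
    (μ := μ) fun ω => ∏ i ∈ Finset.range j, powSubOne w (Y (k - i) ω)

namespace BddOneDep
variable {μ : Measure Ω} {B : ℕ} {Y : ℕ → Ω → ℕ} (hY : BddOneDep μ B Y) (w : ℂ)
include hY

theorem blockExp_eq_zero {j k : ℕ} (h : k < j) : blockExp μ Y w j k = 0 := by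
  have hprod : ∀ ω, ∏ i ∈ Finset.range j, powSubOne w (Y (k - i) ω) = 0 := fun ω =>
    Finset.prod_eq_zero (Finset.mem_range.mpr h) (by simp [powSubOne, hY.zero])
  simp [blockExp, hprod]

variable [IsProbabilityMeasure μ]

/- `w ^ Y m = 1 + (w ^ Y m - 1)`: the first term leaves a gap at the index `m`, across which
1-dependence factorises the expectation. -/
theorem integral_prefix_mul_block (m J : ℕ) :
    ∫ ω, (∏ i ∈ Finset.range (m + 1), w ^ Y (i + 1) ω)
        * ∏ i ∈ Finset.range J, powSubOne w (Y (m + 1 + J - i) ω) ∂μ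
      = genFun μ Y w m * blockExp μ Y w J (m + 1 + J)
        + ∫ ω, (∏ i ∈ Finset.range m, w ^ Y (i + 1) ω)
          * ∏ i ∈ Finset.range (J + 1), powSubOne w (Y (m + 1 + J - i) ω) ∂μ := by
  have hpast : BddMeas (past Y m) (fun ω => ∏ i ∈ Finset.range m, w ^ Y (i + 1) ω) :=
    BddMeas.prod _ fun i hi => hY.comp_past (fun y => w ^ y)
      (by have := Finset.mem_range.mp hi; omega)
  have hfuture : BddMeas (future Y (m + 2))
      (fun ω => ∏ i ∈ Finset.range J, powSubOne w (Y (m + 1 + J - i) ω)) :=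
    BddMeas.prod _ fun i hi => hY.comp_future (powSubOne w)
      (by have := Finset.mem_range.mp hi; omega)
  have hblock : BddMeas mΩ
      (fun ω => ∏ i ∈ Finset.range (J + 1), powSubOne w (Y (m + 1 + J - i) ω)) :=
    BddMeas.prod _ fun i _ => hY.comp (powSubOne w) _
  have hpast' := hpast.mono (hY.past_le _)
  unfold genFun blockExp
  rw [← hY.integral_mul (by omega) hpast hfuture,
    ← integral_add (hpast'.mul (hfuture.mono (hY.future_le _))).integrable
      (hpast'.mul hblock).integrable]
  congr 1
  funext ω
  rw [Finset.prod_range_succ, Finset.prod_range_succ, Nat.add_sub_cancel]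
  unfold powSubOne
  ring

theorem genFun_telescope {k J : ℕ} (hJ : J ≤ k) :
    genFun μ Y w k = ∑ j ∈ Finset.range J, genFun μ Y w (k - j - 1) * blockExp μ Y w j k
      + ∫ ω, (∏ i ∈ Finset.range (k - J), w ^ Y (i + 1) ω)
          * ∏ i ∈ Finset.range J, powSubOne w (Y (k - i) ω) ∂μ := by
  induction J with
  | zero => simp [genFun]
  | succ J ih =>
    obtain ⟨m, rfl⟩ : ∃ m, k = m + 1 + J := ⟨k - J - 1, by omega⟩
    have hlast : m + 1 + J - J - 1 = m := by omega
    have hlen : m + 1 + J - (J + 1) = m := by omega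
    rw [ih (by omega), Finset.sum_range_succ, hlast, hlen, Nat.add_sub_cancel,
      hY.integral_prefix_mul_block]
    ring

theorem genFun_succ (k : ℕ) : genFun μ Y w (k + 1) = genFun μ Y w k
    + ∑ j ∈ Finset.range (k + 1), genFun μ Y w (k - (j + 1)) * blockExp μ Y w (j + 1) (k + 1) := by
  have hindex : ∀ j, k + 1 - (j + 1) - 1 = k - (j + 1) := fun j => by omega
  have hlast : k - (k + 1) = 0 := by omega
  rw [hY.genFun_telescope w (le_refl (k + 1)), Nat.sub_self, Finset.sum_range_succ',
    Finset.sum_range_succ, hlast, genFun_zero, blockExp_zero]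
  simp only [hindex, Nat.sub_zero, Nat.add_sub_cancel, Finset.range_zero, Finset.prod_empty,
    one_mul, mul_one]
  unfold blockExp
  ring

end BddOneDep

section Pointwise
variable {w : ℂ} {B : ℕ} (hw : ‖w‖ ^ (B + 1) ≤ 1.01)
include hw

theorem norm_pow_le_of_le {i : ℕ} (hi : i ≤ B + 1) : ‖w‖ ^ i ≤ 1.01 := by
  rcases le_total ‖w‖ 1 with h | h
  · exact (pow_le_one₀ (norm_nonneg _) h).trans (by norm_num)
  · exact (pow_le_pow_right₀ h hi).trans hw

theorem norm_powSubOne_le_const {y : ℕ} (hy : y ≤ B + 1) : ‖powSubOne w y‖ ≤ 2.01 := by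
  refine (norm_sub_le _ _).trans ?_
  rw [norm_pow, norm_one]
  have := norm_pow_le_of_le hw hy
  norm_num at this ⊢
  linarith

theorem norm_sub_one_le_of_pow : ‖w - 1‖ ≤ 2.01 := by
  simpa only [powSubOne, pow_one] using norm_powSubOne_le_const hw (y := 1) (by omega)

theorem norm_powSubOne_le {y : ℕ} (hy : y ≤ B) : ‖powSubOne w y‖ ≤ 1.01 * (‖w - 1‖ * y) := by
  have hgeom : ‖∑ i ∈ Finset.range y, w ^ i‖ ≤ ∑ _i ∈ Finset.range y, (1.01 : ℝ) :=
    norm_sum_le_of_le _ fun i hi => by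
      rw [norm_pow]
      exact norm_pow_le_of_le hw (by have := Finset.mem_range.mp hi; omega)
  rw [Finset.sum_const, Finset.card_range, nsmul_eq_mul] at hgeom
  calc ‖powSubOne w y‖ = ‖w - 1‖ * ‖∑ i ∈ Finset.range y, w ^ i‖ := by
        rw [powSubOne, ← geom_sum_mul w y, norm_mul, mul_comm]
    _ ≤ ‖w - 1‖ * (y * 1.01) := by gcongr
    _ = _ := by ring

theorem norm_powSubOne_sub_le {y : ℕ} (hy : y ≤ B) :
    ‖powSubOne w y - (w - 1) * y‖ ≤ 0.51 * (‖w - 1‖ ^ 2 * (y * (y - 1))) := by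
  induction y with
  | zero => simp [powSubOne]
  | succ y ih =>
    have hsplit : powSubOne w (y + 1) - (w - 1) * ((y + 1 : ℕ) : ℂ)
        = (powSubOne w y - (w - 1) * y) + (w - 1) * powSubOne w y := by
      unfold powSubOne; push_cast; ring
    have hlast : ‖w - 1‖ * ‖powSubOne w y‖ ≤ 1.01 * (‖w - 1‖ ^ 2 * y) := by
      calc _ ≤ ‖w - 1‖ * (1.01 * (‖w - 1‖ * y)) := by
            gcongr; exact norm_powSubOne_le hw (by omega)
        _ = _ := by ring
    have : 0 ≤ ‖w - 1‖ ^ 2 * (y : ℝ) := by positivity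
    rw [hsplit]
    refine (norm_add_le_of_le (ih (by omega)) ((norm_mul _ _).trans_le hlast)).trans ?_
    push_cast
    norm_num
    linarith

theorem norm_powSubOne_sub_sub_le {y : ℕ} (hy : y ≤ B) :
    ‖powSubOne w y - (w - 1) * y - (w - 1) ^ 2 * (y * (y - 1)) / 2‖
      ≤ ‖w - 1‖ ^ 3 * (y * (y - 1) * (y - 2)) := by
  induction y with
  | zero => simp [powSubOne]
  | succ y ih =>
    have hsplit : powSubOne w (y + 1) - (w - 1) * ((y + 1 : ℕ) : ℂ)
          - (w - 1) ^ 2 * (((y + 1 : ℕ) : ℂ) * (((y + 1 : ℕ) : ℂ) - 1)) / 2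
        = (powSubOne w y - (w - 1) * y - (w - 1) ^ 2 * (y * (y - 1)) / 2)
          + (w - 1) * (powSubOne w y - (w - 1) * y) := by
      unfold powSubOne; push_cast; ring
    have hlast : ‖w - 1‖ * ‖powSubOne w y - (w - 1) * y‖
        ≤ 0.51 * (‖w - 1‖ ^ 3 * (y * (y - 1))) := by
      calc _ ≤ ‖w - 1‖ * (0.51 * (‖w - 1‖ ^ 2 * (y * (y - 1)))) := by
            gcongr; exact norm_powSubOne_sub_le hw (by omega)
        _ = _ := by ring
    have : 0 ≤ ‖w - 1‖ ^ 3 * ((y : ℝ) * (y - 1)) :=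
      mul_nonneg (by positivity) (natCast_mul_sub_one_nonneg y)
    rw [hsplit]
    refine (norm_add_le_of_le (ih (by omega)) ((norm_mul _ _).trans_le hlast)).trans ?_
    push_cast
    norm_num
    linarith

end Pointwise

end Dependent

/-! ### Moments -/

section Moments

variable {Ω : Type*} {mΩ : MeasurableSpace Ω} {μ : Measure Ω} {Y : ℕ → Ω → ℕ}

theorem natCast_mul_sub_one_mul_sub_two_nonneg (y : ℕ) : 0 ≤ (y : ℝ) * (y - 1) * (y - 2) := by
  rcases y with _ | _ | y
  · simp
  · simp
  · calc (0 : ℝ) ≤ (y + 2) * (y + 1) * y := by positivity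
      _ = _ := by push_cast; ring

/-- The mean of `Y k`. -/
noncomputable def mom₁ (μ : Measure Ω) (Y : ℕ → Ω → ℕ) (k : ℕ) : ℝ := ∫ ω, (Y k ω : ℝ) ∂μ

/-- The second factorial moment of `Y k`. -/
noncomputable def mom₂ (μ : Measure Ω) (Y : ℕ → Ω → ℕ) (k : ℕ) : ℝ :=
  ∫ ω, (Y k ω : ℝ) * (Y k ω - 1) ∂μ

/-- The third factorial moment of `Y k`. -/
noncomputable def mom₃ (μ : Measure Ω) (Y : ℕ → Ω → ℕ) (k : ℕ) : ℝ :=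
  ∫ ω, (Y k ω : ℝ) * (Y k ω - 1) * (Y k ω - 2) ∂μ

/-- The mixed moment of order two of `Y (k - 1)` and `Y k`. For `k = 0` the truncated subtraction
makes it a second moment of `Y 0`, which vanishes in the sequences considered. -/
noncomputable def mixMom₂ (μ : Measure Ω) (Y : ℕ → Ω → ℕ) (k : ℕ) : ℝ :=
  ∫ ω, (Y (k - 1) ω : ℝ) * Y k ω ∂μ

/-- The sum of the two mixed factorial moments of total order three of `Y (k - 1)` and `Y k`. -/
noncomputable def mixMom₃ (μ : Measure Ω) (Y : ℕ → Ω → ℕ) (k : ℕ) : ℝ :=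
  ∫ ω, (Y (k - 1) ω : ℝ) * (Y (k - 1) ω - 1) * Y k ω ∂μ
    + ∫ ω, (Y (k - 1) ω : ℝ) * (Y k ω * (Y k ω - 1)) ∂μ

/-- The mixed moment of the three consecutive variables ending with `Y k`. -/
noncomputable def tripleMom (μ : Measure Ω) (Y : ℕ → Ω → ℕ) (k : ℕ) : ℝ :=
  ∫ ω, (Y (k - 2) ω : ℝ) * Y (k - 1) ω * Y k ω ∂μ

theorem mom₁_nonneg (k : ℕ) : 0 ≤ mom₁ μ Y k := integral_nonneg fun _ => Nat.cast_nonneg _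

theorem mom₂_nonneg (k : ℕ) : 0 ≤ mom₂ μ Y k :=
  integral_nonneg fun _ => natCast_mul_sub_one_nonneg _

theorem mom₃_nonneg (k : ℕ) : 0 ≤ mom₃ μ Y k :=
  integral_nonneg fun _ => natCast_mul_sub_one_mul_sub_two_nonneg _

theorem mixMom₂_nonneg (k : ℕ) : 0 ≤ mixMom₂ μ Y k := integral_nonneg fun _ => by positivity

theorem mixMom₃_nonneg (k : ℕ) : 0 ≤ mixMom₃ μ Y k := add_nonneg
  (integral_nonneg fun _ => mul_nonneg (natCast_mul_sub_one_nonneg _) (Nat.cast_nonneg _))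
  (integral_nonneg fun _ => mul_nonneg (Nat.cast_nonneg _) (natCast_mul_sub_one_nonneg _))

theorem tripleMom_nonneg (k : ℕ) : 0 ≤ tripleMom μ Y k := integral_nonneg fun _ => by positivity

theorem ofReal_mom₁ (k : ℕ) : ((mom₁ μ Y k : ℝ) : ℂ) = ∫ ω, (Y k ω : ℂ) ∂μ := by
  rw [mom₁, ← integral_complex_ofReal]
  simp

theorem ofReal_mom₂ (k : ℕ) :
    ((mom₂ μ Y k : ℝ) : ℂ) = ∫ ω, (Y k ω : ℂ) * (Y k ω - 1) ∂μ := by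
  rw [mom₂, ← integral_complex_ofReal]
  simp

theorem ofReal_mixMom₂ (k : ℕ) :
    ((mixMom₂ μ Y k : ℝ) : ℂ) = ∫ ω, (Y (k - 1) ω : ℂ) * Y k ω ∂μ := by
  rw [mixMom₂, ← integral_complex_ofReal]
  simp

theorem integral_mul_le_mul {f g : Ω → ℝ} {c : ℝ} [IsFiniteMeasure μ] (hf : BddMeas mΩ f)
    (hg : BddMeas mΩ g) (h : ∀ ω, f ω ≤ c * g ω) : ∫ ω, f ω ∂μ ≤ c * ∫ ω, g ω ∂μ := by
  rw [← integral_const_mul]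
  exact integral_mono hf.integrable ((BddMeas.const c).mul hg).integrable h

theorem norm_integral_le_mul {f : Ω → ℂ} {g : Ω → ℝ} {c : ℝ} [IsFiniteMeasure μ]
    (hg : BddMeas mΩ g) (h : ∀ ω, ‖f ω‖ ≤ c * g ω) : ‖∫ ω, f ω ∂μ‖ ≤ c * ∫ ω, g ω ∂μ := by
  rw [← integral_const_mul]
  exact norm_integral_le_of_norm_le ((BddMeas.const c).mul hg).integrable
    (Filter.Eventually.of_forall h)

theorem blockExp_one (w : ℂ) (k : ℕ) : blockExp μ Y w 1 k = ∫ ω, powSubOne w (Y k ω) ∂μ := by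
  simp [blockExp]

theorem blockExp_two (w : ℂ) (k : ℕ) :
    blockExp μ Y w 2 k = ∫ ω, powSubOne w (Y k ω) * powSubOne w (Y (k - 1) ω) ∂μ := by
  simp [blockExp, Finset.prod_range_succ]

theorem blockNorm_one (w : ℂ) (k : ℕ) : blockNorm μ Y w 1 k = ∫ ω, ‖powSubOne w (Y k ω)‖ ∂μ := by
  simp [blockNorm]

theorem blockNorm_nonneg (w : ℂ) (j k : ℕ) : 0 ≤ blockNorm μ Y w j k :=
  integral_nonneg fun _ => Finset.prod_nonneg fun _ _ => norm_nonneg _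

theorem norm_powSubOne_mul_powSubOne_sub_le {w : ℂ} {B : ℕ} (hw : ‖w‖ ^ (B + 1) ≤ 1.01)
    {x y : ℕ} (hx : x ≤ B) (hy : y ≤ B) :
    ‖powSubOne w y * powSubOne w x - (w - 1) ^ 2 * (x * y)‖
      ≤ ‖w - 1‖ ^ 3 * (x * (x - 1) * y + x * (y * (y - 1))) := by
  have hx₀ := natCast_mul_sub_one_nonneg x
  have hy₀ := natCast_mul_sub_one_nonneg y
  have hsplit : powSubOne w y * powSubOne w x - (w - 1) ^ 2 * (x * y)
      = (powSubOne w y - (w - 1) * y) * powSubOne w x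
        + (w - 1) * y * (powSubOne w x - (w - 1) * x) := by ring
  rw [hsplit]
  refine (norm_add_le _ _).trans ?_
  rw [norm_mul, norm_mul, norm_mul, Complex.norm_natCast]
  calc _ ≤ (0.51 * (‖w - 1‖ ^ 2 * (y * (y - 1)))) * (1.01 * (‖w - 1‖ * x))
        + ‖w - 1‖ * y * (0.51 * (‖w - 1‖ ^ 2 * (x * (x - 1)))) := by
        gcongr
        exacts [norm_powSubOne_sub_le hw hy, norm_powSubOne_le hw hx, norm_powSubOne_sub_le hw hx]
    _ = 0.51 * 1.01 * (‖w - 1‖ ^ 3 * (x * (y * (y - 1))))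
        + 0.51 * (‖w - 1‖ ^ 3 * (x * (x - 1) * y)) := by ring
    _ ≤ 1 * (‖w - 1‖ ^ 3 * (x * (y * (y - 1))))
        + 1 * (‖w - 1‖ ^ 3 * (x * (x - 1) * y)) := by gcongr <;> norm_num
    _ = _ := by ring

namespace BddOneDep

variable {B : ℕ} (hY : BddOneDep μ B Y)
include hY

theorem bddMeas_cast (k : ℕ) : BddMeas mΩ (fun ω => (Y k ω : ℝ)) :=
  hY.comp (fun y : ℕ => (y : ℝ)) k

theorem bddMeas_two (k : ℕ) : BddMeas mΩ (fun ω => (Y k ω : ℝ) * (Y k ω - 1)) :=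
  hY.comp (fun y : ℕ => (y : ℝ) * (y - 1)) k

theorem bddMeas_three (k : ℕ) : BddMeas mΩ (fun ω => (Y k ω : ℝ) * (Y k ω - 1) * (Y k ω - 2)) :=
  hY.comp (fun y : ℕ => (y : ℝ) * (y - 1) * (y - 2)) k

theorem bddMeas_norm (w : ℂ) (k : ℕ) : BddMeas mΩ (fun ω => ‖powSubOne w (Y k ω)‖) :=
  hY.comp (fun y => ‖powSubOne w y‖) k

theorem bddMeas_block (w : ℂ) (j k : ℕ) :
    BddMeas mΩ (fun ω => ∏ i ∈ Finset.range j, ‖powSubOne w (Y (k - i) ω)‖) :=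
  BddMeas.prod _ fun _ _ => hY.bddMeas_norm w _

theorem mom₁_zero : mom₁ μ Y 0 = 0 := by simp [mom₁, hY.zero]

variable [IsProbabilityMeasure μ]

theorem mixMom₂_le (k : ℕ) : mixMom₂ μ Y k ≤ B * mom₁ μ Y k := by
  refine integral_mul_le_mul ((hY.bddMeas_cast _).mul (hY.bddMeas_cast _)) (hY.bddMeas_cast k)
    fun ω => ?_
  gcongr
  exact hY.le _ ω

section Coefficients

variable {w : ℂ} (hw : ‖w‖ ^ (B + 1) ≤ 1.01)
include hw

theorem blockNorm_succ_le (j k : ℕ) :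
    blockNorm μ Y w (j + 1) k ≤ 2.02 * blockNorm μ Y w j k := by
  refine integral_mul_le_mul (hY.bddMeas_block w _ k) (hY.bddMeas_block w _ k) fun ω => ?_
  rw [Finset.prod_range_succ, mul_comm]
  gcongr
  exact (norm_powSubOne_le_const hw ((hY.le _ ω).trans B.le_succ)).trans (by norm_num)

theorem blockNorm_one_le (k : ℕ) : blockNorm μ Y w 1 k ≤ 1.01 * (‖w - 1‖ * mom₁ μ Y k) := by
  rw [blockNorm_one, ← mul_assoc]
  refine integral_mul_le_mul (hY.bddMeas_norm w k) (hY.bddMeas_cast k) fun ω => ?_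
  rw [mul_assoc]
  exact norm_powSubOne_le hw (hY.le k ω)

theorem blockNorm_two_le (k : ℕ) :
    blockNorm μ Y w 2 k ≤ 1.03 * (‖w - 1‖ ^ 2 * mixMom₂ μ Y k) := by
  rw [← mul_assoc]
  refine integral_mul_le_mul (hY.bddMeas_block w _ k)
    ((hY.bddMeas_cast _).mul (hY.bddMeas_cast _)) fun ω => ?_
  simp only [Finset.prod_range_succ, Finset.range_zero, Finset.prod_empty, one_mul, Nat.sub_zero]
  calc _ ≤ (1.01 * (‖w - 1‖ * Y k ω)) * (1.01 * (‖w - 1‖ * Y (k - 1) ω)) := by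
        gcongr <;> exact norm_powSubOne_le hw (hY.le _ ω)
    _ = 1.01 ^ 2 * (‖w - 1‖ ^ 2 * (Y (k - 1) ω * Y k ω)) := by ring
    _ ≤ 1.03 * (‖w - 1‖ ^ 2 * (Y (k - 1) ω * Y k ω)) := by gcongr; norm_num
    _ = _ := by ring

theorem blockNorm_three_le (k : ℕ) :
    blockNorm μ Y w 3 k ≤ 2 * (‖w - 1‖ ^ 3 * tripleMom μ Y k) := by
  rw [← mul_assoc]
  refine integral_mul_le_mul (hY.bddMeas_block w _ k)
    (((hY.bddMeas_cast _).mul (hY.bddMeas_cast _)).mul (hY.bddMeas_cast _)) fun ω => ?_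
  simp only [Finset.prod_range_succ, Finset.range_zero, Finset.prod_empty, one_mul, Nat.sub_zero]
  calc _ ≤ (1.01 * (‖w - 1‖ * Y k ω)) * (1.01 * (‖w - 1‖ * Y (k - 1) ω))
        * (1.01 * (‖w - 1‖ * Y (k - 2) ω)) := by
        gcongr <;> exact norm_powSubOne_le hw (hY.le _ ω)
    _ = 1.01 ^ 3 * (‖w - 1‖ ^ 3 * (Y (k - 2) ω * Y (k - 1) ω * Y k ω)) := by ring
    _ ≤ 2 * (‖w - 1‖ ^ 3 * (Y (k - 2) ω * Y (k - 1) ω * Y k ω)) := by gcongr; norm_num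
    _ = _ := by ring

/- Bounding the factor of index `k - (j + 1)` by a constant makes the remaining factors
independent. -/
theorem blockNorm_add_three_le_mul (j k : ℕ) :
    blockNorm μ Y w (j + 3) k
      ≤ 2.01 * (blockNorm μ Y w 1 (k - (j + 2)) * blockNorm μ Y w (j + 1) k) := by
  have hdrop : blockNorm μ Y w (j + 3) k
      ≤ 2.01 * ∫ ω, ‖powSubOne w (Y (k - (j + 2)) ω)‖
        * ∏ i ∈ Finset.range (j + 1), ‖powSubOne w (Y (k - i) ω)‖ ∂μ := by
    refine integral_mul_le_mul (hY.bddMeas_block w _ k)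
      ((hY.bddMeas_norm w _).mul (hY.bddMeas_block w _ k)) fun ω => ?_
    rw [Finset.prod_range_succ, Finset.prod_range_succ]
    have : 0 ≤ ∏ i ∈ Finset.range (j + 1), ‖powSubOne w (Y (k - i) ω)‖ :=
      Finset.prod_nonneg fun _ _ => norm_nonneg _
    set P := ∏ i ∈ Finset.range (j + 1), ‖powSubOne w (Y (k - i) ω)‖
    calc _ ≤ P * 2.01 * ‖powSubOne w (Y (k - (j + 2)) ω)‖ := by
          gcongr
          exact norm_powSubOne_le_const hw ((hY.le _ ω).trans B.le_succ)
      _ = _ := by ring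
  refine hdrop.trans (mul_le_mul_of_nonneg_left ?_ (by norm_num))
  rcases Nat.lt_or_ge k (j + 3) with hk | hk
  · have hzero : k - (j + 2) = 0 := by omega
    simp [hzero, hY.zero, powSubOne, blockNorm]
  · have hpast : BddMeas (past Y (k - (j + 2))) (fun ω => ‖powSubOne w (Y (k - (j + 2)) ω)‖) :=
      hY.comp_past (fun y => ‖powSubOne w y‖) le_rfl
    have hfuture : BddMeas (future Y (k - j))
        (fun ω => ∏ i ∈ Finset.range (j + 1), ‖powSubOne w (Y (k - i) ω)‖) :=
      BddMeas.prod _ fun i hi => hY.comp_future (fun y => ‖powSubOne w y‖)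
        (by have := Finset.mem_range.mp hi; omega)
    rw [hY.integral_mul (by omega) hpast hfuture, ← blockNorm_one w]
    exact le_rfl

theorem norm_blockExp_one_sub_linear_le (k : ℕ) :
    ‖blockExp μ Y w 1 k - (w - 1) * mom₁ μ Y k‖ ≤ 0.51 * (‖w - 1‖ ^ 2 * mom₂ μ Y k) := by
  have hint : blockExp μ Y w 1 k - (w - 1) * mom₁ μ Y k
      = ∫ ω, (powSubOne w (Y k ω) - (w - 1) * Y k ω) ∂μ := by
    rw [integral_sub (hY.comp (powSubOne w) k).integrable
      (hY.comp (fun y : ℕ => (w - 1) * (y : ℂ)) k).integrable, integral_const_mul, ofReal_mom₁,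
      blockExp_one]
  rw [hint, ← mul_assoc]
  refine norm_integral_le_mul (hY.bddMeas_two k) fun ω => ?_
  rw [mul_assoc]
  exact norm_powSubOne_sub_le hw (hY.le k ω)

theorem norm_blockExp_one_sub_quadratic_le (k : ℕ) :
    ‖blockExp μ Y w 1 k - (w - 1) * mom₁ μ Y k - (w - 1) ^ 2 * mom₂ μ Y k / 2‖
      ≤ ‖w - 1‖ ^ 3 * mom₃ μ Y k := by
  have hint : blockExp μ Y w 1 k - (w - 1) * mom₁ μ Y k - (w - 1) ^ 2 * mom₂ μ Y k / 2
      = ∫ ω, (powSubOne w (Y k ω) - (w - 1) * Y k ω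
        - (w - 1) ^ 2 * (Y k ω * (Y k ω - 1)) / 2) ∂μ := by
    rw [integral_sub (hY.comp (fun y => powSubOne w y - (w - 1) * (y : ℂ)) k).integrable
        (hY.comp (fun y : ℕ => (w - 1) ^ 2 * ((y : ℂ) * (y - 1)) / 2) k).integrable,
      integral_sub (hY.comp (powSubOne w) k).integrable
        (hY.comp (fun y : ℕ => (w - 1) * (y : ℂ)) k).integrable, integral_const_mul,
      integral_div, integral_const_mul, ofReal_mom₁, ofReal_mom₂, blockExp_one]
  rw [hint]
  exact norm_integral_le_mul (hY.bddMeas_three k)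
    fun ω => norm_powSubOne_sub_sub_le hw (hY.le k ω)

theorem norm_blockExp_two_sub_le (k : ℕ) :
    ‖blockExp μ Y w 2 k - (w - 1) ^ 2 * mixMom₂ μ Y k‖ ≤ ‖w - 1‖ ^ 3 * mixMom₃ μ Y k := by
  have hint : blockExp μ Y w 2 k - (w - 1) ^ 2 * mixMom₂ μ Y k
      = ∫ ω, (powSubOne w (Y k ω) * powSubOne w (Y (k - 1) ω)
        - (w - 1) ^ 2 * (Y (k - 1) ω * Y k ω)) ∂μ := by
    rw [integral_sub ((hY.comp (powSubOne w) k).mul (hY.comp (powSubOne w) (k - 1))).integrable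
      ((BddMeas.const _).mul ((hY.comp (fun y : ℕ => (y : ℂ)) (k - 1)).mul
        (hY.comp (fun y : ℕ => (y : ℂ)) k))).integrable, integral_const_mul, ofReal_mixMom₂,
      blockExp_two]
  have hleft := (hY.bddMeas_two (k - 1)).mul (hY.bddMeas_cast k)
  have hright := (hY.bddMeas_cast (k - 1)).mul (hY.bddMeas_two k)
  rw [hint, mixMom₃, ← integral_add hleft.integrable hright.integrable]
  exact norm_integral_le_mul (hleft.add hright)
    fun ω => norm_powSubOne_mul_powSubOne_sub_le hw (hY.le _ ω) (hY.le k ω)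

variable (hmom₁ : ∀ k, mom₁ μ Y k ≤ 1 / 100)
include hmom₁

theorem blockNorm_one_le_const (k : ℕ) : blockNorm μ Y w 1 k ≤ 0.0204 := by
  have := mom₁_nonneg (μ := μ) (Y := Y) k
  calc _ ≤ 1.01 * (‖w - 1‖ * mom₁ μ Y k) := hY.blockNorm_one_le hw k
    _ ≤ 1.01 * (2.01 * (1 / 100)) := by
        gcongr
        exacts [norm_sub_one_le_of_pow hw, hmom₁ k]
    _ ≤ _ := by norm_num

theorem ratioRecursion_genFun (n : ℕ) :
    RatioRecursion n (genFun μ Y w) (blockExp μ Y w) (blockNorm μ Y w) where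
  f_zero := genFun_zero μ Y w
  f_succ k _ := hY.genFun_succ w k
  D_eq_zero _ _ h := hY.blockExp_eq_zero w h
  norm_D_le := norm_blockExp_le μ Y w
  E_add_three_le j k := by
    have := blockNorm_nonneg (μ := μ) (Y := Y) w (j + 1) k
    calc _ ≤ 2.01 * (blockNorm μ Y w 1 (k - (j + 2)) * blockNorm μ Y w (j + 1) k) :=
          hY.blockNorm_add_three_le_mul hw j k
      _ ≤ 2.01 * (0.0204 * blockNorm μ Y w (j + 1) k) := by
          gcongr
          exact hY.blockNorm_one_le_const hw hmom₁ _
      _ = 2.01 * 0.0204 * blockNorm μ Y w (j + 1) k := by ring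
      _ ≤ _ := by gcongr; norm_num
  E_add_two_le j k := hY.blockNorm_succ_le hw (j + 1) k
  E_one_le := hY.blockNorm_one_le_const hw hmom₁
  E_two_le k := (hY.blockNorm_succ_le hw 1 k).trans <|
    (mul_le_mul_of_nonneg_left (hY.blockNorm_one_le_const hw hmom₁ k) (by norm_num)).trans
      (by norm_num)

theorem recursionData (hmom₂ : ∀ k, mom₂ μ Y k ≤ mom₁ μ Y k) (n : ℕ) :
    RecursionData (w - 1) (B + 2) n (genFun μ Y w) (blockExp μ Y w) (blockNorm μ Y w) (mom₁ μ Y)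
      (mom₂ μ Y) (mom₃ μ Y) (mixMom₂ μ Y) (mixMom₃ μ Y) (tripleMom μ Y) := by
  have hB₁ : (1 : ℝ) ≤ B + 2 := by linarith [Nat.cast_nonneg (α := ℝ) B]
  have hB₂ : (2 : ℝ) ≤ B + 2 := by linarith [Nat.cast_nonneg (α := ℝ) B]
  exact
    { hY.ratioRecursion_genFun hw hmom₁ n with
      norm_le := norm_sub_one_le_of_pow hw
      one_le := hB₁
      p_nonneg := mom₁_nonneg
      m₂_nonneg := mom₂_nonneg
      m₃_nonneg := mom₃_nonneg
      q_nonneg := mixMom₂_nonneg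
      q₂_nonneg := mixMom₃_nonneg
      t_nonneg := tripleMom_nonneg
      p_zero := hY.mom₁_zero
      p_le := hmom₁
      m₂_le := hmom₂
      q_le := fun k => (hY.mixMom₂_le k).trans
        (mul_le_mul_of_nonneg_right (by linarith) (mom₁_nonneg k))
      E_one_le_mul := hY.blockNorm_one_le hw
      E_two_le_mul := hY.blockNorm_two_le hw
      E_three_le_mul := fun k => (hY.blockNorm_three_le hw k).trans
        (mul_le_mul_of_nonneg_right hB₂ (mul_nonneg (by positivity) (tripleMom_nonneg k)))
      norm_D_one_sub_linear_le := hY.norm_blockExp_one_sub_linear_le hw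
      norm_D_one_sub_quadratic_le := fun k => (hY.norm_blockExp_one_sub_quadratic_le hw k).trans
        (le_mul_of_one_le_left (mul_nonneg (by positivity) (mom₃_nonneg k)) hB₁)
      norm_D_two_sub_le := fun k => (hY.norm_blockExp_two_sub_le hw k).trans
        (le_mul_of_one_le_left (mul_nonneg (by positivity) (mixMom₃_nonneg k)) hB₁) }

end Coefficients

end BddOneDep

end Moments

/-! ### The transform of the partial sum -/

theorem sum_Icc_one_eq_sum_range {M : Type*} [AddCommMonoid M] (f : ℕ → M) (n : ℕ) :
    ∑ k ∈ Finset.Icc 1 n, f k = ∑ i ∈ Finset.range n, f (i + 1) := by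
  rw [Finset.range_eq_Ico, Finset.sum_Ico_add' f 0 n 1]
  rfl

section SumTransform

variable {Ω : Type*} {mΩ : MeasurableSpace Ω} {μ : Measure Ω} {B : ℕ} {Y : ℕ → Ω → ℕ}

/-- The sum of the third order contributions of the first `n` ratios of generating functions, the
size of the third order remainder in the expansion of the transform of `S Y n`. -/
noncomputable def totalThirdOrder (μ : Measure Ω) (Y : ℕ → Ω → ℕ) (n : ℕ) : ℝ :=
  ∑ k ∈ Finset.range n, thirdOrder (mom₁ μ Y) (mom₂ μ Y) (mom₃ μ Y) (mixMom₂ μ Y) (mixMom₃ μ Y)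
    (tripleMom μ Y) k

theorem totalThirdOrder_nonneg (n : ℕ) : 0 ≤ totalThirdOrder μ Y n := by
  refine Finset.sum_nonneg fun k _ => ?_
  have hp : ∀ i, 0 ≤ mom₁ μ Y i := mom₁_nonneg
  have hm₂ : ∀ i, 0 ≤ mom₂ μ Y i := mom₂_nonneg
  have hq : ∀ i, 0 ≤ mixMom₂ μ Y i := mixMom₂_nonneg
  have := hp (k - 1)
  have := hp k
  have := hp (k + 1)
  have := hm₂ k
  have := hm₂ (k + 1)
  have := hq k
  have := hq (k + 1)
  have := mom₃_nonneg (μ := μ) (Y := Y) (k + 1)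
  have := mixMom₃_nonneg (μ := μ) (Y := Y) (k + 1)
  have := tripleMom_nonneg (μ := μ) (Y := Y) (k + 1)
  unfold thirdOrder
  positivity

theorem cast_S (n : ℕ) (ω : Ω) : (S Y n ω : ℝ) = ∑ i ∈ Finset.range n, (Y (i + 1) ω : ℝ) := by
  rw [S, sum_Icc_one_eq_sum_range]
  push_cast
  rfl

theorem genFun_eq_integral_pow_S (w : ℂ) (n : ℕ) : genFun μ Y w n = ∫ ω, w ^ S Y n ω ∂μ := by
  simp only [genFun, S, sum_Icc_one_eq_sum_range, Finset.prod_pow_eq_pow_sum]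

theorem integral_pow_eq_sum [IsFiniteMeasure μ] {N : ℕ} {Z : Ω → ℕ} (hZ : Measurable Z)
    (hle : ∀ ω, Z ω ≤ N) (w : ℂ) :
    ∫ ω, w ^ Z ω ∂μ = ∑ x ∈ Finset.range (N + 1), (μ.real {ω | Z ω = x} : ℂ) * w ^ x := by
  have hlevel (x : ℕ) : MeasurableSet {ω | Z ω = x} := hZ (measurableSet_singleton x)
  have hdecomp (ω : Ω) : w ^ Z ω
      = ∑ x ∈ Finset.range (N + 1), Set.indicator {ω | Z ω = x} (fun _ => w ^ x) ω := by
    simp [Set.indicator_apply, hle]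
  simp_rw [hdecomp]
  rw [integral_finsetSum _ fun x _ => (integrable_const _).indicator (hlevel x)]
  simp_rw [integral_indicator_const _ (hlevel _), Complex.real_smul]

theorem bddMeas_sum {m : MeasurableSpace Ω} (n : ℕ)
    (hm : ∀ i < n, BddMeas m (fun ω => (Y (i + 1) ω : ℝ))) :
    BddMeas m (fun ω => ∑ i ∈ Finset.range n, (Y (i + 1) ω : ℝ)) := by
  induction n with
  | zero => simpa using BddMeas.const (0 : ℝ)
  | succ n ih =>
    simp_rw [Finset.sum_range_succ]
    exact (ih fun i hi => hm i (by omega)).add (hm n (by omega))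

theorem norm_exp_pow_le {s : ℂ} (hre : |s.re| ≤ 1 / (200 * (B + 1))) :
    ‖Complex.exp s‖ ^ (B + 1) ≤ 1.01 := by
  rw [Complex.norm_exp, ← Real.exp_nat_mul]
  have hre' : ((B + 1 : ℕ) : ℝ) * s.re ≤ 1 / 200 := by
    have := (le_abs_self s.re).trans hre
    rw [le_div_iff₀ (by positivity)] at this
    push_cast
    linarith
  refine (Real.exp_le_exp.mpr hre').trans ?_
  have := (abs_le.mp (Real.abs_exp_sub_one_sub_id_le (x := 1 / 200)
    (by rw [abs_of_pos (by norm_num)]; norm_num))).2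
  norm_num at this ⊢
  linarith

namespace BddOneDep

variable (hY : BddOneDep μ B Y)
include hY

theorem S_le (n : ℕ) (ω : Ω) : S Y n ω ≤ n * B := by
  refine (Finset.sum_le_card_nsmul _ _ B fun i _ => hY.le i ω).trans ?_
  simp

theorem measurable_S (n : ℕ) : Measurable (S Y n) :=
  Finset.measurable_fun_sum _ fun i _ => hY.meas i

theorem hasTransform_pointF [IsFiniteMeasure μ] (n : ℕ) :
    HasTransform (zeroExt (pointF Y n μ)) (fun s => genFun μ Y (Complex.exp s) n) := by
  refine hasTransform_zeroExt fun s _ => ?_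
  rw [genFun_eq_integral_pow_S, integral_pow_eq_sum (hY.measurable_S n) (hY.S_le n)]
  refine hasSum_sum_of_ne_finset_zero fun x hx => ?_
  have hempty : {ω | S Y n ω = x} = ∅ :=
    Set.eq_empty_of_forall_notMem fun ω (hω : S Y n ω = x) =>
      hx (Finset.mem_range_succ_iff.mpr (hω ▸ hY.S_le n ω))
  simp [pointF, hempty]

theorem bddMeas_sum_range (n : ℕ) :
    BddMeas mΩ (fun ω => ∑ i ∈ Finset.range n, (Y (i + 1) ω : ℝ)) :=
  bddMeas_sum n fun _ _ => hY.bddMeas_cast _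

theorem integral_sum [IsFiniteMeasure μ] (n : ℕ) :
    ∫ ω, ∑ i ∈ Finset.range n, (Y (i + 1) ω : ℝ) ∂μ = ∑ i ∈ Finset.range n, mom₁ μ Y (i + 1) :=
  integral_finsetSum _ fun _ _ => (hY.bddMeas_cast _).integrable

theorem integral_sq [IsFiniteMeasure μ] (k : ℕ) :
    ∫ ω, (Y k ω : ℝ) ^ 2 ∂μ = mom₂ μ Y k + mom₁ μ Y k := by
  rw [mom₂, mom₁, ← integral_add (hY.bddMeas_two k).integrable (hY.bddMeas_cast k).integrable]
  congr 1 with ω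
  ring

variable [IsProbabilityMeasure μ]

theorem integral_sum_mul (n : ℕ) :
    ∫ ω, (∑ i ∈ Finset.range n, (Y (i + 1) ω : ℝ)) * Y (n + 1) ω ∂μ
      = (∑ i ∈ Finset.range n, mom₁ μ Y (i + 1)) * mom₁ μ Y (n + 1) + mixMom₂ μ Y (n + 1)
        - mom₁ μ Y n * mom₁ μ Y (n + 1) := by
  cases n with
  | zero => simp [mixMom₂, hY.zero, hY.mom₁_zero]
  | succ n =>
    have hpast : BddMeas (past Y n) (fun ω => ∑ i ∈ Finset.range n, (Y (i + 1) ω : ℝ)) :=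
      bddMeas_sum n fun i hi => hY.comp_past (fun y : ℕ => (y : ℝ)) (by omega)
    have hfuture : BddMeas (future Y (n + 2)) (fun ω => (Y (n + 2) ω : ℝ)) :=
      hY.comp_future (fun y : ℕ => (y : ℝ)) le_rfl
    have hfactor := hY.integral_mul (by omega) hpast hfuture
    rw [hY.integral_sum] at hfactor
    simp_rw [Finset.sum_range_succ, add_mul]
    rw [integral_add ((hY.bddMeas_sum_range n).mul (hY.bddMeas_cast _)).integrable
      ((hY.bddMeas_cast _).mul (hY.bddMeas_cast _)).integrable, hfactor]
    simp only [mixMom₂, mom₁, Nat.add_sub_cancel]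
    ring

theorem integral_sum_sq (n : ℕ) : ∫ ω, (∑ i ∈ Finset.range n, (Y (i + 1) ω : ℝ)) ^ 2 ∂μ
    = (∑ i ∈ Finset.range n, mom₁ μ Y (i + 1)) ^ 2 + ∑ i ∈ Finset.range n, mom₁ μ Y (i + 1)
      + 2 * ∑ i ∈ Finset.range n, gammaCoeff (mom₁ μ Y) (mom₂ μ Y) (mixMom₂ μ Y) i := by
  induction n with
  | zero => simp
  | succ n ih =>
    have hsum := hY.bddMeas_sum_range n
    have hlast := hY.bddMeas_cast (n + 1)
    have hsum_sq := (hsum.mul hsum).integrable (μ := μ)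
    have hcross := (hsum.mul hlast).integrable (μ := μ)
    have hlast_sq := (hlast.mul hlast).integrable (μ := μ)
    simp only [← pow_two] at hsum_sq hlast_sq
    have hsum_sq_add_cross : Integrable (fun ω => (∑ i ∈ Finset.range n, (Y (i + 1) ω : ℝ)) ^ 2
        + 2 * ((∑ i ∈ Finset.range n, (Y (i + 1) ω : ℝ)) * Y (n + 1) ω)) μ :=
      hsum_sq.add (hcross.const_mul 2)
    simp_rw [Finset.sum_range_succ, add_sq, mul_assoc]
    rw [integral_add hsum_sq_add_cross hlast_sq,
      integral_add hsum_sq (hcross.const_mul 2), integral_const_mul, ih, hY.integral_sum_mul,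
      hY.integral_sq, gammaCoeff]
    ring

theorem lam_eq (n : ℕ) : lam Y n μ = ∑ i ∈ Finset.range n, mom₁ μ Y (i + 1) := by
  simp_rw [lam, cast_S]
  exact hY.integral_sum n

theorem Gam_eq (n : ℕ) :
    Gam Y n μ = ∑ i ∈ Finset.range n, gammaCoeff (mom₁ μ Y) (mom₂ μ Y) (mixMom₂ μ Y) i := by
  have hsum := hY.bddMeas_sum_range n
  obtain ⟨C, hC⟩ := hsum.bdd
  have hvar := variance_eq_sub (MemLp.of_bound (p := 2) (μ := μ) hsum.meas.aestronglyMeasurable C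
    (Filter.Eventually.of_forall hC))
  simp only [Pi.pow_apply] at hvar
  rw [hY.integral_sum_sq, hY.integral_sum] at hvar
  simp_rw [Gam, hY.lam_eq, cast_S, hvar]
  ring

theorem norm_genFun_sub_compPois_le {n : ℕ} (hmom₁ : ∀ k, mom₁ μ Y k ≤ 1 / 100)
    (hmom₂ : ∀ k, mom₂ μ Y k ≤ mom₁ μ Y k)
    (hM : ∑ k ∈ Finset.range n, majorant (mom₁ μ Y) (mom₂ μ Y) (mixMom₂ μ Y) k
      ≤ 9 / 20 * lam Y n μ) {s : ℂ} (hs : InStrip (lam Y n μ) s)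
    (hre : |s.re| ≤ 1 / (200 * (B + 1))) :
    ‖genFun μ Y (Complex.exp s) n - Complex.exp (lam Y n μ * (Complex.exp s - 1)
        + Gam Y n μ * (Complex.exp s - 1) ^ 2)‖
      ≤ 16 * ratioConst (B + 2) * totalThirdOrder μ Y n * ‖s‖ ^ 3
        * Real.exp (gaussExp (lam Y n μ) s) := by
  have hexpand := (hY.recursionData (norm_exp_pow_le hre) hmom₁ hmom₂ n).norm_sub_exp_le
  rw [← hY.lam_eq, ← hY.Gam_eq, mul_comm (Complex.exp s - 1), ← totalThirdOrder] at hexpand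
  have hexponent : lam Y n μ * (Complex.exp s - 1).re
      + (∑ k ∈ Finset.range n, majorant (mom₁ μ Y) (mom₂ μ Y) (mixMom₂ μ Y) k)
        * ‖Complex.exp s - 1‖ ^ 2 ≤ gaussExp (lam Y n μ) s := by
    refine le_trans ?_ (hs.le_gaussExp le_rfl)
    gcongr
  have := ratioConst_pos (K := B + 2) (by positivity)
  have := totalThirdOrder_nonneg (μ := μ) (Y := Y) n
  calc _ ≤ _ := hexpand
    _ ≤ 2 * ratioConst (B + 2) * ((2 * ‖s‖) ^ 3 * totalThirdOrder μ Y n)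
        * Real.exp (gaussExp (lam Y n μ) s) := by
      gcongr
      exact hs.norm_exp_sub_one_le
    _ = _ := by ring

end BddOneDep
end SumTransform

/-! ### Transfer to point probabilities -/

theorem InStrip.of_abs_re_eq {l ε : ℝ} {s : ℂ} (hl : 1 ≤ l) (hε : 0 < ε) (hε1 : ε ≤ 1 / 2)
    (hre : |s.re| = ε / √l) (him : |s.im| ≤ Real.pi) : InStrip l s where
  one_le := hl
  re_le := hre.trans_le ((div_le_self hε.le (Real.one_le_sqrt.mpr hl)).trans hε1)
  re_sq := by
    have hl0 : 0 < l := by linarith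
    rw [← sq_abs, hre, div_pow, Real.sq_sqrt hl0.le, mul_div_cancel₀ _ hl0.ne']
    nlinarith
  im_le := him

theorem exists_weighted_bound_of_inStrip {ε : ℝ} (hε : 0 < ε) (hε1 : ε ≤ 1 / 2) :
    ∃ C : ℝ, 0 < C ∧ ∀ {l A₂ A₃ A₄ : ℝ} {a : ℤ → ℝ} {P : ℂ → ℂ}, 1 ≤ l → 0 ≤ A₂ → 0 ≤ A₃ →
      0 ≤ A₄ → HasTransform a P →
      (∀ s, InStrip l s → |s.re| ≤ ε → ‖P s‖
        ≤ (A₂ * ‖s‖ ^ 2 + A₃ * ‖s‖ ^ 3 + A₄ * ‖s‖ ^ 4) * Real.exp (gaussExp l s)) →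
      ∀ x : ℤ, (1 + ((x : ℝ) - l) ^ 2 / l) * |a x|
        ≤ C * (A₂ / (l * √l) + A₃ / l ^ 2 + A₄ / (l ^ 2 * √l)) := by
  obtain ⟨C, hC, H⟩ :=
    exists_weighted_bound hε (by linarith) (c := 1 / 100) (by norm_num) 3 4
  refine ⟨C, hC, fun {l A₂ A₃ A₄ a P} hl h₂ h₃ h₄ ha hP x => ?_⟩
  let A : ℕ → ℝ
    | 2 => A₂
    | 3 => A₃
    | 4 => A₄
    | _ => 0
  have hA (m : ℕ) : 0 ≤ A m := by
    unfold A
    split <;> first | assumption | rfl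
  have hsq : √l ^ 2 = l := Real.sq_sqrt (by linarith)
  have hpow₃ : √l ^ 3 = l * √l := by rw [pow_succ, hsq]
  have hpow₄ : √l ^ 4 = l ^ 2 := by rw [pow_mul _ 2 2, hsq]
  have hpow₅ : √l ^ 5 = l ^ 2 * √l := by rw [pow_succ, hpow₄]
  have hbound := H l A a P hl hA ha (fun s hre him => ?_) x
  · simpa [Finset.sum_range_succ, A, hpow₃, hpow₄, hpow₅] using hbound
  · have hs := InStrip.of_abs_re_eq hl hε hε1 hre him
    have hre' : |s.re| ≤ ε := hre.trans_le (div_le_self hε.le (Real.one_le_sqrt.mpr hl))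
    simpa [Finset.sum_range_succ, A, gaussExp] using hP s hs hre'

/-- The standing assumptions on a bounded 1-dependent sequence under which its partial sum is
approximated. -/
structure SmallMoments {Ω : Type*} {mΩ : MeasurableSpace Ω} (μ : Measure Ω) (B n : ℕ)
    (Y : ℕ → Ω → ℕ) : Prop extends BddOneDep μ B Y where
  mom₁_le : ∀ k, mom₁ μ Y k ≤ 1 / 100
  mom₂_le : ∀ k, mom₂ μ Y k ≤ mom₁ μ Y k
  majorant_le : ∑ k ∈ Finset.range n, majorant (mom₁ μ Y) (mom₂ μ Y) (mixMom₂ μ Y) k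
      ≤ 9 / 20 * lam Y n μ
  one_le_lam : 1 ≤ lam Y n μ
  abs_Gam_le : |Gam Y n μ| ≤ 2 / 25 * lam Y n μ

/-- The weights `F` are compared with the compound Poisson measure of parameters `l` and `g` up to
a third order error of size `T`: every measure `b` whose transform `Q` is close, on the strip, to
that of the compound Poisson measure is close to `F`, with constant `C` and with the weight
`1 + (x - l) ^ 2 / l`. -/
structure TransferBound (C l g T : ℝ) (F : ℕ → ℝ) : Prop where
  const_nonneg : 0 ≤ C
  one_le : 1 ≤ l
  abs_le : |g| ≤ 2 / 25 * l
  error_nonneg : 0 ≤ T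
  weighted_le : ∀ {A₂ A₃ A₄ : ℝ} {b : ℤ → ℝ} {Q : ℂ → ℂ}, 0 ≤ A₂ → 0 ≤ A₃ → 0 ≤ A₄ →
    HasTransform b Q →
    (∀ s, InStrip l s →
      ‖Complex.exp (l * (Complex.exp s - 1) + g * (Complex.exp s - 1) ^ 2) - Q s‖
        ≤ (A₂ * ‖s‖ ^ 2 + A₃ * ‖s‖ ^ 3 + A₄ * ‖s‖ ^ 4) * Real.exp (gaussExp l s)) →
    ∀ x : ℕ, (1 + ((x : ℝ) - l) ^ 2 / l) * |F x - b x|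
      ≤ C * (A₂ / (l * √l) + (T + A₃) / l ^ 2 + A₄ / (l ^ 2 * √l))

theorem SmallMoments.exists_transferBound (B : ℕ) :
    ∃ C : ℝ, 0 < C ∧ ∀ {Ω : Type*} [MeasurableSpace Ω] (μ : Measure Ω)
      [IsProbabilityMeasure μ] (n : ℕ) (Y : ℕ → Ω → ℕ), SmallMoments μ B n Y →
      TransferBound C (lam Y n μ) (Gam Y n μ) (totalThirdOrder μ Y n) (pointF Y n μ) := by
  have hε : (1 : ℝ) / (200 * (B + 1)) ≤ 1 / 2 := by
    gcongr
    linarith [Nat.cast_nonneg (α := ℝ) B]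
  obtain ⟨C, hC, H⟩ := exists_weighted_bound_of_inStrip (by positivity) hε
  have := ratioConst_pos (K := B + 2) (by positivity)
  set c := 1 + 16 * ratioConst (B + 2)
  have hc1 : 1 ≤ c := by linarith
  refine ⟨C * c, by positivity, fun {Ω} _ μ _ n Y hY => ?_⟩
  have hl : 0 < lam Y n μ := by linarith [hY.one_le_lam]
  have hT : 0 ≤ totalThirdOrder μ Y n := totalThirdOrder_nonneg n
  refine ⟨by positivity, hY.one_le_lam, hY.abs_Gam_le, hT,
    fun {A₂ A₃ A₄ b Q} h₂ h₃ h₄ hb hQ x => ?_⟩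
  have hbound := H hY.one_le_lam h₂ (A₃ := c * totalThirdOrder μ Y n + A₃) (by positivity) h₄
    ((hY.hasTransform_pointF n).sub hb) (fun s hs hre => ?_) x
  · simp only [zeroExt_natCast, Int.cast_natCast] at hbound
    calc _ ≤ _ := hbound
      _ ≤ C * (c * (A₂ / (lam Y n μ * √(lam Y n μ)))
            + (c * totalThirdOrder μ Y n + c * A₃) / lam Y n μ ^ 2
            + c * (A₄ / (lam Y n μ ^ 2 * √(lam Y n μ)))) := by
        gcongr <;> exact le_mul_of_one_le_left (by positivity) hc1
      _ = _ := by ring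
  · have hgen := hY.norm_genFun_sub_compPois_le hY.mom₁_le hY.mom₂_le hY.majorant_le hs hre
    calc _ ≤ _ := norm_sub_le_norm_sub_add_norm_sub _ _ _
      _ ≤ _ := add_le_add hgen (hQ s hs)
      _ ≤ c * totalThirdOrder μ Y n * ‖s‖ ^ 3 * Real.exp (gaussExp (lam Y n μ) s) + _ := by
        gcongr
        linarith
      _ = _ := by ring

/-- A common bound for the numerical constants in the strip estimates. -/
noncomputable def stripConst : ℝ := 12 * Real.exp 8

theorem le_stripConst : 3000 ≤ stripConst := by
  have hexp : (2 : ℝ) ^ 8 ≤ Real.exp 1 ^ 8 := by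
    gcongr
    linarith [Real.add_one_le_exp 1]
  rw [← Real.exp_nat_mul] at hexp
  norm_num at hexp
  unfold stripConst
  linarith

namespace TransferBound

variable {C l g T : ℝ} {F : ℕ → ℝ} (h : TransferBound C l g T F)
include h

theorem pos : 0 < l := one_pos.trans_le h.one_le

theorem sqrt_le : √l ≤ l := by
  have := h.one_le
  exact Real.sqrt_le_iff.mpr ⟨by linarith, by nlinarith⟩

theorem rescale {c r : ℝ} (hc : 1 ≤ c) (hT : T ≤ c * r) : TransferBound (c * C) l g r F := by
  have := h.const_nonneg
  have := h.pos
  refine ⟨by positivity, h.one_le, h.abs_le,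
    nonneg_of_mul_nonneg_right (h.error_nonneg.trans hT) (by linarith),
    fun {A₂ A₃ A₄ b Q} h₂ h₃ h₄ hb hQ x => (h.weighted_le h₂ h₃ h₄ hb hQ x).trans ?_⟩
  calc C * (A₂ / (l * √l) + (T + A₃) / l ^ 2 + A₄ / (l ^ 2 * √l))
      ≤ C * (c * (A₂ / (l * √l)) + (c * r + c * A₃) / l ^ 2 + c * (A₄ / (l ^ 2 * √l))) := by
        gcongr <;> exact le_mul_of_one_le_left (by positivity) hc
    _ = _ := by ring

theorem weighted_le_mul {M A₂ A₃ A₄ : ℝ} {b : ℤ → ℝ} {Q : ℂ → ℂ} (hM : 1 ≤ M) (h₂ : 0 ≤ A₂)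
    (h₃ : 0 ≤ A₃) (h₄ : 0 ≤ A₄) (hb : HasTransform b Q)
    (hQ : ∀ s, InStrip l s →
      ‖Complex.exp (l * (Complex.exp s - 1) + g * (Complex.exp s - 1) ^ 2) - Q s‖
        ≤ (M * A₂ * ‖s‖ ^ 2 + M * A₃ * ‖s‖ ^ 3 + M * A₄ * ‖s‖ ^ 4)
          * Real.exp (gaussExp l s)) (x : ℕ) :
    (1 + ((x : ℝ) - l) ^ 2 / l) * |F x - b x|
      ≤ M * C * (A₂ / (l * √l) + (T + A₃) / l ^ 2 + A₄ / (l ^ 2 * √l)) := by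
  have := h.const_nonneg
  have := h.pos
  calc _ ≤ C * (M * A₂ / (l * √l) + (T + M * A₃) / l ^ 2 + M * A₄ / (l ^ 2 * √l)) :=
        h.weighted_le (by positivity) (by positivity) (by positivity) hb hQ x
    _ ≤ C * (M * A₂ / (l * √l) + (M * T + M * A₃) / l ^ 2 + M * A₄ / (l ^ 2 * √l)) := by
        gcongr
        exact le_mul_of_one_le_left h.error_nonneg hM
    _ = _ := by ring

theorem pois_le (hg : |g| ≤ 2 * T) (x : ℕ) :
    (1 + ((x : ℝ) - l) ^ 2 / l) * |F x - pois l x| ≤ stripConst * C * (T / (l * √l)) := by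
  have := h.const_nonneg
  have := h.pos
  have := h.error_nonneg
  have := le_stripConst
  have hcoef : 4 * |g| ≤ stripConst / 2 * T := by nlinarith
  calc _ ≤ stripConst / 2 * C * (T / (l * √l) + (T + 0) / l ^ 2 + 0 / (l ^ 2 * √l)) := by
        refine h.weighted_le_mul (by linarith) h.error_nonneg le_rfl le_rfl
          (hasTransform_pois h.pos.le) (fun s hs => ?_) x
        refine (hs.norm_compPois_sub_pois_le h.abs_le).trans ?_
        simp only [mul_zero, zero_mul, add_zero]
        gcongr ?_ * _ * _
    _ ≤ stripConst / 2 * C * (T / (l * √l) + T / (l * √l)) := by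
        rw [add_zero, zero_div, add_zero, pow_two]
        gcongr
        exact h.sqrt_le
    _ = _ := by ring

theorem pois_sub_pois₁_le {r : ℝ} (hg : |g| ≤ 2 * r) (x : ℕ) :
    (1 + ((x : ℝ) - l) ^ 2 / l) * |F x - pois l x - pois₁ l g x|
      ≤ stripConst * C * (r ^ 2 / (l ^ 2 * √l) + T / l ^ 2) := by
  have hg_sq : g ^ 2 ≤ 4 * r ^ 2 := by
    rw [← sq_abs]
    nlinarith [abs_nonneg g]
  have := le_stripConst
  have hcoef : 16 * g ^ 2 ≤ stripConst * r ^ 2 := by nlinarith [sq_nonneg r]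
  rw [sub_sub]
  calc _ ≤ stripConst * C * (0 / (l * √l) + (T + 0) / l ^ 2 + r ^ 2 / (l ^ 2 * √l)) := by
        refine h.weighted_le_mul (by linarith) le_rfl le_rfl (sq_nonneg r)
          ((hasTransform_pois h.pos.le).add (hasTransform_pois₁ h.pos.le g)) (fun s hs => ?_) x
        refine (hs.norm_compPois_sub_pois₁_le h.abs_le).trans ?_
        simp only [mul_zero, zero_mul, zero_add]
        gcongr ?_ * _ * _
    _ = _ := by ring

theorem compPois_le (x : ℕ) :
    (1 + ((x : ℝ) - l) ^ 2 / l) * |F x - compPois l g x| ≤ stripConst * C * (T / l ^ 2) := by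
  have := le_stripConst
  have := h.weighted_le_mul (M := stripConst) (by linarith) le_rfl le_rfl le_rfl
    (hasTransform_compPois l g) (fun s _ => by simp) x
  simpa [zeroExt_natCast] using this

theorem transPois_le (x : ℕ) :
    (1 + ((x : ℝ) - l) ^ 2 / l) * |F x - transPois l g x|
      ≤ stripConst * C * ((T + |g|) / l ^ 2 + Int.fract (-2 * g) / (l * √l)) := by
  have := h.const_nonneg
  have := h.pos
  have := h.abs_le
  have := le_stripConst
  have := Int.fract_nonneg (-2 * g)
  set δ := Int.fract (-2 * g) with hδ
  have hcoef₂ : 4 * δ ≤ stripConst * (δ / 2) := by nlinarith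
  have hcoef₃ : 6 * Real.exp 8 * (|g| + δ) ≤ stripConst * ((|g| + δ) / 2) := by
    unfold stripConst
    linarith
  calc _ ≤ stripConst * C * (δ / 2 / (l * √l) + (T + (|g| + δ) / 2) / l ^ 2
          + 0 / (l ^ 2 * √l)) := by
        refine h.weighted_le_mul (by linarith) (by positivity) (by positivity) le_rfl
          (hasTransform_transPois (by linarith [neg_abs_le g])) (fun s hs => ?_) x
        refine (hs.norm_compPois_sub_transPois_le h.abs_le).trans ?_
        rw [mul_zero, zero_mul, add_zero, ← hδ]
        gcongr (?_ * _ + ?_ * _) * _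
    _ = stripConst * C * ((T + |g| / 2) / l ^ 2 + (δ / (l * √l) + δ / (l * l)) / 2) := by ring
    _ ≤ stripConst * C * ((T + |g|) / l ^ 2 + (δ / (l * √l) + δ / (l * √l)) / 2) := by
        gcongr
        · linarith [abs_nonneg g]
        · exact h.sqrt_le
    _ = _ := by ring

theorem negBin_le (hg : 0 < g) (x : ℕ) :
    (1 + ((x : ℝ) - l) ^ 2 / l) * |F x - negBin (nbR l g) (nbQ l g) x|
      ≤ stripConst * C * (T / l ^ 2 + g ^ 2 / l ^ 3) := by
  have := h.pos
  have := le_stripConst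
  have hgl := (le_abs_self g).trans h.abs_le
  rw [← zeroExt_natCast (negBin _ _)]
  calc _ ≤ stripConst * C * (0 / (l * √l) + (T + g ^ 2 / l) / l ^ 2 + 0 / (l ^ 2 * √l)) := by
        refine h.weighted_le_mul (by linarith) le_rfl (by positivity) le_rfl
          (hasTransform_negBin h.pos hg (by linarith)) (fun s hs => ?_) x
        refine (hs.norm_compPois_sub_negBin_le hg hgl).trans ?_
        simp only [mul_zero, zero_mul, zero_add, add_zero]
        gcongr
        linarith
    _ = _ := by field_simp; ring

theorem binom_le (hg : g < 0) (x : ℕ) :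
    (1 + ((x : ℝ) - l) ^ 2 / l) * |F x - binom (biN l g) (l / biN l g) x|
      ≤ stripConst * C * (T / l ^ 2 + g ^ 2 / l ^ 3) := by
  have := h.const_nonneg
  have := h.pos
  have := h.one_le
  have := le_stripConst
  have hcoef₂ : 24 * (g ^ 2 / l ^ 2) ≤ stripConst * (g ^ 2 / l ^ 2 / 2) := by
    nlinarith [div_nonneg (sq_nonneg g) (sq_nonneg l)]
  have hcoef₃ : 1020 * (g ^ 2 / l) ≤ stripConst * (g ^ 2 / l / 2) := by
    nlinarith [div_nonneg (sq_nonneg g) h.pos.le]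
  rw [← zeroExt_natCast (binom _ _)]
  calc _ ≤ stripConst * C * (g ^ 2 / l ^ 2 / 2 / (l * √l) + (T + g ^ 2 / l / 2) / l ^ 2
          + 0 / (l ^ 2 * √l)) := by
        refine h.weighted_le_mul (by linarith) (by positivity) (by positivity) le_rfl
          (hasTransform_binom _ _) (fun s hs => ?_) x
        refine (hs.norm_compPois_sub_binom_le hg h.abs_le).trans ?_
        rw [mul_zero, zero_mul, add_zero]
        gcongr (?_ * _ + ?_ * _) * _
    _ = stripConst * C * (T / l ^ 2 + (g ^ 2 / (l ^ 2 * (l * √l)) + g ^ 2 / l ^ 3) / 2) := by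
        field_simp; ring
    _ ≤ stripConst * C * (T / l ^ 2 + (g ^ 2 / l ^ 3 + g ^ 2 / l ^ 3) / 2) := by
        gcongr
        calc l ^ 3 ≤ l ^ 3 * √l := le_mul_of_one_le_right (by positivity) (by simpa)
          _ = _ := by ring
    _ = _ := by ring

end TransferBound

/-! ### Moment inequalities -/

section MomentBounds
variable {Ω : Type*} {mΩ : MeasurableSpace Ω} {μ : Measure Ω} {B : ℕ} {Y : ℕ → Ω → ℕ}

/-- The second order contribution of `Y k`: for `k = 1, …, n` these sum to the remainder `R₀`. -/
noncomputable def secondOrder (μ : Measure Ω) (Y : ℕ → Ω → ℕ) (k : ℕ) : ℝ :=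
  mom₂ μ Y k + mom₁ μ Y k ^ 2 + mixMom₂ μ Y k

theorem secondOrder_nonneg (k : ℕ) : 0 ≤ secondOrder μ Y k :=
  add_nonneg (add_nonneg (mom₂_nonneg k) (sq_nonneg _)) (mixMom₂_nonneg k)

theorem sum_range_le_sum_range_succ {u : ℕ → ℝ} (h₀ : u 0 = 0) (hu : ∀ k, 0 ≤ u k) (n : ℕ) :
    ∑ k ∈ Finset.range n, u k ≤ ∑ k ∈ Finset.range n, u (k + 1) := by
  have := Finset.sum_range_succ' u n
  have := Finset.sum_range_succ u n
  have := hu n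
  linarith

theorem abs_gammaCoeff_le_secondOrder (k : ℕ) :
    |gammaCoeff (mom₁ μ Y) (mom₂ μ Y) (mixMom₂ μ Y) k|
      ≤ secondOrder μ Y (k + 1) + secondOrder μ Y k := by
  have := two_mul_le_add_sq (mom₁ μ Y k) (mom₁ μ Y (k + 1))
  have := mom₂_nonneg (μ := μ) (Y := Y) k
  have := mom₂_nonneg (μ := μ) (Y := Y) (k + 1)
  have := mixMom₂_nonneg (μ := μ) (Y := Y) k
  have := mixMom₂_nonneg (μ := μ) (Y := Y) (k + 1)
  have := sq_nonneg (mom₁ μ Y k)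
  have := sq_nonneg (mom₁ μ Y (k + 1))
  have := mul_nonneg (mom₁_nonneg (μ := μ) (Y := Y) k) (mom₁_nonneg (μ := μ) (Y := Y) (k + 1))
  unfold gammaCoeff secondOrder
  exact abs_le.mpr ⟨by linarith, by linarith⟩

section SmallFirstMoment
variable (hmom₁ : ∀ k, mom₁ μ Y k ≤ 1 / 100)
include hmom₁

theorem mom₁_mul_le (i : ℕ) {v : ℝ} (hv : 0 ≤ v) : mom₁ μ Y i * v ≤ 1 / 100 * v :=
  mul_le_mul_of_nonneg_right (hmom₁ i) hv

theorem mom₁_mul_mom₁_le (i j : ℕ) : mom₁ μ Y i * mom₁ μ Y j ≤ 1 / 100 * mom₁ μ Y j :=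
  mom₁_mul_le hmom₁ i (mom₁_nonneg j)

theorem majorant_le (k : ℕ) :
    majorant (mom₁ μ Y) (mom₂ μ Y) (mixMom₂ μ Y) k
      ≤ 0.6 * mom₂ μ Y (k + 1) + 4.75 * mixMom₂ μ Y (k + 1) + 0.05 * mixMom₂ μ Y k
        + 0.02 * mom₁ μ Y (k + 1) := by
  have := mom₁_mul_mom₁_le hmom₁ (k + 1) (k + 1)
  have := mom₁_mul_mom₁_le hmom₁ k (k + 1)
  unfold majorant
  linarith

theorem abs_gammaCoeff_le (k : ℕ) :
    |gammaCoeff (mom₁ μ Y) (mom₂ μ Y) (mixMom₂ μ Y) k|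
      ≤ 1 / 2 * mom₂ μ Y (k + 1) + 1 / 200 * mom₁ μ Y (k + 1)
        + |mixMom₂ μ Y (k + 1) - mom₁ μ Y k * mom₁ μ Y (k + 1)| := by
  have := mom₁_mul_mom₁_le hmom₁ (k + 1) (k + 1)
  have := sq_nonneg (mom₁ μ Y (k + 1))
  have := mom₁_nonneg (μ := μ) (Y := Y) (k + 1)
  have := mom₂_nonneg (μ := μ) (Y := Y) (k + 1)
  have := le_abs_self (mixMom₂ μ Y (k + 1) - mom₁ μ Y k * mom₁ μ Y (k + 1))
  have := neg_abs_le (mixMom₂ μ Y (k + 1) - mom₁ μ Y k * mom₁ μ Y (k + 1))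
  unfold gammaCoeff
  exact abs_le.mpr ⟨by linarith, by linarith⟩

end SmallFirstMoment

namespace BddOneDep

section
variable (hY : BddOneDep μ B Y)
include hY

theorem mixMom₂_zero : mixMom₂ μ Y 0 = 0 := by simp [mixMom₂, hY.zero]

theorem sum_secondOrder_le (n : ℕ) : ∑ k ∈ Finset.range n, secondOrder μ Y k
    ≤ ∑ k ∈ Finset.range n, secondOrder μ Y (k + 1) :=
  sum_range_le_sum_range_succ
    (by simp [secondOrder, mom₂, hY.zero, hY.mom₁_zero, hY.mixMom₂_zero]) secondOrder_nonneg n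

end

variable [IsProbabilityMeasure μ] (hY : BddOneDep μ B Y)
include hY

theorem mom₃_le (k : ℕ) : mom₃ μ Y k ≤ B * mom₂ μ Y k := by
  refine integral_mul_le_mul (hY.bddMeas_three k) (hY.bddMeas_two k) fun ω => ?_
  have := natCast_mul_sub_one_nonneg (Y k ω)
  have hle : (Y k ω : ℝ) ≤ B := Nat.cast_le.mpr (hY.le k ω)
  rw [mul_comm]
  gcongr
  linarith

theorem mixMom₃_le (k : ℕ) : mixMom₃ μ Y k ≤ 2 * B * mixMom₂ μ Y k := by
  have hprod := (hY.bddMeas_cast (k - 1)).mul (hY.bddMeas_cast k)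
  have hle (i : ℕ) (ω : Ω) : (Y i ω : ℝ) ≤ B := Nat.cast_le.mpr (hY.le i ω)
  have hleft := integral_mul_le_mul (μ := μ) (c := B)
    ((hY.bddMeas_two (k - 1)).mul (hY.bddMeas_cast k)) hprod fun ω => by
      nlinarith [hle (k - 1) ω, mul_nonneg (Nat.cast_nonneg (α := ℝ) (Y (k - 1) ω))
        (Nat.cast_nonneg (α := ℝ) (Y k ω))]
  have hright := integral_mul_le_mul (μ := μ) (c := B)
    ((hY.bddMeas_cast (k - 1)).mul (hY.bddMeas_two k)) hprod fun ω => by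
      nlinarith [hle k ω, mul_nonneg (Nat.cast_nonneg (α := ℝ) (Y (k - 1) ω))
        (Nat.cast_nonneg (α := ℝ) (Y k ω))]
  unfold mixMom₃ mixMom₂
  linarith

theorem tripleMom_le (k : ℕ) : tripleMom μ Y k ≤ B * mixMom₂ μ Y k := by
  refine integral_mul_le_mul (((hY.bddMeas_cast (k - 2)).mul (hY.bddMeas_cast (k - 1))).mul
    (hY.bddMeas_cast k)) ((hY.bddMeas_cast (k - 1)).mul (hY.bddMeas_cast k)) fun ω => ?_
  rw [mul_assoc]
  gcongr
  exact hY.le _ ω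

theorem abs_Gam_le_sum (n : ℕ) :
    |Gam Y n μ| ≤ 2 * ∑ k ∈ Finset.range n, secondOrder μ Y (k + 1) := by
  rw [hY.Gam_eq]
  calc _ ≤ ∑ k ∈ Finset.range n, |gammaCoeff (mom₁ μ Y) (mom₂ μ Y) (mixMom₂ μ Y) k| :=
        Finset.abs_sum_le_sum_abs _ _
    _ ≤ ∑ k ∈ Finset.range n, (secondOrder μ Y (k + 1) + secondOrder μ Y k) :=
        Finset.sum_le_sum fun k _ => abs_gammaCoeff_le_secondOrder k
    _ ≤ _ := by
        rw [Finset.sum_add_distrib]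
        linarith [hY.sum_secondOrder_le n]

variable (hmom₁ : ∀ k, mom₁ μ Y k ≤ 1 / 100)
include hmom₁

theorem thirdOrder_le (k : ℕ) :
    thirdOrder (mom₁ μ Y) (mom₂ μ Y) (mom₃ μ Y) (mixMom₂ μ Y) (mixMom₃ μ Y) (tripleMom μ Y) k
      ≤ (3 * B + 1) * secondOrder μ Y (k + 1) + secondOrder μ Y k := by
  have hB : (0 : ℝ) ≤ B := Nat.cast_nonneg B
  have hsmall (i : ℕ) {v : ℝ} (hv : 0 ≤ v) := mom₁_mul_le hmom₁ i hv
  have hm (i : ℕ) := mom₂_nonneg (μ := μ) (Y := Y) i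
  have hq (i : ℕ) := mixMom₂_nonneg (μ := μ) (Y := Y) i
  have hp (i : ℕ) := sq_nonneg (mom₁ μ Y i)
  have hpp := mul_nonneg (mom₁_nonneg (μ := μ) (Y := Y) k)
    (mom₁_nonneg (μ := μ) (Y := Y) (k + 1))
  have hBm := mul_nonneg hB (hm (k + 1))
  have hBp := mul_nonneg hB (hp (k + 1))
  unfold thirdOrder secondOrder
  linarith [hY.mom₃_le (k + 1), hY.mixMom₃_le (k + 1), hY.tripleMom_le (k + 1),
    hsmall (k + 1) (hp (k + 1)), hsmall k (hp k), hsmall (k + 1) (hm (k + 1)),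
    hsmall (k + 1) (hm k), hsmall k (hm (k + 1)), hsmall (k - 1) (hq (k + 1)),
    hsmall k (hq (k + 1)), hsmall (k + 1) (hq (k + 1)), hsmall (k + 1) (hq k),
    hsmall (k - 1) hpp, two_mul_le_add_sq (mom₁ μ Y k) (mom₁ μ Y (k + 1)), hm k, hm (k + 1),
    hq k, hq (k + 1), hp k, hp (k + 1)]

theorem totalThirdOrder_le (n : ℕ) : totalThirdOrder μ Y n
    ≤ (3 * B + 2) * ∑ k ∈ Finset.range n, secondOrder μ Y (k + 1) := by
  calc _ ≤ ∑ k ∈ Finset.range n,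
          ((3 * B + 1) * secondOrder μ Y (k + 1) + secondOrder μ Y k) :=
        Finset.sum_le_sum fun k _ => hY.thirdOrder_le hmom₁ k
    _ ≤ _ := by
        rw [Finset.sum_add_distrib, ← Finset.mul_sum]
        linarith [hY.sum_secondOrder_le n]

section SmallCovariances
variable {n : ℕ} (hm : ∑ k ∈ Finset.range n, mom₂ μ Y (k + 1) ≤ lam Y n μ / 20)
  (hc : ∑ k ∈ Finset.range n, |mixMom₂ μ Y (k + 1) - mom₁ μ Y k * mom₁ μ Y (k + 1)|
    ≤ lam Y n μ / 20)
include hc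

theorem sum_mixMom₂_le : ∑ k ∈ Finset.range n, mixMom₂ μ Y (k + 1) ≤ 6 / 100 * lam Y n μ := by
  have hterm (k : ℕ) : mixMom₂ μ Y (k + 1)
      ≤ |mixMom₂ μ Y (k + 1) - mom₁ μ Y k * mom₁ μ Y (k + 1)|
        + 1 / 100 * mom₁ μ Y (k + 1) := by
    linarith [le_abs_self (mixMom₂ μ Y (k + 1) - mom₁ μ Y k * mom₁ μ Y (k + 1)),
      mom₁_mul_mom₁_le hmom₁ k (k + 1)]
  refine (Finset.sum_le_sum fun k _ => hterm k).trans ?_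
  rw [Finset.sum_add_distrib, ← Finset.mul_sum, ← hY.lam_eq]
  linarith

include hm

theorem sum_majorant_le :
    ∑ k ∈ Finset.range n, majorant (mom₁ μ Y) (mom₂ μ Y) (mixMom₂ μ Y) k
      ≤ 9 / 20 * lam Y n μ := by
  have : 0 ≤ lam Y n μ := integral_nonneg fun _ => Nat.cast_nonneg _
  have := hY.sum_mixMom₂_le hmom₁ hc
  have := sum_range_le_sum_range_succ hY.mixMom₂_zero mixMom₂_nonneg n
  refine (Finset.sum_le_sum fun k _ => majorant_le hmom₁ k).trans ?_
  simp_rw [Finset.sum_add_distrib, ← Finset.mul_sum, ← hY.lam_eq]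
  linarith

theorem abs_Gam_le_lam : |Gam Y n μ| ≤ 2 / 25 * lam Y n μ := by
  rw [hY.Gam_eq]
  refine (Finset.abs_sum_le_sum_abs _ _).trans
    ((Finset.sum_le_sum fun k _ => abs_gammaCoeff_le hmom₁ k).trans ?_)
  simp_rw [Finset.sum_add_distrib, ← Finset.mul_sum, ← hY.lam_eq]
  linarith

theorem smallMoments (hmom₂ : ∀ k, mom₂ μ Y k ≤ mom₁ μ Y k) (hl : 1 ≤ lam Y n μ) :
    SmallMoments μ B n Y where
  toBddOneDep := hY
  mom₁_le := hmom₁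
  mom₂_le := hmom₂
  majorant_le := hY.sum_majorant_le hmom₁ hm hc
  one_le_lam := hl
  abs_Gam_le := hY.abs_Gam_le_lam hmom₁ hm hc

end SmallCovariances

end BddOneDep
end MomentBounds

/-! ### Truncation and the remainders -/

section Truncation
variable {Ω : Type*} {mΩ : MeasurableSpace Ω} {μ : Measure Ω} {m n : ℕ} {X : ℕ → Ω → ℕ}

/-- The variables with index between `1` and `n`, truncated at `B`, the others being `0`. -/
def truncate (n B : ℕ) (X : ℕ → Ω → ℕ) (k : ℕ) (ω : Ω) : ℕ :=
  if k ∈ Finset.Icc 1 n then min (X k ω) B else 0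

theorem truncate_of_mem {k : ℕ} (B : ℕ) (hk : k ∈ Finset.Icc 1 n) :
    truncate n B X k = fun ω => min (X k ω) B := by
  funext ω
  simp only [truncate, hk, if_true]

theorem truncate_of_notMem {k : ℕ} (B : ℕ) (hk : k ∉ Finset.Icc 1 n) :
    truncate n B X k = fun _ => 0 := by
  funext ω
  simp only [truncate, hk, if_false]

theorem truncate_le (B k : ℕ) (ω : Ω) : truncate n B X k ω ≤ B := by
  unfold truncate
  split_ifs
  · exact min_le_right _ _
  · exact Nat.zero_le _

theorem measurable_truncate (B : ℕ) (hX : ∀ k ∈ Finset.Icc 1 n, Measurable (X k)) (k : ℕ) :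
    Measurable (truncate n B X k) := by
  by_cases hk : k ∈ Finset.Icc 1 n
  · rw [truncate_of_mem B hk]
    exact (hX k hk).min measurable_const
  · rw [truncate_of_notMem B hk]
    exact measurable_const

theorem comap_truncate_of_notMem {k : ℕ} (B : ℕ) (hk : k ∉ Finset.Icc 1 n) :
    MeasurableSpace.comap (truncate n B X k) ⊤ = ⊥ := by
  rw [truncate_of_notMem B hk, MeasurableSpace.comap_const]

theorem comap_truncate_le {k : ℕ} (B : ℕ) (hk : k ∈ Finset.Icc 1 n) :
    MeasurableSpace.comap (truncate n B X k) ⊤ ≤ MeasurableSpace.comap (X k) ⊤ := by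
  rw [truncate_of_mem B hk]
  rintro _ ⟨s, -, rfl⟩
  exact ⟨(fun y => min y B) ⁻¹' s, trivial, rfl⟩

theorem comap_truncate_le_iSup (B : ℕ) {I : Finset ℕ} {k : ℕ} (hk : k ∈ Finset.Icc 1 n → k ∈ I) :
    MeasurableSpace.comap (truncate n B X k) ⊤
      ≤ ⨆ i ∈ I, MeasurableSpace.comap (X i) ⊤ := by
  by_cases hkn : k ∈ Finset.Icc 1 n
  · exact (comap_truncate_le B hkn).trans
      (le_iSup₂_of_le (f := fun i (_ : i ∈ I) => MeasurableSpace.comap (X i) ⊤) k (hk hkn) le_rfl)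
  · rw [comap_truncate_of_notMem B hkn]
    exact bot_le

theorem past_truncate_le (n B s : ℕ) (X : ℕ → Ω → ℕ) :
    past (truncate n B X) s ≤ ⨆ i ∈ Finset.Icc 1 s, MeasurableSpace.comap (X i) ⊤ :=
  iSup₂_le fun _ hi => comap_truncate_le_iSup B fun hin =>
    Finset.mem_Icc.mpr ⟨(Finset.mem_Icc.mp hin).1, hi⟩

theorem future_truncate_le (n B t : ℕ) (X : ℕ → Ω → ℕ) :
    future (truncate n B X) t ≤ ⨆ i ∈ Finset.Icc t n, MeasurableSpace.comap (X i) ⊤ :=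
  iSup₂_le fun _ hi => comap_truncate_le_iSup B fun hin =>
    Finset.mem_Icc.mpr ⟨hi, (Finset.mem_Icc.mp hin).2⟩

theorem MDependent.indep [IsProbabilityMeasure μ] (hdep : MDependent m n X μ) {s t : ℕ}
    (hst : s + m < t) :
    Indep (⨆ i ∈ Finset.Icc 1 s, MeasurableSpace.comap (X i) ⊤)
      (⨆ i ∈ Finset.Icc t n, MeasurableSpace.comap (X i) ⊤) μ := by
  rcases Nat.eq_zero_or_pos s with rfl | hs
  · simpa using indep_bot_left _
  · rcases le_or_gt t n with ht | ht
    · exact hdep s t hs hst ht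
    · simpa [Finset.Icc_eq_empty_of_lt ht] using indep_bot_right _

theorem bddOneDep_truncate [IsProbabilityMeasure μ] (B : ℕ)
    (hX : ∀ k ∈ Finset.Icc 1 n, Measurable (X k)) (hdep : MDependent 1 n X μ) :
    BddOneDep μ B (truncate n B X) where
  meas := measurable_truncate B hX
  le := truncate_le B
  zero ω := by simp [truncate]
  indep s t hst := indep_of_indep_of_le (hdep.indep hst) (past_truncate_le n B s X)
    (future_truncate_le n B t X)

theorem ae_rv_eq_truncate {B : ℕ} (hB : ∀ k ∈ Finset.Icc 1 n, ∀ᵐ ω ∂μ, X k ω ≤ B) :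
    ∀ᵐ ω ∂μ, ∀ m : ℤ, m ≤ n → rv X m ω = truncate n B X m.toNat ω := by
  filter_upwards [(Finset.eventually_all _).mpr hB] with ω hω m hm
  unfold rv
  split_ifs with hpos
  · have hk : m.toNat ∈ Finset.Icc 1 n := by
      rw [Finset.mem_Icc]
      omega
    rw [truncate_of_mem B hk]
    simp only [min_eq_left (hω _ hk)]
  · rw [truncate_of_notMem B (by rw [Finset.mem_Icc]; omega)]
    simp

end Truncation

theorem sum_Icc_int_eq_sum_range {M : Type*} [AddCommMonoid M] (f : ℤ → M) (n : ℕ) :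
    ∑ k ∈ Finset.Icc (1 : ℤ) n, f k = ∑ i ∈ Finset.range n, f (i + 1) := by
  refine Finset.sum_nbij' (fun k => (k - 1).toNat) (fun i => (i : ℤ) + 1) ?_ ?_ ?_ ?_ ?_
  all_goals
    simp only [Finset.mem_Icc, Finset.mem_range]
    intro k hk
  case refine_5 => rw [Int.toNat_of_nonneg (by omega), sub_add_cancel]
  all_goals omega

section Transfer
variable {Ω : Type*} {mΩ : MeasurableSpace Ω} {μ : Measure Ω} {n B : ℕ} {X Y : ℕ → Ω → ℕ}
  (hXY : ∀ᵐ ω ∂μ, ∀ m : ℤ, m ≤ n → rv X m ω = Y m.toNat ω)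
include hXY

theorem S_ae_eq : S X n =ᵐ[μ] S Y n := by
  filter_upwards [hXY] with ω hω
  refine Finset.sum_congr rfl fun k hk => ?_
  have hk' := Finset.mem_Icc.mp hk
  have hXYk := hω k (by omega)
  rw [rv, if_pos (by omega), Int.toNat_natCast] at hXYk
  exact_mod_cast hXYk

theorem lam_congr : lam X n μ = lam Y n μ := by
  refine integral_congr_ae ?_
  filter_upwards [S_ae_eq hXY] with ω hω
  rw [hω]

theorem Gam_congr : Gam X n μ = Gam Y n μ := by
  have hS : (fun ω => (S X n ω : ℝ)) =ᵐ[μ] fun ω => (S Y n ω : ℝ) := by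
    filter_upwards [S_ae_eq hXY] with ω hω
    rw [hω]
  rw [Gam, Gam, variance_congr hS, lam_congr hXY]

theorem pointF_congr : pointF X n μ = pointF Y n μ := by
  funext x
  refine measureReal_congr ?_
  filter_upwards [S_ae_eq hXY] with ω hω
  change (S X n ω = x) = (S Y n ω = x)
  rw [hω]

variable {m : ℤ} {k : ℕ} (hm : m ≤ n) (hk : m.toNat = k)
include hm hk

theorem rv_ae_eq : rv X m =ᵐ[μ] fun ω => (Y k ω : ℝ) := by
  filter_upwards [hXY] with ω hω
  rw [hω m hm, hk]

theorem integral_comp_rv (φ : ℝ → ℝ) : ∫ ω, φ (rv X m ω) ∂μ = ∫ ω, φ (Y k ω) ∂μ :=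
  integral_congr_ae ((rv_ae_eq hXY hm hk).fun_comp φ)

theorem integral_comp_rv_rv (φ : ℝ → ℝ → ℝ) :
    ∫ ω, φ (rv X (m - 1) ω) (rv X m ω) ∂μ = ∫ ω, φ (Y (k - 1) ω) (Y k ω) ∂μ := by
  refine integral_congr_ae ?_
  filter_upwards [rv_ae_eq hXY (m := m - 1) (k := k - 1) (by omega) (by omega),
    rv_ae_eq hXY hm hk] with ω h₁ h₂
  rw [h₁, h₂]

theorem nu_one_eq : nu X μ 1 m = mom₁ μ Y k := by
  simpa [nu, mom₁] using integral_comp_rv hXY hm hk id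

theorem nu_two_eq : nu X μ 2 m = mom₂ μ Y k := by
  simpa [nu, mom₂, Finset.prod_range_succ] using integral_comp_rv hXY hm hk fun y => y * (y - 1)

theorem nu_three_eq : nu X μ 3 m = mom₃ μ Y k := by
  simpa [nu, mom₃, Finset.prod_range_succ] using
    integral_comp_rv hXY hm hk fun y => y * (y - 1) * (y - 2)

theorem integral_rv : ∫ ω, rv X m ω ∂μ = mom₁ μ Y k := integral_comp_rv hXY hm hk id

theorem integral_rv_mul_rv : ∫ ω, rv X (m - 1) ω * rv X m ω ∂μ = mixMom₂ μ Y k :=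
  integral_comp_rv_rv hXY hm hk (· * ·)

theorem integral_rv_mul_rv_mul_rv :
    ∫ ω, rv X (m - 2) ω * rv X (m - 1) ω * rv X m ω ∂μ = tripleMom μ Y k := by
  refine integral_congr_ae ?_
  filter_upwards [rv_ae_eq hXY (m := m - 2) (k := k - 2) (by omega) (by omega),
    rv_ae_eq hXY (m := m - 1) (k := k - 1) (by omega) (by omega),
    rv_ae_eq hXY hm hk] with ω h₁ h₂ h₃
  rw [h₁, h₂, h₃]

theorem EPlusTwo_rv : EPlusTwo μ (rv X (m - 1)) (rv X m)
    = mixMom₃ μ Y k + mom₂ μ Y (k - 1) * mom₁ μ Y k + mom₁ μ Y (k - 1) * mom₂ μ Y k := by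
  have hm' : m - 1 ≤ n := by omega
  have hk' : (m - 1).toNat = k - 1 := by omega
  have hleft := integral_comp_rv_rv hXY hm hk fun y z => y * (y - 1) * z
  have hright := integral_comp_rv_rv hXY hm hk fun y z => y * (z * (z - 1))
  have htwo := integral_comp_rv hXY hm hk fun y => y * (y - 1)
  have htwo' := integral_comp_rv hXY hm' hk' fun y => y * (y - 1)
  simp only [EPlusTwo, EPlusPair, hleft, hright, htwo, htwo', integral_rv hXY hm hk,
    integral_rv hXY hm' hk', mixMom₃, mom₂]
  ring

theorem EPlusTriple_rv : EPlusTriple μ (rv X (m - 2)) (rv X (m - 1)) (rv X m)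
    = tripleMom μ Y k + mom₁ μ Y (k - 2) * mixMom₂ μ Y k
      + (mixMom₂ μ Y (k - 1) + mom₁ μ Y (k - 2) * mom₁ μ Y (k - 1)) * mom₁ μ Y k := by
  have hm₁ : m - 1 ≤ n := by omega
  have hk₁ : (m - 1).toNat = k - 1 := by omega
  have hpair := integral_rv_mul_rv hXY hm₁ hk₁
  rw [sub_sub, one_add_one_eq_two] at hpair
  rw [EPlusTriple, EPlusPair, integral_rv_mul_rv_mul_rv hXY hm hk, integral_rv_mul_rv hXY hm hk,
    hpair, integral_rv hXY (m := m - 2) (k := k - 2) (by omega) (by omega),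
    integral_rv hXY hm₁ hk₁, integral_rv hXY hm hk]

theorem covariance_rv [IsProbabilityMeasure μ] (hY : BddOneDep μ B Y) :
    cov[rv X (m - 1), rv X m; μ] = mixMom₂ μ Y k - mom₁ μ Y (k - 1) * mom₁ μ Y k := by
  have hm' : m - 1 ≤ n := by omega
  have hk' : (m - 1).toNat = k - 1 := by omega
  have hL (j : ℕ) : MemLp (fun ω => (Y j ω : ℝ)) 2 μ := by
    obtain ⟨C, hC⟩ := (hY.bddMeas_cast j).bdd
    exact MemLp.of_bound (hY.bddMeas_cast j).meas.aestronglyMeasurable C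
      (Filter.Eventually.of_forall hC)
  rw [covariance_eq_sub ((hL (k - 1)).ae_eq (rv_ae_eq hXY hm' hk').symm)
    ((hL k).ae_eq (rv_ae_eq hXY hm hk).symm), integral_rv hXY hm hk, integral_rv hXY hm' hk']
  exact congrArg (· - _) (integral_rv_mul_rv hXY hm hk)

end Transfer

section Remainders
variable {Ω : Type*} {mΩ : MeasurableSpace Ω} {μ : Measure Ω} {n B : ℕ} {X Y : ℕ → Ω → ℕ}

theorem mom₁_pow_three_add_le_thirdOrder (k : ℕ) :
    mom₁ μ Y (k + 1) ^ 3 + mom₁ μ Y k ^ 3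
      ≤ thirdOrder (mom₁ μ Y) (mom₂ μ Y) (mom₃ μ Y) (mixMom₂ μ Y) (mixMom₃ μ Y)
        (tripleMom μ Y) k := by
  have hp (i : ℕ) := mom₁_nonneg (μ := μ) (Y := Y) i
  have hm (i : ℕ) := mom₂_nonneg (μ := μ) (Y := Y) i
  have hq (i : ℕ) := mixMom₂_nonneg (μ := μ) (Y := Y) i
  have hsum := add_nonneg (add_nonneg (hp (k - 1)) (hp k)) (hp (k + 1))
  unfold thirdOrder
  linarith [mul_nonneg (hp (k + 1)) (hm (k + 1)), mom₃_nonneg (μ := μ) (Y := Y) (k + 1),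
    mul_nonneg hsum (hq (k + 1)), mixMom₃_nonneg (μ := μ) (Y := Y) (k + 1),
    mul_nonneg (hm k) (hp (k + 1)), mul_nonneg (hp k) (hm (k + 1)),
    tripleMom_nonneg (μ := μ) (Y := Y) (k + 1), mul_nonneg (hp (k + 1)) (hq k),
    mul_nonneg (mul_nonneg (hp (k - 1)) (hp k)) (hp (k + 1))]

section
variable (hXY : ∀ᵐ ω ∂μ, ∀ m : ℤ, m ≤ n → rv X m ω = Y m.toNat ω)
include hXY

theorem R₀_eq_sum : R₀ X n μ = ∑ k ∈ Finset.range n, secondOrder μ Y (k + 1) := by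
  rw [R₀, sum_Icc_int_eq_sum_range]
  refine Finset.sum_congr rfl fun k hk => ?_
  have hm : (k : ℤ) + 1 ≤ n := by exact_mod_cast Finset.mem_range.mp hk
  have hk : ((k : ℤ) + 1).toNat = k + 1 := by omega
  rw [nu_two_eq hXY hm hk, nu_one_eq hXY hm hk, integral_rv_mul_rv hXY hm hk, secondOrder]

theorem R₁_eq_sum : R₁ X n μ = ∑ k ∈ Finset.range n,
    (thirdOrder (mom₁ μ Y) (mom₂ μ Y) (mom₃ μ Y) (mixMom₂ μ Y) (mixMom₃ μ Y) (tripleMom μ Y) k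
      - mom₁ μ Y k ^ 3 + mom₁ μ Y (k - 1) * mixMom₂ μ Y (k + 1)) := by
  rw [R₁, sum_Icc_int_eq_sum_range]
  refine Finset.sum_congr rfl fun k hk => ?_
  have hm : (k : ℤ) + 1 ≤ n := by exact_mod_cast Finset.mem_range.mp hk
  have hk : ((k : ℤ) + 1).toNat = k + 1 := by omega
  rw [nu_one_eq hXY hm hk, nu_two_eq hXY hm hk, nu_three_eq hXY hm hk,
    nu_one_eq hXY (m := (k : ℤ) + 1 - 2) (k := k - 1) (by omega) (by omega),
    nu_one_eq hXY (m := (k : ℤ) + 1 - 1) (k := k) (by omega) (by omega),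
    integral_rv_mul_rv hXY hm hk, EPlusTwo_rv hXY hm hk, EPlusTriple_rv hXY hm hk]
  have hsub : k + 1 - 2 = k - 1 := by omega
  simp only [thirdOrder, Nat.add_sub_cancel, hsub]
  ring

theorem totalThirdOrder_le_R₁ (hY : BddOneDep μ B Y) : totalThirdOrder μ Y n ≤ 2 * R₁ X n μ := by
  have hshift := sum_range_le_sum_range_succ (u := fun k => mom₁ μ Y k ^ 3)
    (by simp [hY.mom₁_zero]) (fun k => pow_nonneg (mom₁_nonneg k) 3) n
  have hcube := Finset.sum_le_sum fun k (_ : k ∈ Finset.range n) =>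
    mom₁_pow_three_add_le_thirdOrder (μ := μ) (Y := Y) k
  have hcross : 0 ≤ ∑ k ∈ Finset.range n, mom₁ μ Y (k - 1) * mixMom₂ μ Y (k + 1) :=
    Finset.sum_nonneg fun k _ => mul_nonneg (mom₁_nonneg _) (mixMom₂_nonneg _)
  rw [Finset.sum_add_distrib] at hcube
  rw [R₁_eq_sum hXY, Finset.sum_add_distrib, Finset.sum_sub_distrib]
  unfold totalThirdOrder
  linarith

end

theorem rv_of_nonpos (X : ℕ → Ω → ℕ) {k : ℤ} (hk : k ≤ 0) : rv X k = 0 := by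
  funext ω
  simp [rv, hk]

theorem sum_Icc_two_covariance (μ : Measure Ω) (n : ℕ) (X : ℕ → Ω → ℕ) :
    ∑ k ∈ Finset.Icc (2 : ℤ) n, |cov[rv X (k - 1), rv X k; μ]|
      = ∑ k ∈ Finset.Icc (1 : ℤ) n, |cov[rv X (k - 1), rv X k; μ]| := by
  refine Finset.sum_subset (Finset.Icc_subset_Icc_left (by norm_num)) fun k hk hk' => ?_
  rw [Finset.mem_Icc] at hk hk'
  rw [rv_of_nonpos X (k := k - 1) (by omega), covariance_zero_left, abs_zero]

theorem smallMoments_truncate [IsProbabilityMeasure μ]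
    (hX : ∀ k ∈ Finset.Icc 1 n, Measurable (X k)) (hdep : MDependent 1 n X μ)
    (hXY : ∀ᵐ ω ∂μ, ∀ m : ℤ, m ≤ n → rv X m ω = truncate n B X m.toNat ω)
    (hnu₁ : ∀ k ∈ Finset.Icc 1 n, nu X μ 1 k ≤ 1 / 100)
    (hnu₂ : ∀ k ∈ Finset.Icc 1 n, nu X μ 2 k ≤ nu X μ 1 k) (hl : 1 ≤ lam X n μ)
    (hm : ∑ k ∈ Finset.Icc (1 : ℤ) n, nu X μ 2 k ≤ lam X n μ / 20)
    (hc : ∑ k ∈ Finset.Icc (2 : ℤ) n, |cov[rv X (k - 1), rv X k; μ]| ≤ lam X n μ / 20) :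
    SmallMoments μ B n (truncate n B X) := by
  have hY := bddOneDep_truncate B hX hdep
  have hle {k : ℕ} (hk : k ∈ Finset.Icc 1 n) : (k : ℤ) ≤ n := by
    exact_mod_cast (Finset.mem_Icc.mp hk).2
  have hlt {k : ℕ} (hk : k ∈ Finset.range n) : (k : ℤ) + 1 ≤ n := by
    exact_mod_cast Finset.mem_range.mp hk
  rw [lam_congr hXY] at hl hm hc
  rw [sum_Icc_int_eq_sum_range] at hm
  rw [sum_Icc_two_covariance, sum_Icc_int_eq_sum_range] at hc
  refine hY.smallMoments (fun k => ?_) (le_of_eq_of_le ?_ hm) (le_of_eq_of_le ?_ hc)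
    (fun k => ?_) hl
  · by_cases hk : k ∈ Finset.Icc 1 n
    · exact (nu_one_eq hXY (hle hk) (Int.toNat_natCast k)).symm.trans_le (hnu₁ k hk)
    · simp [mom₁, truncate_of_notMem B hk]
  · exact Finset.sum_congr rfl fun k hk => (nu_two_eq hXY (hlt hk) (by omega)).symm
  · exact Finset.sum_congr rfl fun k hk =>
      congrArg _ (covariance_rv hXY (hlt hk) (k := k + 1) (by omega) hY).symm
  · by_cases hk : k ∈ Finset.Icc 1 n
    · rw [← nu_one_eq hXY (hle hk) (Int.toNat_natCast k),
        ← nu_two_eq hXY (hle hk) (Int.toNat_natCast k)]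
      exact hnu₂ k hk
    · simp [mom₁, mom₂, truncate_of_notMem B hk]

end Remainders

end OneDep

theorem theorem3 (C₀ : ℝ) :
    ∃ C : ℝ, 0 < C ∧
      ∀ {Ω : Type*} [MeasurableSpace Ω] (μ : Measure Ω) [IsProbabilityMeasure μ]
        (n : ℕ) (X : ℕ → Ω → ℕ),
        (∀ k ∈ Finset.Icc 1 n, Measurable (X k)) →
        MDependent 1 n X μ →
        (∀ k ∈ Finset.Icc 1 n,
          nu X μ 1 k ≤ 1 / 100 ∧ nu X μ 2 k ≤ nu X μ 1 k ∧ ∀ᵐ ω ∂μ, (X k ω : ℝ) ≤ C₀) →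
        1 ≤ lam X n μ →
        ∑ k ∈ Finset.Icc (1 : ℤ) n, nu X μ 2 k ≤ lam X n μ / 20 →
        ∑ k ∈ Finset.Icc (2 : ℤ) n, |cov[rv X (k - 1), rv X k; μ]| ≤ lam X n μ / 20 →
        ∀ x : ℕ,
          (1 + ((x : ℝ) - lam X n μ) ^ 2 / lam X n μ)
              * |pointF X n μ x - pois (lam X n μ) x|
            ≤ C * (R₀ X n μ / (lam X n μ * √(lam X n μ))) ∧
          (1 + ((x : ℝ) - lam X n μ) ^ 2 / lam X n μ)
              * |pointF X n μ x - pois (lam X n μ) x - pois₁ (lam X n μ) (Gam X n μ) x|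
            ≤ C * (R₀ X n μ ^ 2 / (lam X n μ ^ 2 * √(lam X n μ)) + R₁ X n μ / lam X n μ ^ 2) ∧
          (1 + ((x : ℝ) - lam X n μ) ^ 2 / lam X n μ)
              * |pointF X n μ x - compPois (lam X n μ) (Gam X n μ) x|
            ≤ C * (R₁ X n μ / lam X n μ ^ 2) ∧
          (1 + ((x : ℝ) - lam X n μ) ^ 2 / lam X n μ)
              * |pointF X n μ x - transPois (lam X n μ) (Gam X n μ) x|
            ≤ C * ((R₁ X n μ + |Gam X n μ|) / lam X n μ ^ 2
                + Int.fract (-2 * Gam X n μ) / (lam X n μ * √(lam X n μ))) ∧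
          (0 < Gam X n μ →
            (1 + ((x : ℝ) - lam X n μ) ^ 2 / lam X n μ)
                * |pointF X n μ x
                    - negBin (nbR (lam X n μ) (Gam X n μ)) (nbQ (lam X n μ) (Gam X n μ)) x|
              ≤ C * (R₁ X n μ / lam X n μ ^ 2 + Gam X n μ ^ 2 / lam X n μ ^ 3)) ∧
          (Gam X n μ < 0 →
            (1 + ((x : ℝ) - lam X n μ) ^ 2 / lam X n μ)
                * |pointF X n μ x
                    - binom (biN (lam X n μ) (Gam X n μ))
                        (lam X n μ / biN (lam X n μ) (Gam X n μ)) x|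
              ≤ C * (R₁ X n μ / lam X n μ ^ 2 + Gam X n μ ^ 2 / lam X n μ ^ 3)) := by
  obtain ⟨C, hC, H⟩ := SmallMoments.exists_transferBound ⌊C₀⌋₊
  set B := ⌊C₀⌋₊
  have hstrip : 0 < stripConst := by linarith [le_stripConst]
  refine ⟨stripConst * ((3 * B + 2) * C), by positivity,
    fun {Ω} _ μ _ n X hX hdep hmom hl hm hc x => ?_⟩
  have hXY := ae_rv_eq_truncate (B := B) fun k hk => by
    filter_upwards [(hmom k hk).2.2] with ω hω using Nat.le_floor hω
  have hY := bddOneDep_truncate B hX hdep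
  have hS := smallMoments_truncate hX hdep hXY (fun k hk => (hmom k hk).1)
    (fun k hk => (hmom k hk).2.1) hl hm hc
  have hG := hY.abs_Gam_le_sum n
  have hT₀ := hY.totalThirdOrder_le hS.mom₁_le n
  have hT₁ := totalThirdOrder_le_R₁ hXY hY
  have h := H μ n _ hS
  rw [← R₀_eq_sum hXY] at hG hT₀
  rw [← lam_congr hXY, ← Gam_congr hXY, ← pointF_congr hXY] at h
  rw [← Gam_congr hXY] at hG
  have : (0 : ℝ) ≤ B := B.cast_nonneg
  have h₀ := h.rescale (c := 3 * B + 2) (by linarith) hT₀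
  have h₁ := h.rescale (c := 3 * B + 2) (r := R₁ X n μ) (by linarith)
    (by nlinarith [h.error_nonneg])
  exact ⟨h₀.pois_le hG x, h₁.pois_sub_pois₁_le hG x, h₁.compPois_le x, h₁.transPois_le x,
    fun hg => h₁.negBin_le hg x, fun hg => h₁.binom_le hg x⟩
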